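/- Let $n\ge 0$ and let $\mathfrak S_{n+1}$ be the symmetric group, with simple transpositions $s_i=(i,i+1)$, $1\le i\le n$, and set $\mathcal T$ of all transpositions. Let $\ell_{\mathcal S}$, $\ell_{\mathcal T}$ be the word lengths with respect to $\mathcal S=\{s_1,\dots,s_n\}$ and $\mathcal T$, and let $<$ be the Bruhat order. Let $\mathcal W_f$ be the set of fully commutative elements (any two reduced $\mathcal S$-words are related by relations $st=ts$, $s,t\in\mathcal S$), let $c=s_1s_2\cdots s_n$, and let $\mathcal P_c=\{x:\ \ell_{\mathcal T}(x)+\ell_{\mathcal T}(x^{-1}c)=\ell_{\mathcal T}(c)\}$ be the set of noncrossing partitions. For $x\in\mathcal P_c$ let $D_x$ (resp. $U_x$) be the set of points in nontrivial cycles of $x$ that are not the maximum (resp. minimum) of their cycle. A fully commutative $w$ has a reduced decomposition $(s_{i_1}s_{i_1-1}\cdots s_{j_1})\cdots(s_{i_\ell}s_{i_\ell-1}\cdots s_{j_\ell})$ with $i_1<\dots<i_\ell$, $j_1<\dots<j_\ell$, $j_m\le i_m$; put $I_w=\{i_1,\dots,i_\ell\}$, $J_w=\{j_1,\dots,j_\ell\}$.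 For $w\in\mathcal W_f$ let $\psi(w)\in\mathcal P_c$ be the element with $D_{\psi(w)}=J_w$ and $U_{\psi(w)}=\{i+1: i\in I_w\}$. Let $\mathrm{TL}_n$ be the unital associative $\mathbb Z[v,v^{-1}]$-algebra with generators $b_1,\dots,b_n$ and relations $b_jb_ib_j=b_j$ if $|i-j|=1$, $b_ib_j=b_jb_i$ if $|i-j|>1$, $b_i^2=(v+v^{-1})b_i$. Let $\mathcal B_{n+1}$ be the braid group with standard generators $\mathbf s_1,\dots,\mathbf s_n$, and $\omega:\mathbb Z[v,v^{-1}]\mathcal B_{n+1}\to\mathrm{TL}_n$ the algebra homomorphism with $\mathbf s_i\mapsto v^{-1}-b_i$ (so $\mathbf s_i^{-1}\mapsto v-b_i$). For a transposition $t=(i,k+1)$, $i\le k$, put $\mathbf t=\mathbf s_k^{-1}\cdots\mathbf s_{i+1}^{-1}\mathbf s_i\mathbf s_{i+1}\cdots\mathbf s_k\in\mathcal B_{n+1}$. For $x\in\mathcal P_c$ with a reduced $\mathcal T$-decomposition $x=t_1\cdots t_k$ (that is, $k=\ell_{\mathcal T}(x)$), let $i_c(x)=\mathbf t_1\cdots\mathbf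 t_k$ and $Z_x=\omega(i_c(x))$. For $w\in\mathcal W_f$ let $L(w)=\{s\in\mathcal S: sw<w\}$ and $R(w)=\{s\in\mathcal S: ws<w\}$. Given $L\subseteq L(w)$ and $R\subseteq R(w)$, as long as there are $s_j\in L$ and $s_r\in R$ with $r\in\{j,j-1\}$, remove either $s_j$ from $L$ or $s_r$ from $R$; any pair $(L',R')$ reached when no such elements are left is called an ending pair for $(L,R)$. Let $Q_w$ be the set of all elements $\bigl(\prod_{s\in L'}s\bigr)\psi(w)\bigl(\prod_{s\in R'}s\bigr)$, where $(L',R')$ runs over the ending pairs for all $(L,R)$ with $L\subseteq L(w)$, $R\subseteq R(w)$. Put $$X_w=\sum_{x\in Q_w}(-1)^{\alpha_w(x)}v^{\beta_w(x)}Z_x,\qquad \alpha_w(x)=\ell_{\mathcal S}(w)+\ell_{\mathcal S}(\psi(w))-\ell_{\mathcal S}(x),\quad \beta_w(x)=\ell_{\mathcal T}(x)-\ell_{\mathcal T}(\psi(w)).$$ Then these objects are well defined: for each $w\in\mathcal W_f$ the element $\psi(w)$ exists and is unique, and $\psi:\mathcal W_f\to\mathcal P_c$ is a bijection; for $x\in\mathcal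 P_c$ the braid $i_c(x)$ does not depend on the chosen reduced $\mathcal T$-decomposition; and $Q_w\subseteq\mathcal P_c$ for all $w\in\mathcal W_f$. Moreover the family $(X_w)_{w\in\mathcal W_f}$ is a basis of the $\mathbb Z[v,v^{-1}]$-module $\mathrm{TL}_n$. -/

import Mathlib

open scoped LaurentPolynomial

namespace TLBasis

/-! ### The symmetric group on `n + 1` points as a Coxeter group of type `A_n`

Points are numbered `0, …, n` and simple reflections `0, …, n - 1`. -/

/-- The simple transposition exchanging the neighbouring points `i` and `i + 1`. -/
def simpleRefl (n : ℕ) (i : Fin n) : Equiv.Perm (Fin (n + 1)) :=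
  Equiv.swap i.castSucc i.succ

/-- The permutation represented by a word in the simple transpositions. -/
def wordProd (n : ℕ) (u : List (Fin n)) : Equiv.Perm (Fin (n + 1)) :=
  (u.map (simpleRefl n)).prod

/-- Length with respect to the simple transpositions. -/
noncomputable def lenS (n : ℕ) (w : Equiv.Perm (Fin (n + 1))) : ℕ :=
  sInf {k : ℕ | ∃ u : List (Fin n), u.length = k ∧ wordProd n u = w}

/-- `u` is a reduced decomposition of `w` into simple transpositions. -/
def IsReducedWord (n : ℕ) (w : Equiv.Perm (Fin (n + 1))) (u : List (Fin n)) : Prop :=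
  wordProd n u = w ∧ u.length = lenS n w

/-- `u'` arises from `u` by one application of a relation `s t = t s` between commuting
simple transpositions. -/
def CommMove (n : ℕ) (u u' : List (Fin n)) : Prop :=
  ∃ (a b : List (Fin n)) (i j : Fin n),
    simpleRefl n i * simpleRefl n j = simpleRefl n j * simpleRefl n i ∧
      u = a ++ i :: j :: b ∧ u' = a ++ j :: i :: b

/-- `w` is fully commutative: any two reduced decompositions are related by commutations. -/
def IsFullyCommutative (n : ℕ) (w : Equiv.Perm (Fin (n + 1))) : Prop :=
  ∀ u u' : List (Fin n), IsReducedWord n w u → IsReducedWord n w u' →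
    Relation.ReflTransGen (CommMove n) u u'

/-- The index set of the transpositions: pairs of points `a < b`. -/
abbrev Transp (n : ℕ) : Type := {p : Fin (n + 1) × Fin (n + 1) // p.1 < p.2}

/-- The transposition exchanging `a` and `b`. -/
def Transp.toPerm {n : ℕ} (t : Transp n) : Equiv.Perm (Fin (n + 1)) :=
  Equiv.swap t.1.1 t.1.2

/-- The permutation represented by a word in all transpositions. -/
def transpProd (n : ℕ) (u : List (Transp n)) : Equiv.Perm (Fin (n + 1)) :=
  (u.map Transp.toPerm).prod

/-- Length with respect to all transpositions. -/
noncomputable def lenT (n : ℕ) (x : Equiv.Perm (Fin (n + 1))) : ℕ :=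
  sInf {k : ℕ | ∃ u : List (Transp n), u.length = k ∧ transpProd n u = x}

/-- `u` is a reduced decomposition of `x` into transpositions. -/
def IsReducedTranspWord (n : ℕ) (x : Equiv.Perm (Fin (n + 1))) (u : List (Transp n)) : Prop :=
  transpProd n u = x ∧ u.length = lenT n x

theorem exists_transpProd (n : ℕ) (x : Equiv.Perm (Fin (n + 1))) :
    ∃ u : List (Transp n), transpProd n u = x := by
  induction x using Equiv.Perm.swap_induction_on with
  | one => exact ⟨[], rfl⟩
  | swap_mul f a b hab ih =>
    obtain ⟨u, hu⟩ := ih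
    rcases lt_or_gt_of_ne hab with h | h
    · exact ⟨⟨(a, b), h⟩ :: u, by simpa [transpProd, Transp.toPerm] using hu⟩
    · refine ⟨⟨(b, a), h⟩ :: u, ?_⟩
      rw [Equiv.swap_comm a b]
      simpa [transpProd, Transp.toPerm] using hu

theorem exists_isReducedTranspWord (n : ℕ) (x : Equiv.Perm (Fin (n + 1))) :
    ∃ u : List (Transp n), IsReducedTranspWord n x u := by
  obtain ⟨u, hu⟩ := exists_transpProd n x
  have hne : {k : ℕ | ∃ u : List (Transp n), u.length = k ∧ transpProd n u = x}.Nonempty :=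
    ⟨u.length, u, rfl, hu⟩
  obtain ⟨u', h1, h2⟩ := Nat.sInf_mem hne
  exact ⟨u', h2, h1⟩

/-- One step `w → w'` of the Bruhat order: `w' = t w` for a transposition `t`, and the length
increases. -/
def BruhatStep (n : ℕ) (w w' : Equiv.Perm (Fin (n + 1))) : Prop :=
  (∃ t : Transp n, w' = t.toPerm * w) ∧ lenS n w < lenS n w'

/-- The strict Bruhat order. -/
def BruhatLT (n : ℕ) : Equiv.Perm (Fin (n + 1)) → Equiv.Perm (Fin (n + 1)) → Prop :=
  Relation.TransGen (BruhatStep n)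

/-- The indices of the simple transpositions `s` with `s w < w`. -/
def leftDescents (n : ℕ) (w : Equiv.Perm (Fin (n + 1))) : Set (Fin n) :=
  {i | BruhatLT n (simpleRefl n i * w) w}

/-- The indices of the simple transpositions `s` with `w s < w`. -/
def rightDescents (n : ℕ) (w : Equiv.Perm (Fin (n + 1))) : Set (Fin n) :=
  {i | BruhatLT n (w * simpleRefl n i) w}

/-! ### Noncrossing partitions -/

/-- The Coxeter element `s_1 s_2 ⋯ s_n`. -/
def coxeterElt (n : ℕ) : Equiv.Perm (Fin (n + 1)) := wordProd n (List.finRange n)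

/-- The noncrossing partitions: the permutations below the Coxeter element in the absolute
order. -/
def NC (n : ℕ) : Set (Equiv.Perm (Fin (n + 1))) :=
  {x | lenT n x + lenT n (x⁻¹ * coxeterElt n) = lenT n (coxeterElt n)}

/-- `m` is a vertex of a polygon of `x`, that is, an element of a nontrivial cycle. -/
def IsVertex {n : ℕ} (x : Equiv.Perm (Fin (n + 1))) (m : Fin (n + 1)) : Prop := x m ≠ m

/-- `m` is an initial vertex: the smallest vertex of its polygon. -/
def IsInitial {n : ℕ} (x : Equiv.Perm (Fin (n + 1))) (m : Fin (n + 1)) : Prop :=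
  IsVertex x m ∧ ∀ m', x.SameCycle m m' → m ≤ m'

/-- `m` is a terminal vertex: the largest vertex of its polygon. -/
def IsTerminal {n : ℕ} (x : Equiv.Perm (Fin (n + 1))) (m : Fin (n + 1)) : Prop :=
  IsVertex x m ∧ ∀ m', x.SameCycle m m' → m' ≤ m

/-- The set `D_x` of non-terminal vertices. -/
def setD {n : ℕ} (x : Equiv.Perm (Fin (n + 1))) : Set (Fin (n + 1)) :=
  {m | IsVertex x m ∧ ¬ IsTerminal x m}

/-- The set `U_x` of non-initial vertices. -/
def setU {n : ℕ} (x : Equiv.Perm (Fin (n + 1))) : Set (Fin (n + 1)) :=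
  {m | IsVertex x m ∧ ¬ IsInitial x m}

/-! ### The bijection between fully commutative elements and noncrossing partitions -/

/-- The word `s_i s_{i-1} ⋯ s_j`. -/
def descRun (n : ℕ) (i j : Fin n) : List (Fin n) :=
  ((List.finRange n).filter (fun m => j ≤ m ∧ m ≤ i)).reverse

/-- `p = [(i_1, j_1), …, (i_l, j_l)]` encodes a reduced decomposition
`(s_{i_1} ⋯ s_{j_1}) ⋯ (s_{i_l} ⋯ s_{j_l})` of `w` into descending runs with
`i_1 < ⋯ < i_l`, `j_1 < ⋯ < j_l` and `j_m ≤ i_m`. -/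
def IsCanonicalForm (n : ℕ) (w : Equiv.Perm (Fin (n + 1))) (p : List (Fin n × Fin n)) : Prop :=
  (p.map Prod.fst).Pairwise (· < ·) ∧ (p.map Prod.snd).Pairwise (· < ·) ∧
    (∀ q ∈ p, q.2 ≤ q.1) ∧ IsReducedWord n w (p.flatMap fun q => descRun n q.1 q.2)

/-- `w` and `x` correspond to each other: `x` is a noncrossing partition with
`(D_x, U_x) = (J_w, I_w + 1)`, where `I_w` and `J_w` are the sets of first and of last indices of
the runs of the canonical form of `w`. -/
def Corresponds (n : ℕ) (w x : Equiv.Perm (Fin (n + 1))) : Prop :=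
  x ∈ NC n ∧ ∃ p : List (Fin n × Fin n), IsCanonicalForm n w p ∧
    setD x = {m | ∃ q ∈ p, m = q.2.castSucc} ∧ setU x = {m | ∃ q ∈ p, m = q.1.succ}

open Classical in
/-- The map `ψ`, sending a fully commutative `w` to the corresponding noncrossing partition.
The default value is used only where no such partition exists. -/
noncomputable def psi (n : ℕ) (w : Equiv.Perm (Fin (n + 1))) : Equiv.Perm (Fin (n + 1)) :=
  if h : ∃ x, Corresponds n w x then h.choose else 1

/-! ### The Temperley-Lieb algebra -/

/-- The defining relations of the Temperley-Lieb algebra; `T 1` is the indeterminate `v`. -/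
inductive TLRel (n : ℕ) : FreeAlgebra ℤ[T;T⁻¹] (Fin n) → FreeAlgebra ℤ[T;T⁻¹] (Fin n) → Prop
  | braid (i j : Fin n) (h : i.val + 1 = j.val ∨ j.val + 1 = i.val) :
      TLRel n (FreeAlgebra.ι _ j * FreeAlgebra.ι _ i * FreeAlgebra.ι _ j) (FreeAlgebra.ι _ j)
  | comm (i j : Fin n) (h : i.val + 1 < j.val ∨ j.val + 1 < i.val) :
      TLRel n (FreeAlgebra.ι _ i * FreeAlgebra.ι _ j) (FreeAlgebra.ι _ j * FreeAlgebra.ι _ i)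
  | sq (i : Fin n) :
      TLRel n (FreeAlgebra.ι _ i * FreeAlgebra.ι _ i)
        ((LaurentPolynomial.T 1 + LaurentPolynomial.T (-1) : ℤ[T;T⁻¹]) • FreeAlgebra.ι _ i)

/-- The Temperley-Lieb algebra `TL_n` over `ℤ[v, v⁻¹]`, with generators `b_1, …, b_n`. -/
def TL (n : ℕ) : Type := RingQuot (TLRel n)

noncomputable instance (n : ℕ) : Ring (TL n) := inferInstanceAs (Ring (RingQuot (TLRel n)))

noncomputable instance (n : ℕ) : Algebra ℤ[T;T⁻¹] (TL n) :=
  inferInstanceAs (Algebra ℤ[T;T⁻¹] (RingQuot (TLRel n)))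

/-- The quotient map from the free algebra. -/
noncomputable def tlMk (n : ℕ) : FreeAlgebra ℤ[T;T⁻¹] (Fin n) →ₐ[ℤ[T;T⁻¹]] TL n :=
  RingQuot.mkAlgHom ℤ[T;T⁻¹] (TLRel n)

theorem tlMk_rel (n : ℕ) {a b : FreeAlgebra ℤ[T;T⁻¹] (Fin n)} (h : TLRel n a b) :
    tlMk n a = tlMk n b :=
  RingQuot.mkAlgHom_rel ℤ[T;T⁻¹] h

/-- The generator `b_i`. -/
noncomputable def tlGen (n : ℕ) (i : Fin n) : TL n :=
  tlMk n (FreeAlgebra.ι _ i)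

theorem tlGen_braid (n : ℕ) (i j : Fin n) (h : i.val + 1 = j.val ∨ j.val + 1 = i.val) :
    tlGen n j * tlGen n i * tlGen n j = tlGen n j := by
  have := tlMk_rel n (TLRel.braid i j h)
  simpa [tlGen] using this

theorem tlGen_comm (n : ℕ) (i j : Fin n) (h : i.val + 1 < j.val ∨ j.val + 1 < i.val) :
    tlGen n i * tlGen n j = tlGen n j * tlGen n i := by
  have := tlMk_rel n (TLRel.comm i j h)
  simpa [tlGen] using this

theorem tlGen_sq (n : ℕ) (i : Fin n) :
    tlGen n i * tlGen n i =
      (LaurentPolynomial.T 1 + LaurentPolynomial.T (-1) : ℤ[T;T⁻¹]) • tlGen n i := by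
  have := tlMk_rel n (TLRel.sq i)
  rw [map_mul, map_smul] at this
  exact this

/-! ### The braid group and its simple elements -/

/-- The braid relations, as words in the free group. -/
inductive IsBraidRelator (n : ℕ) : FreeGroup (Fin n) → Prop
  | braid (i j : Fin n) (h : i.val + 1 = j.val) :
      IsBraidRelator n (FreeGroup.of i * FreeGroup.of j * FreeGroup.of i *
        (FreeGroup.of j * FreeGroup.of i * FreeGroup.of j)⁻¹)
  | comm (i j : Fin n) (h : i.val + 1 < j.val ∨ j.val + 1 < i.val) :
      IsBraidRelator n (FreeGroup.of i * FreeGroup.of j * (FreeGroup.of j * FreeGroup.of i)⁻¹)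

/-- The braid group on `n + 1` strands. -/
abbrev Braid (n : ℕ) : Type := PresentedGroup {r | IsBraidRelator n r}

/-- The braid group generator lifting the simple transposition with index `i`. -/
def braidGen (n : ℕ) (i : Fin n) : Braid n := PresentedGroup.of i

/-- The lift `(s_{a+1} ⋯ s_{b-1})⁻¹ s_a (s_{a+1} ⋯ s_{b-1})` of the transposition `(a, b)` to the
braid group. -/
def braidTransp (n : ℕ) (t : Transp n) : Braid n :=
  let r : Braid n := (((List.finRange n).filter
    (fun i => t.1.1.val < i.val ∧ i.val < t.1.2.val)).map (braidGen n)).prod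
  r⁻¹ * braidGen n ⟨t.1.1.val, lt_of_lt_of_le t.2 (Nat.le_of_lt_succ t.1.2.isLt)⟩ * r

/-- The braid obtained by lifting the letters of a word in the transpositions. -/
def braidTranspProd (n : ℕ) (u : List (Transp n)) : Braid n := (u.map (braidTransp n)).prod

/-- The simple element of the dual braid monoid attached to `x`, inside the braid group: the
lift of a reduced decomposition of `x` into transpositions. For a noncrossing partition `x` it does
not depend on the chosen decomposition. -/
noncomputable def simpleElt (n : ℕ) (x : Equiv.Perm (Fin (n + 1))) : Braid n :=
  braidTranspProd n (exists_isReducedTranspWord n x).choose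

/-! ### The map from the braid group to the Temperley-Lieb algebra -/

/-- The invertible element `v⁻¹ - b_i`, with inverse `v - b_i`. -/
noncomputable def tlUnit (n : ℕ) (i : Fin n) : (TL n)ˣ where
  val := algebraMap ℤ[T;T⁻¹] (TL n) (LaurentPolynomial.T (-1)) - tlGen n i
  inv := algebraMap ℤ[T;T⁻¹] (TL n) (LaurentPolynomial.T 1) - tlGen n i
  val_inv := by
    have h := tlGen_sq n i
    rw [sub_mul, mul_sub, mul_sub, h, ← map_mul, ← LaurentPolynomial.T_add,
      ← Algebra.commutes, ← Algebra.smul_def, ← Algebra.smul_def, add_smul]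
    simp
  inv_val := by
    have h := tlGen_sq n i
    rw [sub_mul, mul_sub, mul_sub, h, ← map_mul, ← LaurentPolynomial.T_add,
      ← Algebra.commutes, ← Algebra.smul_def, ← Algebra.smul_def, add_smul]
    simp

theorem tlUnit_val (n : ℕ) (i : Fin n) :
    (tlUnit n i : TL n) = (LaurentPolynomial.T (-1) : ℤ[T;T⁻¹]) • (1 : TL n) - tlGen n i := by
  rw [← Algebra.algebraMap_eq_smul_one]
  rfl

theorem tlUnit_braid (n : ℕ) (i j : Fin n) (h : i.val + 1 = j.val) :
    tlUnit n i * tlUnit n j * tlUnit n i = tlUnit n j * tlUnit n i * tlUnit n j := by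
  have h1 := tlGen_braid n i j (Or.inl h)
  have h2 := tlGen_braid n j i (Or.inr h)
  have h3 := tlGen_sq n i
  have h4 := tlGen_sq n j
  have hv : (LaurentPolynomial.T (-1) * LaurentPolynomial.T 1 : ℤ[T;T⁻¹]) = 1 := by
    rw [← LaurentPolynomial.T_add]
    simp
  ext
  simp only [Units.val_mul, tlUnit_val, sub_mul, mul_sub, smul_mul_assoc, mul_smul_comm, one_mul,
    mul_one, h1, h2, h3, h4, smul_sub, smul_smul, mul_add, hv]
  module

theorem tlUnit_comm (n : ℕ) (i j : Fin n) (h : i.val + 1 < j.val ∨ j.val + 1 < i.val) :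
    tlUnit n i * tlUnit n j = tlUnit n j * tlUnit n i := by
  have h1 := tlGen_comm n i j h
  ext
  simp only [Units.val_mul, tlUnit_val, sub_mul, mul_sub, smul_mul_assoc, mul_smul_comm, one_mul,
    mul_one, h1, smul_sub]
  module

/-- The group homomorphism sending the `i`-th braid generator to `v⁻¹ - b_i`. -/
noncomputable def omegaUnits (n : ℕ) : Braid n →* (TL n)ˣ :=
  PresentedGroup.toGroup (f := tlUnit n) (by
    rintro r (⟨i, j, h⟩ | ⟨i, j, h⟩)
    · simpa using mul_inv_eq_one.mpr (tlUnit_braid n i j h)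
    · simpa using mul_inv_eq_one.mpr (tlUnit_comm n i j h))

/-- The algebra homomorphism `ω` from the group algebra of the braid group to `TL_n`. -/
noncomputable def omega (n : ℕ) : MonoidAlgebra ℤ[T;T⁻¹] (Braid n) →ₐ[ℤ[T;T⁻¹]] TL n :=
  MonoidAlgebra.lift ℤ[T;T⁻¹] (TL n) (Braid n) ((Units.coeHom (TL n)).comp (omegaUnits n))

/-- The element `Z_x` of Zinno's basis. -/
noncomputable def Z (n : ℕ) (x : Equiv.Perm (Fin (n + 1))) : TL n :=
  omega n (MonoidAlgebra.of ℤ[T;T⁻¹] (Braid n) (simpleElt n x))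

/-! ### The elements `X_w` -/

/-- The pairs `s_i ∈ L`, `s_r ∈ R` with `r = i` or `r = i - 1`, one of which has to be removed. -/
def Conflict {n : ℕ} (i r : Fin n) : Prop := r = i ∨ r.val + 1 = i.val

/-- One step of the removal process on pairs `(L, R)`. -/
inductive RemovalStep (n : ℕ) : Finset (Fin n) × Finset (Fin n) →
    Finset (Fin n) × Finset (Fin n) → Prop
  | left (L R : Finset (Fin n)) (i r : Fin n) (hi : i ∈ L) (hr : r ∈ R) (h : Conflict i r) :
      RemovalStep n (L, R) (L.erase i, R)
  | right (L R : Finset (Fin n)) (i r : Fin n) (hi : i ∈ L) (hr : r ∈ R) (h : Conflict i r) :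
      RemovalStep n (L, R) (L, R.erase r)

/-- `(L', R')` is an ending pair for `(L, R)`. -/
def IsEndingPair (n : ℕ) (L R L' R' : Finset (Fin n)) : Prop :=
  Relation.ReflTransGen (RemovalStep n) (L, R) (L', R') ∧
    ∀ i ∈ L', ∀ r ∈ R', ¬ Conflict i r

/-- The product of the simple transpositions with index in `L`, in increasing order of the indices.
(It is used only for sets of pairwise commuting simple transpositions.) -/
def finsetProd (n : ℕ) (L : Finset (Fin n)) : Equiv.Perm (Fin (n + 1)) :=
  wordProd n (L.sort (· ≤ ·))

/-- The set `Q_w` of the elements `x_{L,R} = (∏_{s ∈ L'} s) ψ(w) (∏_{s ∈ R'} s)`, where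
`L ⊆ L(w)`, `R ⊆ R(w)` and `(L', R')` is an ending pair for `(L, R)`. -/
def Q (n : ℕ) (w : Equiv.Perm (Fin (n + 1))) : Set (Equiv.Perm (Fin (n + 1))) :=
  {x | ∃ L R L' R' : Finset (Fin n),
    (L : Set (Fin n)) ⊆ leftDescents n w ∧ (R : Set (Fin n)) ⊆ rightDescents n w ∧
      IsEndingPair n L R L' R' ∧ x = finsetProd n L' * psi n w * finsetProd n R'}

/-- The exponent `α_w(x)`. -/
noncomputable def alpha (n : ℕ) (w x : Equiv.Perm (Fin (n + 1))) : ℤ :=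
  (lenS n w : ℤ) + (lenS n (psi n w) : ℤ) - (lenS n x : ℤ)

/-- The exponent `β_w(x)`. -/
noncomputable def beta (n : ℕ) (w x : Equiv.Perm (Fin (n + 1))) : ℤ :=
  (lenT n x : ℤ) - (lenT n (psi n w) : ℤ)

/-- The coefficient `(-1)^{α_w(x)} v^{β_w(x)}`. -/
noncomputable def coeff (n : ℕ) (w x : Equiv.Perm (Fin (n + 1))) : ℤ[T;T⁻¹] :=
  LaurentPolynomial.C (((-1 : ℤˣ) ^ alpha n w x : ℤˣ) : ℤ) * LaurentPolynomial.T (beta n w x)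

open Classical in
/-- The element `X_w`, the sum of the `(-1)^{α_w(x)} v^{β_w(x)} Z_x` over `x ∈ Q_w`. -/
noncomputable def X (n : ℕ) (w : Equiv.Perm (Fin (n + 1))) : TL n :=
  ∑ x : Equiv.Perm (Fin (n + 1)) with x ∈ Q n w, coeff n w x • Z n x

end TLBasis

namespace TLBasis

/-! ### Noncrossing permutations -/

/-! Everything is read off from excedances, the points `m` with `m < x m`, and from their values `x
m`. A permutation lies below the Coxeter element exactly when its cycles are increasing and
noncrossing (`mem_NC_iff`). For such `x` the sets D_x and U_x consist of the excedances and of the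
excedance values, and the absolute length is the number of excedances. Fully commutative means
avoiding 321, or equivalently increasing on the excedances and on the non-excedances
(`isFullyCommutative_iff`); J_w and I_w + 1 are again the excedances and their values
(`IsCanonicalForm.spec`). Among the permutations with prescribed excedances and excedance values
exactly one is noncrossing, the minimum of the weight ∑ m · x(m), and exactly one is increasing, the
maximum. Pairing them gives ψ.

A right descent of `w` is an excedance followed by a non-excedance, and a left descent is the
analogous pattern of values. ψ(w) shows the same patterns. Multiplying a noncrossing permutation by
a simple reflection at such a place keeps it noncrossing and raises the weight, and the removal
process ensures that left and right factors do not interfere (`Q_spec`). Hence X_w is ±Z_{ψ(w)} plus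
terms of larger weight, and the X_w span whatever the Z_x span.

The braid lifting `x` is independent of the word by induction on the length: two possible first
letters are always linked by dual braid relations `t_ab t_bc = t_bc t_ac = t_ac t_ab`, or by
commutation of separate or nested transpositions (`IsNoncrossing.confluence_all`).

The Z_x span because their span is stable under right multiplication by the generators
(`mul_tlH_gen_mem`). Write e_{pq} = v⁻¹ - ω(t_{pq}). Right multiplication by e_{pq} turns Z_y into
v⁻¹ Z_y - Z_{y(p q)} when the transposition merges two cycles of `y` in a noncrossing way. In all
other cases, quadratic relations among the e_{pq} reduce the product to simpler ones.

Independence needs no diagram basis. In a representation on configurations of particles, matrix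
coefficients attached to the fully commutative elements are unitriangular on suitable words, which
gives a surjection from TL onto the free module on these elements (`tlCoord_surjective`). Composed
with the surjection given by the X_w it is a surjective endomorphism of a finite free module, hence
injective. -/

theorem perm_inv_apply_self {α : Type*} (x : Equiv.Perm α) (a : α) : x⁻¹ (x a) = a :=
  x.symm_apply_apply a

theorem perm_apply_inv_self {α : Type*} (x : Equiv.Perm α) (a : α) : x (x⁻¹ a) = a :=
  x.apply_symm_apply a

theorem pow_mem_of_forall_mem {α : Type*} (x : Equiv.Perm α) {S : α → Prop}
    (h : ∀ a, S a → S (x a)) (k : ℕ) {a : α} (ha : S a) : S ((x ^ k) a) := by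
  induction k with
  | zero => exact ha
  | succ k ih =>
    rw [pow_succ', Equiv.Perm.mul_apply]
    exact h _ ih

/-- The inverse of a permutation of a finite set is a power of it, so forward stability can be
pulled back. Most contradictions about noncrossing permutations come from a stable interval that
contains `x a` but not `a`. -/
theorem mem_of_apply_mem {α : Type*} [Finite α] (x : Equiv.Perm α) {S : α → Prop}
    (h : ∀ a, S a → S (x a)) {a : α} (ha : S (x a)) : S a := by
  have h1 := pow_mem_of_forall_mem x h (orderOf x - 1) ha
  rwa [← Equiv.Perm.mul_apply, ← pow_succ, Nat.sub_add_cancel (orderOf_pos x),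
    pow_orderOf_eq_one] at h1

theorem mem_of_sameCycle {α : Type*} [Finite α] (x : Equiv.Perm α) {S : α → Prop}
    (h : ∀ a, S a → S (x a)) {a b : α} (hab : x.SameCycle a b) (ha : S a) : S b := by
  obtain ⟨k, rfl⟩ := hab.exists_nat_pow_eq
  exact pow_mem_of_forall_mem x h k ha

/-- The cycles of `x` are increasing and noncrossing: every open interval `(m, x m)` is stable
under `x`. -/
def IsNoncrossing {n : ℕ} (x : Equiv.Perm (Fin (n + 1))) : Prop :=
  ∀ m k, m < k → k < x m → m < x k ∧ x k < x m

/-- The set of excedances. -/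
def excSet {n : ℕ} (x : Equiv.Perm (Fin (n + 1))) : Finset (Fin (n + 1)) :=
  Finset.univ.filter fun m => m < x m

theorem mem_excSet {n : ℕ} {x : Equiv.Perm (Fin (n + 1))} {m : Fin (n + 1)} :
    m ∈ excSet x ↔ m < x m := by
  simp [excSet]

namespace IsNoncrossing

variable {n : ℕ} {x : Equiv.Perm (Fin (n + 1))}

theorem mem_Ioo_of_apply_mem (h : IsNoncrossing x) {m k : Fin (n + 1)} (h1 : m < x k)
    (h2 : x k < x m) : m < k ∧ k < x m :=
  mem_of_apply_mem x (S := fun k => m < k ∧ k < x m) (fun a ha => h m a ha.1 ha.2) ⟨h1, h2⟩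

theorem mem_Ioo_of_sameCycle (h : IsNoncrossing x) {m a b : Fin (n + 1)}
    (hab : x.SameCycle a b) (h1 : m < a) (h2 : a < x m) : m < b ∧ b < x m :=
  mem_of_sameCycle x (S := fun k => m < k ∧ k < x m) (fun a ha => h m a ha.1 ha.2) hab ⟨h1, h2⟩

/-- An arc running backwards closes its cycle: `m` is the maximum and `x m` the minimum, so no other
arc can leave the closed interval. The upper bound is immediate from noncrossing; the lower bound is
obtained by showing stability under the inverse. -/
theorem apply_mem_Icc (h : IsNoncrossing x) {m k : Fin (n + 1)} (hm : x m ≤ m) (h1 : x m ≤ k)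
    (h2 : k ≤ m) : x m ≤ x k ∧ x k ≤ m := by
  have key : ∀ k, x m ≤ k → k ≤ m → x k ≤ m := by
    intro k h1 h2
    by_contra! h3
    have h4 : k ≠ m := by rintro rfl; omega
    have := h k m (by omega) h3
    omega
  have hinv : ∀ w, x m ≤ w ∧ w ≤ m → x m ≤ x⁻¹ w ∧ x⁻¹ w ≤ m := by
    intro w hw
    obtain ⟨v, rfl⟩ := x.surjective w
    rw [perm_inv_apply_self]
    by_contra hv
    have hne : v ≠ m := by rintro rfl; omega
    have hne' : x v ≠ x m := fun he => hne (x.injective he)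
    by_cases hv1 : v < x m
    · have := h.mem_Ioo_of_apply_mem (m := v) (k := m) hv1 (by omega)
      omega
    · have hv2 : m < v := by omega
      -- Some arc must leave the points up to `m`, since otherwise these would form a stable set and
      -- contain `v`. For the rightmost start `u` of such an arc, the interval from `u` (excluded)
      -- to `m` is stable; it contains `x v` but not `v`.
      have hex : ((Finset.univ.filter fun u => u ≤ m ∧ m < x u)).Nonempty := by
        by_contra hne
        have hall : ∀ a, a ≤ m → x a ≤ m := by
          intro a ha
          by_contra! hc
          exact hne ⟨a, by simp [ha, hc]⟩
        have := mem_of_apply_mem x hall hw.2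
        omega
      obtain ⟨u, hu, hmax⟩ := Finset.exists_max_image _ id hex
      simp only [Finset.mem_filter, Finset.mem_univ, true_and, id] at hu hmax
      have hu1 : u < x m := by
        by_contra! hc
        have := key u hc hu.1
        omega
      have hall : ∀ a, u < a ∧ a ≤ m → u < x a ∧ x a ≤ m := by
        intro a ha
        have h5 := h u a ha.1 (by omega)
        refine ⟨h5.1, ?_⟩
        by_contra! hc
        have := hmax a ⟨ha.2, hc⟩
        omega
      have := mem_of_apply_mem x (S := fun a => u < a ∧ a ≤ m) hall (a := v) ⟨by omega, by omega⟩
      omega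
  have := mem_of_apply_mem x⁻¹ (S := fun w => x m ≤ w ∧ w ≤ m) hinv (a := x k)
    (by rw [perm_inv_apply_self]; exact ⟨h1, h2⟩)
  exact this

theorem mem_Icc_of_apply_mem (h : IsNoncrossing x) {m k : Fin (n + 1)} (hm : x m ≤ m)
    (h1 : x m ≤ x k) (h2 : x k ≤ m) : x m ≤ k ∧ k ≤ m :=
  mem_of_apply_mem x (S := fun k => x m ≤ k ∧ k ≤ m)
    (fun _ ha => h.apply_mem_Icc hm ha.1 ha.2) ⟨h1, h2⟩

theorem mem_Icc_of_sameCycle (h : IsNoncrossing x) {m k : Fin (n + 1)} (hm : x m ≤ m)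
    (hk : x.SameCycle m k) : x m ≤ k ∧ k ≤ m :=
  mem_of_sameCycle x (S := fun k => x m ≤ k ∧ k ≤ m)
    (fun _ ha => h.apply_mem_Icc hm ha.1 ha.2) hk ⟨hm, le_rfl⟩

/-- A point that is not an excedance is the maximum of its cycle, and an excedance is visibly not.
This replaces cycle data by excedances, which also make sense for the fully commutative side. -/
theorem setD_eq (h : IsNoncrossing x) : setD x = {m | m < x m} := by
  ext m
  simp only [setD, IsTerminal, IsVertex, Set.mem_ofPred_eq]
  constructor
  · rintro ⟨h1, h2⟩
    by_contra! hc
    exact h2 ⟨h1, fun m' hm' => (h.mem_Icc_of_sameCycle hc hm').2⟩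
  · intro hm
    refine ⟨hm.ne', fun h2 => ?_⟩
    have := h2.2 (x m) ⟨1, by simp⟩
    omega

theorem setU_eq (h : IsNoncrossing x) : setU x = {m | x⁻¹ m < m} := by
  ext m
  obtain ⟨q, rfl⟩ := x.surjective m
  simp only [setU, IsInitial, IsVertex, Set.mem_ofPred_eq, perm_inv_apply_self]
  have hs : x.SameCycle (x q) q := ⟨-1, by simp⟩
  constructor
  · rintro ⟨h1, h2⟩
    by_contra! hc
    exact h2 ⟨h1, fun m' hm' => (h.mem_Icc_of_sameCycle hc (hs.symm.trans hm')).1⟩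
  · intro hm
    refine ⟨fun he => ?_, fun h2 => ?_⟩
    · have := x.injective he
      omega
    · have := h2.2 q hs
      omega

theorem lt_apply_of_sameCycle (h : IsNoncrossing x) {a b : Fin (n + 1)} (hab : a < b)
    (hs : x.SameCycle a b) : a < x a := by
  by_contra! hc
  have := h.mem_Icc_of_sameCycle hc hs
  omega

theorem apply_le_of_sameCycle (h : IsNoncrossing x) {a b : Fin (n + 1)} (hab : a < b)
    (hs : x.SameCycle a b) : x a ≤ b := by
  by_contra! hc
  have := h.mem_Ioo_of_sameCycle hs.symm hab hc
  omega

/-- The interval from `a` to `b` is filled by consecutive arcs of their common cycle, and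
noncrossing makes the interior of each arc stable. The recursion moves `a` along its arc. -/
theorem apply_mem_Ioc (h : IsNoncrossing x) {a b y : Fin (n + 1)} (hab : a < b)
    (hs : x.SameCycle a b) (h1 : a ≤ y) (h2 : y < b) : a < x y ∧ x y ≤ b := by
  have h3 := h.lt_apply_of_sameCycle hab hs
  have h4 := h.apply_le_of_sameCycle hab hs
  rcases eq_or_lt_of_le h1 with rfl | h1
  · exact ⟨h3, h4⟩
  rcases lt_or_ge y (x a) with h5 | h5
  · have := h a y h1 h5
    omega
  · have hlt : x a < b := by omega
    have := h.apply_mem_Ioc (a := x a) hlt (Equiv.Perm.sameCycle_apply_left.mpr hs) h5 h2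
    omega
termination_by b.val - a.val

section Split

variable {a b : Fin (n + 1)}

theorem split_mapsTo (h : IsNoncrossing x) (hab : a < b) (hs : x.SameCycle a b)
    {y : Fin (n + 1)} (hy : a ≤ y ∧ y < b) :
    a ≤ (Equiv.swap a b * x) y ∧ (Equiv.swap a b * x) y < b := by
  have := h.apply_mem_Ioc hab hs hy.1 hy.2
  rw [Equiv.Perm.mul_apply, Equiv.swap_apply_def]
  split_ifs <;> omega

theorem split_mapsTo_compl (h : IsNoncrossing x) (hab : a < b) (hs : x.SameCycle a b)
    {y : Fin (n + 1)} (hy : ¬ (a ≤ y ∧ y < b)) :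
    ¬ (a ≤ (Equiv.swap a b * x) y ∧ (Equiv.swap a b * x) y < b) := fun hc =>
  hy (mem_of_apply_mem _ (S := fun y => a ≤ y ∧ y < b) (fun _ ha => h.split_mapsTo hab hs ha) hc)

/-- Splitting a cycle of a noncrossing permutation. -/
theorem swap_mul (h : IsNoncrossing x) (hab : a < b) (hs : x.SameCycle a b) :
    IsNoncrossing (Equiv.swap a b * x) := by
  intro m k hmk hk
  have e1 := fun y => h.split_mapsTo hab hs (y := y)
  have e2 := fun y => h.split_mapsTo_compl hab hs (y := y)
  have f1 := e1 m
  have f2 := e2 m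
  have f3 := e1 k
  have f4 := e2 k
  have g1 := h m k hmk
  have g2 := fun hm => h.mem_Ioo_of_sameCycle (m := m) hs hm
  have g3 := fun hm => h.mem_Ioo_of_sameCycle (m := m) hs.symm hm
  rw [Equiv.Perm.mul_apply, Equiv.swap_apply_def] at *
  rw [Equiv.Perm.mul_apply, Equiv.swap_apply_def] at *
  have hne : x k ≠ x m := fun he => hmk.ne' (x.injective he)
  split_ifs at * <;> grind

/-- Only the preimages of `a` and `b` get new values. The preimage of `b` is redirected to the
minimum `a` of the block `[a, b)` and stops being an excedance; the preimage of `a` lies outside the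
block and keeps its status. -/
theorem excSet_swap_mul (h : IsNoncrossing x) (hab : a < b) (hs : x.SameCycle a b) :
    excSet (Equiv.swap a b * x) = (excSet x).erase (x⁻¹ b) := by
  ext m
  rw [Finset.mem_erase, mem_excSet, mem_excSet]
  have f1 := h.split_mapsTo hab hs (y := m)
  have f2 := h.split_mapsTo_compl hab hs (y := m)
  have f3 : m = x⁻¹ b ↔ x m = b := by rw [Equiv.Perm.eq_inv_iff_eq]
  rw [Ne, f3]
  rw [Equiv.Perm.mul_apply, Equiv.swap_apply_def] at *
  split_ifs at * <;> grind

theorem card_excSet_swap_mul (h : IsNoncrossing x) (hab : a < b) (hs : x.SameCycle a b) :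
    (excSet (Equiv.swap a b * x)).card + 1 = (excSet x).card := by
  rw [h.excSet_swap_mul hab hs, Finset.card_erase_add_one]
  rw [mem_excSet, perm_apply_inv_self]
  have : (Equiv.swap a b * x) (x⁻¹ b) = a := by simp
  have h1 := fun hc => h.split_mapsTo_compl hab hs (y := x⁻¹ b) hc
  rw [this] at h1
  by_contra hc
  exact h1 (by omega) (by omega)

/-- The `z`-orbit is the `x`-orbit with each excursion across the border of `[a, b)` cut out. -/
theorem sameCycle_swap_mul (h : IsNoncrossing x) (hab : a < b) (hs : x.SameCycle a b)
    {m k : Fin (n + 1)} (hmk : x.SameCycle m k) (hiff : (a ≤ m ∧ m < b) ↔ (a ≤ k ∧ k < b)) :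
    (Equiv.swap a b * x).SameCycle m k := by
  set z := Equiv.swap a b * x with hz
  have e1 : ∀ y, a ≤ y ∧ y < b → a ≤ z y ∧ z y < b := fun y => h.split_mapsTo hab hs
  have e2 : ∀ y, ¬ (a ≤ y ∧ y < b) → ¬ (a ≤ z y ∧ z y < b) := fun y =>
    h.split_mapsTo_compl hab hs
  have step : ∀ y, x y ≠ a → x y ≠ b → z y = x y := fun y h1 h2 => by
    rw [hz, Equiv.Perm.mul_apply, Equiv.swap_apply_of_ne_of_ne h1 h2]
  have stepa : ∀ y, x y = a → z y = b := fun y h1 => by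
    rw [hz, Equiv.Perm.mul_apply, h1, Equiv.swap_apply_left]
  have stepb : ∀ y, x y = b → z y = a := fun y h1 => by
    rw [hz, Equiv.Perm.mul_apply, h1, Equiv.swap_apply_right]
  by_cases hm : a ≤ m ∧ m < b
  · have := mem_of_sameCycle x (S := fun y => ((a ≤ y ∧ y < b) → z.SameCycle m y) ∧
      (¬ (a ≤ y ∧ y < b) → z.SameCycle m a)) ?_ hmk ⟨fun _ => .rfl, fun hc => absurd hm hc⟩
    · exact this.1 (hiff.mp hm)
    · intro y hy
      have f1 := e1 y
      have f2 := e2 y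
      by_cases ha : x y = a
      · rw [ha]
        have := stepa y ha
        have : ¬ (a ≤ y ∧ y < b) := fun hc => by have := f1 hc; omega
        exact ⟨fun _ => hy.2 this, fun hc => by omega⟩
      by_cases hb : x y = b
      · rw [hb]
        have hzy := stepb y hb
        have : (a ≤ y ∧ y < b) := by by_contra hc; have := f2 hc; omega
        refine ⟨fun hc => by omega, fun _ => ?_⟩
        rw [← hzy]
        exact (hy.1 this).apply_right
      have hzy := step y ha hb
      rw [hzy] at f1 f2
      refine ⟨fun hc => ?_, fun hc => hy.2 fun hc' => hc (f1 hc')⟩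
      rw [← hzy]
      refine (hy.1 ?_).apply_right
      by_contra hc'
      exact f2 hc' hc
  · have := mem_of_sameCycle x (S := fun y => (¬ (a ≤ y ∧ y < b) → z.SameCycle m y) ∧
      ((a ≤ y ∧ y < b) → z.SameCycle m b)) ?_ hmk ⟨fun _ => .rfl, fun hc => absurd hc hm⟩
    · exact this.1 (fun hc => hm (hiff.mpr hc))
    · intro y hy
      have f1 := e1 y
      have f2 := e2 y
      by_cases hb : x y = b
      · rw [hb]
        have hzy := stepb y hb
        have : (a ≤ y ∧ y < b) := by by_contra hc; have := f2 hc; omega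
        exact ⟨fun _ => hy.2 this, fun hc => by omega⟩
      by_cases ha : x y = a
      · rw [ha]
        have hzy := stepa y ha
        have : ¬ (a ≤ y ∧ y < b) := fun hc => by have := f1 hc; omega
        refine ⟨fun hc => by omega, fun _ => ?_⟩
        rw [← hzy]
        exact (hy.1 this).apply_right
      have hzy := step y ha hb
      rw [hzy] at f1 f2
      refine ⟨fun hc => ?_, fun hc => hy.2 ?_⟩
      · rw [← hzy]
        exact (hy.1 fun hc' => hc (f1 hc')).apply_right
      · by_contra hc'
        exact f2 hc' hc

end Split

end IsNoncrossing

/-! ### The absolute length and noncrossing partitions -/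

section AbsoluteLength

variable {n : ℕ}

theorem lenT_transpProd_le (u : List (Transp n)) : lenT n (transpProd n u) ≤ u.length :=
  Nat.sInf_le ⟨u, rfl, rfl⟩

theorem transpProd_append (u v : List (Transp n)) :
    transpProd n (u ++ v) = transpProd n u * transpProd n v := by
  simp [transpProd]

theorem transpProd_cons (t : Transp n) (u : List (Transp n)) :
    transpProd n (t :: u) = t.toPerm * transpProd n u := by
  simp [transpProd]

theorem lenT_mul_le (x y : Equiv.Perm (Fin (n + 1))) : lenT n (x * y) ≤ lenT n x + lenT n y := by
  obtain ⟨u, rfl, hu⟩ := exists_isReducedTranspWord n x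
  obtain ⟨v, rfl, hv⟩ := exists_isReducedTranspWord n y
  rw [← transpProd_append, ← hu, ← hv, ← List.length_append]
  exact lenT_transpProd_le _

/-- Only the preimages of `a` and `b` can become excedances. The cases depend on where the preimage
of `a` lies relative to `a` and `b`; in each of them at most one of the two is new. This is what
bounds the absolute length from below. -/
theorem card_excSet_swap_mul_le (x : Equiv.Perm (Fin (n + 1))) (a b : Fin (n + 1)) :
    (excSet (Equiv.swap a b * x)).card ≤ (excSet x).card + 1 := by
  have key : ∃ r, excSet (Equiv.swap a b * x) ⊆ insert r (excSet x) := by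
    by_cases hp : x⁻¹ a < a
    · refine ⟨x⁻¹ b, fun m => ?_⟩
      rw [Finset.mem_insert, mem_excSet, mem_excSet, Equiv.Perm.mul_apply, Equiv.swap_apply_def,
        Equiv.Perm.eq_inv_iff_eq]
      split_ifs with h1 h2
      · rw [← h1, perm_inv_apply_self] at hp
        exact fun _ => Or.inr hp
      · exact fun _ => Or.inl h2
      · exact Or.inr
    · by_cases hq : x⁻¹ a < b
      · refine ⟨x⁻¹ a, fun m => ?_⟩
        rw [Finset.mem_insert, mem_excSet, mem_excSet, Equiv.Perm.mul_apply,
          Equiv.swap_apply_def, Equiv.Perm.eq_inv_iff_eq]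
        split_ifs with h1 h2
        · exact fun _ => Or.inl h1
        · intro h3
          refine Or.inr ?_
          omega
        · exact Or.inr
      · refine ⟨x⁻¹ b, fun m => ?_⟩
        rw [Finset.mem_insert, mem_excSet, mem_excSet, Equiv.Perm.mul_apply,
          Equiv.swap_apply_def, Equiv.Perm.eq_inv_iff_eq]
        split_ifs with h1 h2
        · rw [← h1, perm_inv_apply_self] at hq
          exact fun h => absurd h hq
        · exact fun _ => Or.inl h2
        · exact Or.inr
  obtain ⟨r, hr⟩ := key
  exact (Finset.card_le_card hr).trans (Finset.card_insert_le _ _)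

theorem excSet_one : excSet (1 : Equiv.Perm (Fin (n + 1))) = ∅ := by
  ext m
  simp [excSet]

theorem card_excSet_transpProd_le (u : List (Transp n)) :
    (excSet (transpProd n u)).card ≤ u.length := by
  induction u with
  | nil => simp [transpProd, excSet_one]
  | cons t u ih =>
    rw [transpProd_cons, List.length_cons]
    exact (card_excSet_swap_mul_le _ _ _).trans (by omega)

theorem card_excSet_le_lenT (x : Equiv.Perm (Fin (n + 1))) : (excSet x).card ≤ lenT n x := by
  obtain ⟨u, rfl, hu⟩ := exists_isReducedTranspWord n x
  rw [← hu]
  exact card_excSet_transpProd_le u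

theorem eq_one_of_excSet_eq_empty {x : Equiv.Perm (Fin (n + 1))} (h : excSet x = ∅) : x = 1 := by
  have h1 : ∀ m, x m ≤ m := fun m => by
    by_contra! hc
    rw [← mem_excSet, h] at hc
    simp at hc
  ext m
  suffices x m = m by simp [this]
  by_contra hne
  have := mem_of_apply_mem x⁻¹ (S := fun a => m ≤ a) (fun a ha => ha.trans (by
    have := h1 (x⁻¹ a)
    rwa [perm_apply_inv_self] at this)) (a := x m) (by rw [perm_inv_apply_self])
  have h3 := h1 m
  exact hne (le_antisymm h3 this)

theorem exists_isReducedTranspWord_card_excSet {x : Equiv.Perm (Fin (n + 1))}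
    (h : IsNoncrossing x) : ∃ u, transpProd n u = x ∧ u.length = (excSet x).card := by
  induction hk : (excSet x).card generalizing x with
  | zero =>
    rw [Finset.card_eq_zero] at hk
    exact ⟨[], (eq_one_of_excSet_eq_empty hk).symm, rfl⟩
  | succ k ih =>
    obtain ⟨m, hm⟩ : (excSet x).Nonempty := by
      rw [← Finset.card_pos]
      omega
    rw [mem_excSet] at hm
    have hs : x.SameCycle m (x m) := Equiv.Perm.sameCycle_apply_right.mpr .rfl
    obtain ⟨u, hu, hu'⟩ := ih (h.swap_mul hm hs) (by
      have := h.card_excSet_swap_mul hm hs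
      omega)
    refine ⟨⟨(m, x m), hm⟩ :: u, ?_, by simp [hu']⟩
    rw [transpProd_cons, hu]
    simp [Transp.toPerm]

theorem IsNoncrossing.lenT_eq {x : Equiv.Perm (Fin (n + 1))} (h : IsNoncrossing x) :
    lenT n x = (excSet x).card := by
  obtain ⟨u, rfl, hu'⟩ := exists_isReducedTranspWord_card_excSet h
  exact le_antisymm (hu' ▸ lenT_transpProd_le u) (card_excSet_le_lenT _)

/-- The functions that are constant on the cycles of `x`. -/
def fixSpace (x : Equiv.Perm (Fin (n + 1))) : Submodule ℚ (Fin (n + 1) → ℚ) where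
  carrier := {f | ∀ m, f (x m) = f m}
  add_mem' hf hg m := by simp [hf m, hg m]
  zero_mem' m := rfl
  smul_mem' c f hf m := by simp [hf m]

theorem mem_fixSpace {x : Equiv.Perm (Fin (n + 1))} {f : Fin (n + 1) → ℚ} :
    f ∈ fixSpace x ↔ ∀ m, f (x m) = f m := Iff.rfl

/-- Invariant functions that agree at `a` and `b` remain invariant after the swap, and agreement is
a single linear condition. -/
theorem finrank_fixSpace_le (x : Equiv.Perm (Fin (n + 1))) (a b : Fin (n + 1)) :
    Module.finrank ℚ (fixSpace x) ≤
      Module.finrank ℚ (fixSpace (x * Equiv.swap a b)) + 1 := by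
  let φ : (Fin (n + 1) → ℚ) →ₗ[ℚ] ℚ := (LinearMap.proj a : (Fin (n + 1) → ℚ) →ₗ[ℚ] ℚ) - LinearMap.proj b
  have h1 : fixSpace x ⊓ LinearMap.ker φ ≤ fixSpace (x * Equiv.swap a b) := by
    rintro f ⟨hf, hφ⟩ m
    have hab : f a = f b := by
      have : f a - f b = 0 := hφ
      linarith
    rw [Equiv.Perm.mul_apply, hf, Equiv.swap_apply_def]
    split_ifs with h1 h2
    · rw [h1, hab]
    · rw [h2, hab]
    · rfl
  have h2 := Submodule.finrank_mono h1
  have h3 := Submodule.finrank_sup_add_finrank_inf_eq (fixSpace x) (LinearMap.ker φ)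
  have h4 := LinearMap.finrank_range_add_finrank_ker φ
  have h5 : Module.finrank ℚ (LinearMap.range φ) ≤ 1 := by
    simpa using Submodule.finrank_le (LinearMap.range φ)
  have h6 := Submodule.finrank_le (fixSpace x ⊔ LinearMap.ker φ)
  omega

theorem lt_finrank_fixSpace_add_length (u : List (Transp n)) :
    n + 1 ≤ Module.finrank ℚ (fixSpace (transpProd n u)) + u.length := by
  induction u using List.reverseRecOn with
  | nil =>
    have : fixSpace (transpProd n []) = ⊤ := by
      ext f
      simp [mem_fixSpace, transpProd]
    rw [this, finrank_top]
    simp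
  | append_singleton u t ih =>
    have := finrank_fixSpace_le (transpProd n u) t.1.1 t.1.2
    have e : transpProd n (u ++ [t]) = transpProd n u * Equiv.swap t.1.1 t.1.2 := by
      simp [transpProd, Transp.toPerm]
    rw [e, List.length_append, List.length_singleton]
    omega

theorem lt_finrank_fixSpace_add_lenT (x : Equiv.Perm (Fin (n + 1))) :
    n + 1 ≤ Module.finrank ℚ (fixSpace x) + lenT n x := by
  obtain ⟨u, rfl, hu⟩ := exists_isReducedTranspWord n x
  rw [← hu]
  exact lt_finrank_fixSpace_add_length u

/-- An invariant function is determined by its values off the excedances: following excedances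
upwards must end at a non-excedance. -/
theorem finrank_fixSpace_add_card_excSet_le (x : Equiv.Perm (Fin (n + 1))) :
    Module.finrank ℚ (fixSpace x) + (excSet x).card ≤ n + 1 := by
  let r : fixSpace x →ₗ[ℚ] ({m // m ∉ excSet x} → ℚ) :=
    (LinearMap.funLeft ℚ ℚ Subtype.val).comp (fixSpace x).subtype
  have hr : Function.Injective r := by
    rw [← LinearMap.ker_eq_bot, LinearMap.ker_eq_bot']
    rintro ⟨f, hf⟩ h0
    have hz : ∀ m, x m ≤ m → f m = 0 := fun m hm =>
      congrFun h0 ⟨m, by rw [mem_excSet]; omega⟩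
    have : ∀ k : ℕ, ∀ m : Fin (n + 1), n ≤ m.val + k → f m = 0 := by
      intro k
      induction k with
      | zero => exact fun m hm => hz m (by omega)
      | succ k ih =>
        intro m hm
        by_cases hx : m < x m
        · rw [← hf m]
          exact ih _ (by omega)
        · exact hz m (by omega)
    ext m
    exact this n m (by omega)
  have h1 := LinearMap.finrank_le_finrank_of_injective hr
  rw [Module.finrank_fintype_fun_eq_card, Fintype.card_subtype_compl, Fintype.card_fin,
    Fintype.card_coe] at h1
  have := Finset.card_le_univ (excSet x)
  rw [Fintype.card_fin] at this
  omega

/-- The swap joins two different cycles, so a function invariant under the product is constant on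
their union. -/
theorem fixSpace_mul_swap_le {x : Equiv.Perm (Fin (n + 1))} {a b : Fin (n + 1)}
    (h : ¬ x.SameCycle a b) : fixSpace (x * Equiv.swap a b) ≤ fixSpace x := by
  intro f hf
  have ha : f (x b) = f a := by simpa using hf a
  have hb : f (x a) = f b := by simpa using hf b
  have hne : ∀ m, m ≠ a → m ≠ b → f (x m) = f m := fun m h1 h2 => by
    simpa [Equiv.swap_apply_of_ne_of_ne h1 h2] using hf m
  have key : f b = f (x b) := by
    -- Up to its first return to `b`, the `x`-orbit of `b` meets neither `a` nor `b`, so `f` is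
    -- constant along it.
    have hex : ∃ k, (x ^ (k + 1)) b = b :=
      ⟨orderOf x - 1, by rw [Nat.sub_add_cancel (orderOf_pos x), pow_orderOf_eq_one]; rfl⟩
    classical
    have : ∀ j ≤ Nat.find hex, f ((x ^ (j + 1)) b) = f (x b) := by
      intro j
      induction j with
      | zero => simp
      | succ j ih =>
        intro hj
        rw [pow_succ', Equiv.Perm.mul_apply, hne, ih (by omega)]
        · rintro rfl
          exact h (Equiv.Perm.SameCycle.symm ⟨(j + 1 : ℕ), by rw [zpow_natCast]⟩)
        · exact Nat.find_min hex (by omega)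
    rw [← this _ le_rfl, Nat.find_spec hex]
  intro m
  by_cases h1 : m = a
  · rw [h1, hb, key, ha]
  by_cases h2 : m = b
  · rw [h2, key]
  exact hne m h1 h2

/-- If the cycles were different, the fixed space would not grow, so the length of the product would
be at least the codimension of the fixed space of `x`. That codimension is at least the number of
excedances, which is `lenT n x`. -/
theorem IsNoncrossing.sameCycle_of_lenT_mul_lt {x : Equiv.Perm (Fin (n + 1))}
    (h : IsNoncrossing x) {a b : Fin (n + 1)}
    (hlt : lenT n (x * Equiv.swap a b) < lenT n x) : x.SameCycle a b := by
  by_contra hc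
  have h1 := Submodule.finrank_mono (fixSpace_mul_swap_le hc)
  have h2 := lt_finrank_fixSpace_add_lenT (x * Equiv.swap a b)
  have h3 := finrank_fixSpace_add_card_excSet_le x
  rw [h.lenT_eq] at hlt
  omega

theorem IsNoncrossing.sameCycle_of_lenT_swap_mul_lt {x : Equiv.Perm (Fin (n + 1))}
    (h : IsNoncrossing x) {a b : Fin (n + 1)}
    (hlt : lenT n (Equiv.swap a b * x) < lenT n x) : x.SameCycle a b := by
  rw [Equiv.swap_mul_eq_mul_swap] at hlt
  have := h.sameCycle_of_lenT_mul_lt hlt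
  rwa [← Equiv.Perm.sameCycle_apply_left, perm_apply_inv_self,
    ← Equiv.Perm.sameCycle_apply_right, perm_apply_inv_self] at this

theorem IsNoncrossing.swap_mul' {x : Equiv.Perm (Fin (n + 1))} (h : IsNoncrossing x)
    {a b : Fin (n + 1)} (hab : a ≠ b) (hs : x.SameCycle a b) :
    IsNoncrossing (Equiv.swap a b * x) ∧
      (excSet (Equiv.swap a b * x)).card + 1 = (excSet x).card := by
  rcases lt_or_gt_of_ne hab with h1 | h1
  · exact ⟨h.swap_mul h1 hs, h.card_excSet_swap_mul h1 hs⟩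
  · rw [Equiv.swap_comm]
    exact ⟨h.swap_mul h1 hs.symm, h.card_excSet_swap_mul h1 hs.symm⟩

theorem IsNoncrossing.mul_swap {x : Equiv.Perm (Fin (n + 1))} (h : IsNoncrossing x)
    {a b : Fin (n + 1)} (hab : a ≠ b) (hs : x.SameCycle a b) :
    IsNoncrossing (x * Equiv.swap a b) ∧
      (excSet (x * Equiv.swap a b)).card + 1 = (excSet x).card := by
  rw [Equiv.mul_swap_eq_swap_mul]
  refine h.swap_mul' (fun he => hab (x.injective he)) ?_
  rwa [Equiv.Perm.sameCycle_apply_left, Equiv.Perm.sameCycle_apply_right]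

theorem simpleRefl_apply_castSucc (i : Fin n) : simpleRefl n i i.castSucc = i.succ :=
  Equiv.swap_apply_left _ _

theorem simpleRefl_apply_succ (i : Fin n) : simpleRefl n i i.succ = i.castSucc :=
  Equiv.swap_apply_right _ _

theorem simpleRefl_apply_val (i : Fin n) (m : Fin (n + 1)) : (simpleRefl n i m).val =
    if m.val = i.val then i.val + 1 else if m.val = i.val + 1 then i.val else m.val := by
  rw [simpleRefl, Equiv.swap_apply_def]
  simp only [Fin.ext_iff, Fin.val_castSucc, Fin.val_succ]
  split_ifs <;> simp [*]

theorem wordProd_take_finRange_apply_val (k : ℕ) (hk : k ≤ n) (m : Fin (n + 1)) :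
    (wordProd n ((List.finRange n).take k) m).val =
      if m.val < k then m.val + 1 else if m.val = k then 0 else m.val := by
  induction k generalizing m with
  | zero =>
    simp [wordProd]
  | succ k ih =>
    have h1 : wordProd n ((List.finRange n).take (k + 1)) =
        wordProd n ((List.finRange n).take k) * simpleRefl n ⟨k, hk⟩ := by
      rw [List.take_succ_eq_append_getElem (by simpa using hk)]
      simp [wordProd]
    rw [h1, Equiv.Perm.mul_apply, ih (by omega), simpleRefl_apply_val]
    dsimp only
    split_ifs <;> omega

theorem coxeterElt_apply_val (m : Fin (n + 1)) :
    (coxeterElt n m).val = if m.val < n then m.val + 1 else 0 := by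
  have h := wordProd_take_finRange_apply_val n le_rfl m
  rw [List.take_of_length_le (by simp)] at h
  rw [coxeterElt, h]
  split_ifs <;> omega

theorem isNoncrossing_coxeterElt : IsNoncrossing (coxeterElt n) := by
  intro m k h1 h2
  have h3 := coxeterElt_apply_val m
  have h4 := coxeterElt_apply_val k
  split_ifs at h3 h4 <;> omega

theorem excSet_coxeterElt : excSet (coxeterElt n) = Finset.univ.erase (Fin.last n) := by
  ext m
  rw [mem_excSet]
  have h3 := coxeterElt_apply_val m
  simp only [Finset.mem_erase, Finset.mem_univ, and_true, Ne, Fin.ext_iff, Fin.val_last]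
  split_ifs at h3 <;> omega

theorem lenT_coxeterElt : lenT n (coxeterElt n) = n := by
  rw [isNoncrossing_coxeterElt.lenT_eq, excSet_coxeterElt, Finset.card_erase_of_mem (by simp)]
  simp

theorem coxeterElt_apply_val_of_lt {m : Fin (n + 1)} (h : m.val < n) :
    (coxeterElt n m).val = m.val + 1 := by
  rw [coxeterElt_apply_val, if_pos h]

/-- The Kreweras complement of a noncrossing permutation is noncrossing. -/
theorem IsNoncrossing.inv_mul_coxeterElt {x : Equiv.Perm (Fin (n + 1))} (h : IsNoncrossing x) :
    IsNoncrossing (x⁻¹ * coxeterElt n) := by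
  intro m k h1 h2
  rw [Equiv.Perm.mul_apply] at *
  rw [Equiv.Perm.mul_apply]
  have hm := coxeterElt_apply_val_of_lt (m := m) (by omega)
  have hk := coxeterElt_apply_val_of_lt (m := k) (by omega)
  generalize coxeterElt n m = M at *
  generalize coxeterElt n k = K at *
  have h3 : x (x⁻¹ M) = M := perm_apply_inv_self _ _
  have h4 : x (x⁻¹ K) = K := perm_apply_inv_self _ _
  have h5 := h.mem_Icc_of_apply_mem (m := x⁻¹ M) (k := x⁻¹ K) (by omega) (by omega) (by omega)
  have h6 : x⁻¹ K ≠ x⁻¹ M := fun he => by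
    have := x⁻¹.injective he
    omega
  omega

/-- The Coxeter element raises every point but the last by one, so the excedances of the complement
correspond to the nonzero points that are not excedance values of `x`. -/
theorem card_excSet_inv_mul_coxeterElt (x : Equiv.Perm (Fin (n + 1))) :
    (excSet (x⁻¹ * coxeterElt n)).card + (excSet x).card = n := by
  have h1 : (excSet x).map x.toEmbedding = Finset.univ.filter fun m => x⁻¹ m < m := by
    ext m
    obtain ⟨q, rfl⟩ := x.surjective m
    simp [mem_excSet]
  have h2 : (excSet (x⁻¹ * coxeterElt n)).map (coxeterElt n).toEmbedding =
      ((Finset.univ.filter fun m => ¬ x⁻¹ m < m)).erase 0 := by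
    ext m
    obtain ⟨q, rfl⟩ := (coxeterElt n).surjective m
    simp only [Finset.mem_map_equiv, Finset.mem_erase, mem_excSet, Equiv.symm_apply_apply,
      Finset.mem_filter, Finset.mem_univ, true_and, Equiv.Perm.mul_apply, Ne, Fin.ext_iff,
      Fin.val_zero]
    have := coxeterElt_apply_val q
    split_ifs at this <;> omega
  have h3 := Finset.card_filter_add_card_filter_not (s := (Finset.univ : Finset (Fin (n + 1))))
    (fun m => x⁻¹ m < m)
  have h4 := congrArg Finset.card h1
  have h5 := congrArg Finset.card h2
  rw [Finset.card_map] at h4 h5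
  rw [Finset.card_erase_of_mem (by simp)] at h5
  rw [Finset.card_univ, Fintype.card_fin] at h3
  have h6 : 0 < (Finset.univ.filter fun m => ¬ x⁻¹ m < m).card :=
    Finset.card_pos.mpr ⟨0, by simp⟩
  omega

theorem IsNoncrossing.mem_NC {x : Equiv.Perm (Fin (n + 1))} (h : IsNoncrossing x) :
    x ∈ NC n := by
  change _ = _
  rw [h.lenT_eq, h.inv_mul_coxeterElt.lenT_eq, lenT_coxeterElt, add_comm,
    card_excSet_inv_mul_coxeterElt]

/-- The letters are peeled off from the right. Each of them lowers the length, hence joins two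
points of one cycle and splits it, which keeps the permutation noncrossing. -/
theorem IsNoncrossing.of_mul_transpProd {x : Equiv.Perm (Fin (n + 1))} (u : List (Transp n))
    (h : IsNoncrossing (x * transpProd n u))
    (hl : lenT n x + u.length = lenT n (x * transpProd n u)) : IsNoncrossing x := by
  induction u using List.reverseRecOn with
  | nil => simpa [transpProd] using h
  | append_singleton u t ih =>
    have e : x * transpProd n (u ++ [t]) * Equiv.swap t.1.1 t.1.2 = x * transpProd n u := by
      rw [transpProd_append, transpProd_cons, ← mul_assoc]
      simp [transpProd, Transp.toPerm, mul_assoc]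
    have h1 : lenT n (x * transpProd n u) ≤ lenT n x + u.length :=
      (lenT_mul_le _ _).trans (Nat.add_le_add_left (lenT_transpProd_le u) _)
    rw [List.length_append, List.length_singleton] at hl
    have hs := h.sameCycle_of_lenT_mul_lt (a := t.1.1) (b := t.1.2) (by rw [e]; omega)
    have h2 := h.mul_swap t.2.ne hs
    rw [e] at h2
    refine ih h2.1 ?_
    rw [h2.1.lenT_eq]
    rw [h.lenT_eq] at hl
    omega

theorem mem_NC_iff {x : Equiv.Perm (Fin (n + 1))} : x ∈ NC n ↔ IsNoncrossing x := by
  refine ⟨fun h => ?_, IsNoncrossing.mem_NC⟩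
  obtain ⟨u, hu, hl⟩ := exists_isReducedTranspWord n (x⁻¹ * coxeterElt n)
  refine IsNoncrossing.of_mul_transpProd u ?_ ?_
  · rw [hu, mul_inv_cancel_left]
    exact isNoncrossing_coxeterElt
  · rw [hu, mul_inv_cancel_left, hl]
    exact h

end AbsoluteLength

/-! ### Inversions, descents and fully commutative elements -/

section Length

variable {n : ℕ}

/-- The set of inversions. -/
def invSet (w : Equiv.Perm (Fin (n + 1))) : Finset (Fin (n + 1) × Fin (n + 1)) :=
  Finset.univ.filter fun p => p.1 < p.2 ∧ w p.2 < w p.1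

theorem mem_invSet {w : Equiv.Perm (Fin (n + 1))} {p : Fin (n + 1) × Fin (n + 1)} :
    p ∈ invSet w ↔ p.1 < p.2 ∧ w p.2 < w p.1 := by
  simp [invSet]

theorem simpleRefl_mul_self (i : Fin n) : simpleRefl n i * simpleRefl n i = 1 :=
  Equiv.swap_mul_self _ _

theorem simpleRefl_inv (i : Fin n) : (simpleRefl n i)⁻¹ = simpleRefl n i :=
  Equiv.swap_inv _ _

theorem card_invSet_mul_simpleRefl {w : Equiv.Perm (Fin (n + 1))} {i : Fin n}
    (h : w i.castSucc < w i.succ) :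
    (invSet (w * simpleRefl n i)).card = (invSet w).card + 1 := by
  have h1 : (invSet (w * simpleRefl n i)).erase (i.castSucc, i.succ) =
      (invSet w).map ((simpleRefl n i).prodCongr (simpleRefl n i)).toEmbedding := by
    ext ⟨a, b⟩
    have e : ((simpleRefl n i).prodCongr (simpleRefl n i)).symm (a, b) =
        (simpleRefl n i a, simpleRefl n i b) := rfl
    rw [Finset.mem_map_equiv, e, Finset.mem_erase, mem_invSet, mem_invSet]
    simp only [Equiv.Perm.mul_apply, Ne, Prod.mk.injEq, ← and_assoc]
    refine and_congr_left fun hw => ?_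
    have ha := simpleRefl_apply_val i a
    have hb := simpleRefl_apply_val i b
    have h2 : ¬ (a = i.succ ∧ b = i.castSucc) := by
      rintro ⟨rfl, rfl⟩
      rw [simpleRefl_apply_castSucc, simpleRefl_apply_succ] at hw
      omega
    rw [Fin.ext_iff, Fin.ext_iff, Fin.val_succ, Fin.val_castSucc] at *
    split_ifs at ha hb <;> omega
  have h2 := congrArg Finset.card h1
  rw [Finset.card_map, Finset.card_erase_of_mem] at h2
  · have : 0 < (invSet (w * simpleRefl n i)).card := Finset.card_pos.mpr ⟨(i.castSucc, i.succ), by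
      rw [mem_invSet]
      simpa [simpleRefl_apply_castSucc, simpleRefl_apply_succ] using h⟩
    omega
  · rw [mem_invSet]
    simpa [simpleRefl_apply_castSucc, simpleRefl_apply_succ] using h

theorem card_invSet_mul_simpleRefl_of_gt {w : Equiv.Perm (Fin (n + 1))} {i : Fin n}
    (h : w i.succ < w i.castSucc) :
    (invSet (w * simpleRefl n i)).card + 1 = (invSet w).card := by
  have := card_invSet_mul_simpleRefl (w := w * simpleRefl n i) (i := i)
    (by simpa [simpleRefl_apply_castSucc, simpleRefl_apply_succ] using h)
  rw [mul_assoc, simpleRefl_mul_self, mul_one] at this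
  exact this.symm

theorem apply_castSucc_ne_apply_succ (w : Equiv.Perm (Fin (n + 1))) (i : Fin n) :
    w i.castSucc ≠ w i.succ := fun h => by
  have := w.injective h
  simp [Fin.ext_iff] at this

theorem wordProd_append (u v : List (Fin n)) :
    wordProd n (u ++ v) = wordProd n u * wordProd n v := by
  simp [wordProd]

theorem wordProd_cons (i : Fin n) (u : List (Fin n)) :
    wordProd n (i :: u) = simpleRefl n i * wordProd n u := by
  simp [wordProd]

theorem wordProd_singleton (i : Fin n) : wordProd n [i] = simpleRefl n i := by
  simp [wordProd]

theorem wordProd_reverse (u : List (Fin n)) : wordProd n u.reverse = (wordProd n u)⁻¹ := by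
  induction u with
  | nil => simp [wordProd]
  | cons i u ih =>
    rw [List.reverse_cons, wordProd_append, ih, wordProd_cons i u, mul_inv_rev, simpleRefl_inv,
      wordProd_singleton]

theorem card_invSet_wordProd_le (u : List (Fin n)) :
    (invSet (wordProd n u)).card ≤ u.length := by
  induction u using List.reverseRecOn with
  | nil =>
    have : invSet (wordProd n ([] : List (Fin n))) = ∅ := by
      ext p
      rw [mem_invSet]
      simpa [wordProd] using le_of_lt
    simp [this]
  | append_singleton u i ih =>
    rw [wordProd_append, wordProd_singleton, List.length_append, List.length_singleton]
    rcases lt_or_gt_of_ne (apply_castSucc_ne_apply_succ (wordProd n u) i) with h | h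
    · have := card_invSet_mul_simpleRefl h
      omega
    · have := card_invSet_mul_simpleRefl_of_gt h
      omega

theorem eq_one_of_forall_lt {w : Equiv.Perm (Fin (n + 1))}
    (h : ∀ i : Fin n, w i.castSucc < w i.succ) : w = 1 := by
  have h1 : StrictMono w := Fin.strictMono_iff_lt_succ.mpr h
  rw [← inv_eq_one]
  apply eq_one_of_excSet_eq_empty
  ext m
  obtain ⟨q, rfl⟩ := w.surjective m
  rw [mem_excSet, perm_inv_apply_self]
  simpa using h1.le_apply

theorem exists_wordProd_eq (w : Equiv.Perm (Fin (n + 1))) :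
    ∃ u, wordProd n u = w ∧ u.length = (invSet w).card := by
  induction hk : (invSet w).card generalizing w with
  | zero =>
    refine ⟨[], ?_, rfl⟩
    refine (eq_one_of_forall_lt fun i => ?_).symm
    by_contra! hc
    have := card_invSet_mul_simpleRefl_of_gt
      (lt_of_le_of_ne hc (apply_castSucc_ne_apply_succ w i).symm)
    omega
  | succ k ih =>
    by_cases h : ∀ i : Fin n, w i.castSucc < w i.succ
    · rw [eq_one_of_forall_lt h] at hk
      have := card_invSet_wordProd_le ([] : List (Fin n))
      simp only [wordProd, List.map_nil, List.prod_nil, List.length_nil] at this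
      omega
    · push Not at h
      obtain ⟨i, hi⟩ := h
      have := card_invSet_mul_simpleRefl_of_gt
        (lt_of_le_of_ne hi (apply_castSucc_ne_apply_succ w i).symm)
      obtain ⟨u, hu, hl⟩ := ih (w * simpleRefl n i) (by omega)
      refine ⟨u ++ [i], ?_, by simp [hl]⟩
      rw [wordProd_append, hu, wordProd_singleton, mul_assoc, simpleRefl_mul_self, mul_one]

theorem lenS_wordProd_le (u : List (Fin n)) : lenS n (wordProd n u) ≤ u.length :=
  Nat.sInf_le ⟨u, rfl, rfl⟩

theorem exists_isReducedWord (w : Equiv.Perm (Fin (n + 1))) : ∃ u, IsReducedWord n w u := by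
  obtain ⟨u, hu, -⟩ := exists_wordProd_eq w
  have hne : {k : ℕ | ∃ u : List (Fin n), u.length = k ∧ wordProd n u = w}.Nonempty :=
    ⟨u.length, u, rfl, hu⟩
  obtain ⟨u', h1, h2⟩ := Nat.sInf_mem hne
  exact ⟨u', h2, h1⟩

theorem lenS_eq_card_invSet (w : Equiv.Perm (Fin (n + 1))) : lenS n w = (invSet w).card := by
  apply le_antisymm
  · obtain ⟨u, rfl, hl⟩ := exists_wordProd_eq w
    rw [← hl]
    exact lenS_wordProd_le u
  · obtain ⟨u, rfl, hl⟩ := exists_isReducedWord w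
    rw [← hl]
    exact card_invSet_wordProd_le u

theorem lenS_inv (w : Equiv.Perm (Fin (n + 1))) : lenS n w⁻¹ = lenS n w := by
  have key : ∀ w, lenS n w⁻¹ ≤ lenS n w := fun w => by
    obtain ⟨u, rfl, hl⟩ := exists_isReducedWord w
    rw [← hl, ← wordProd_reverse, ← List.length_reverse]
    exact lenS_wordProd_le _
  exact le_antisymm (key w) (by simpa using key w⁻¹)

theorem lenS_mul_simpleRefl_add_one {w : Equiv.Perm (Fin (n + 1))} {i : Fin n}
    (h : w i.succ < w i.castSucc) : lenS n (w * simpleRefl n i) + 1 = lenS n w := by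
  rw [lenS_eq_card_invSet, lenS_eq_card_invSet, card_invSet_mul_simpleRefl_of_gt h]

theorem lenS_simpleRefl_mul_add_one {w : Equiv.Perm (Fin (n + 1))} {i : Fin n}
    (h : w⁻¹ i.succ < w⁻¹ i.castSucc) : lenS n (simpleRefl n i * w) + 1 = lenS n w := by
  rw [← lenS_inv, mul_inv_rev, simpleRefl_inv, lenS_mul_simpleRefl_add_one h, lenS_inv]

theorem lenS_mul_simpleRefl_lt_iff {w : Equiv.Perm (Fin (n + 1))} {i : Fin n} :
    lenS n (w * simpleRefl n i) < lenS n w ↔ w i.succ < w i.castSucc := by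
  constructor
  · intro h
    by_contra! hc
    have := card_invSet_mul_simpleRefl (lt_of_le_of_ne hc (apply_castSucc_ne_apply_succ w i))
    rw [lenS_eq_card_invSet, lenS_eq_card_invSet] at h
    omega
  · intro h
    have := lenS_mul_simpleRefl_add_one h
    omega

theorem lenS_simpleRefl_mul_lt_iff {w : Equiv.Perm (Fin (n + 1))} {i : Fin n} :
    lenS n (simpleRefl n i * w) < lenS n w ↔ w⁻¹ i.succ < w⁻¹ i.castSucc := by
  rw [← lenS_mul_simpleRefl_lt_iff, lenS_inv, ← lenS_inv, mul_inv_rev, simpleRefl_inv]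

theorem BruhatLT.lenS_lt {w w' : Equiv.Perm (Fin (n + 1))} (h : BruhatLT n w w') :
    lenS n w < lenS n w' := by
  induction h with
  | single h => exact h.2
  | tail _ h ih => exact ih.trans h.2

/-- A Bruhat chain raises the length, and a length drop under a simple reflection is a single Bruhat
step, so the Bruhat condition is just a comparison of lengths. -/
theorem mem_leftDescents {w : Equiv.Perm (Fin (n + 1))} {i : Fin n} :
    i ∈ leftDescents n w ↔ w⁻¹ i.succ < w⁻¹ i.castSucc := by
  rw [← lenS_simpleRefl_mul_lt_iff]
  refine ⟨fun h => BruhatLT.lenS_lt h, fun h => .single ⟨⟨⟨(i.castSucc, i.succ), by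
    simp [Fin.lt_def]⟩, ?_⟩, h⟩⟩
  change w = simpleRefl n i * (simpleRefl n i * w)
  rw [← mul_assoc, simpleRefl_mul_self, one_mul]

theorem mem_rightDescents {w : Equiv.Perm (Fin (n + 1))} {i : Fin n} :
    i ∈ rightDescents n w ↔ w i.succ < w i.castSucc := by
  rw [← lenS_mul_simpleRefl_lt_iff]
  refine ⟨fun h => BruhatLT.lenS_lt h, fun h => .single ⟨⟨⟨(w i.succ, w i.castSucc),
    lenS_mul_simpleRefl_lt_iff.mp h⟩, ?_⟩, h⟩⟩
  change w = Equiv.swap _ _ * (w * Equiv.swap _ _)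
  rw [Equiv.mul_swap_eq_swap_mul, ← mul_assoc, Equiv.swap_comm, Equiv.swap_mul_self, one_mul]

/-- Avoidance of the pattern `321`. -/
def Avoids321 (w : Equiv.Perm (Fin (n + 1))) : Prop :=
  ∀ a b c, a < b → b < c → w c < w b → w b < w a → False

theorem simpleRefl_braid {i j : Fin n} (h : i.val + 1 = j.val) :
    simpleRefl n i * simpleRefl n j * simpleRefl n i =
      simpleRefl n j * simpleRefl n i * simpleRefl n j := by
  have e : j.castSucc = i.succ := by ext; simpa using h.symm
  have h1 : i.castSucc ≠ i.succ := by simp [Fin.ext_iff]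
  have h2 : i.castSucc ≠ j.succ := by simp [Fin.ext_iff]; omega
  have h3 : j.succ ≠ i.succ := by simp [Fin.ext_iff]; omega
  rw [simpleRefl, simpleRefl, e, Equiv.swap_mul_swap_mul_swap h1 h2, Equiv.swap_comm i.castSucc,
    Equiv.swap_comm i.succ j.succ, Equiv.swap_mul_swap_mul_swap h3 h2.symm, Equiv.swap_comm]

theorem simpleRefl_comm {i j : Fin n} (h : i.val + 1 < j.val ∨ j.val + 1 < i.val) :
    simpleRefl n i * simpleRefl n j = simpleRefl n j * simpleRefl n i := by
  ext m
  simp only [Equiv.Perm.mul_apply, simpleRefl_apply_val]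
  split_ifs <;> omega

theorem IsReducedWord.append_singleton {w : Equiv.Perm (Fin (n + 1))} {i : Fin n}
    {u : List (Fin n)} (h : w i.succ < w i.castSucc)
    (hu : IsReducedWord n (w * simpleRefl n i) u) : IsReducedWord n w (u ++ [i]) := by
  refine ⟨?_, ?_⟩
  · rw [wordProd_append, hu.1, wordProd_singleton, mul_assoc, simpleRefl_mul_self, mul_one]
  · rw [List.length_append, hu.2, List.length_singleton, lenS_mul_simpleRefl_add_one h]

theorem IsReducedWord.of_cons {w : Equiv.Perm (Fin (n + 1))} {i : Fin n}
    {u : List (Fin n)} (h : IsReducedWord n w (i :: u)) :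
    IsReducedWord n (simpleRefl n i * w) u ∧ w⁻¹ i.succ < w⁻¹ i.castSucc := by
  have h1 : wordProd n u = simpleRefl n i * w := by
    rw [← h.1, wordProd_cons, ← mul_assoc, simpleRefl_mul_self, one_mul]
  have h2 := h.2
  have h3 := lenS_wordProd_le u
  rw [List.length_cons] at h2
  rw [h1] at h3
  have h4 := lenS_simpleRefl_mul_lt_iff.mp (by omega : lenS n (simpleRefl n i * w) < lenS n w)
  have h5 := lenS_simpleRefl_mul_add_one h4
  exact ⟨⟨h1, by omega⟩, h4⟩

/-- An occurrence of the pattern `321` yields a reduced word with a factor `i j i`. -/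
theorem exists_isReducedWord_braid (w : Equiv.Perm (Fin (n + 1))) (a b c : Fin (n + 1))
    (hab : a < b) (hbc : b < c) (h1 : w c < w b) (h2 : w b < w a) :
    ∃ (p q : List (Fin n)) (i j : Fin n), i.val + 1 = j.val ∧
      IsReducedWord n w (p ++ [i, j, i] ++ q) := by
  induction hk : c.val - a.val using Nat.strong_induction_on generalizing w a b c with | _ k ih
  -- If `b` is not adjacent to `a`, then either the next point can replace `a` in the pattern, or
  -- there is a descent at `a` which can be split off on the right, moving the largest value one
  -- step closer to `b`. The same is done for `c` afterwards.
  by_cases hb : a.val + 1 < b.val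
  · obtain ⟨i, rfl⟩ : ∃ i : Fin n, a = i.castSucc := ⟨⟨a.val, by omega⟩, rfl⟩
    rw [Fin.val_castSucc] at hb
    have hib : i.succ < b := by rw [Fin.lt_def, Fin.val_succ]; exact hb
    by_cases hm : w b < w i.succ
    · exact ih _ (by rw [← hk, Fin.val_succ, Fin.val_castSucc]; omega) w i.succ b c hib hbc h1 hm rfl
    · have hne : w i.succ ≠ w b := fun he => hib.ne (w.injective he)
      have hd : w i.succ < w i.castSucc := by omega
      have hs : ∀ m, i.succ < m → simpleRefl n i m = m := fun m hm =>
        Equiv.swap_apply_of_ne_of_ne (by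
          rintro rfl
          rw [Fin.lt_def, Fin.val_succ, Fin.val_castSucc] at hm
          omega) hm.ne'
      obtain ⟨p, q, i', j', hij, hr⟩ := ih _
        (by rw [← hk, Fin.val_succ, Fin.val_castSucc]; omega) (w * simpleRefl n i)
        i.succ b c hib hbc
        (by rw [Equiv.Perm.mul_apply, Equiv.Perm.mul_apply, hs b hib, hs c (by omega)]; exact h1)
        (by rw [Equiv.Perm.mul_apply, Equiv.Perm.mul_apply, hs b hib, simpleRefl_apply_succ]
            exact h2) rfl
      refine ⟨p, q ++ [i], i', j', hij, ?_⟩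
      rw [← List.append_assoc]
      exact hr.append_singleton hd
  by_cases hc : b.val + 1 < c.val
  · obtain ⟨i, rfl⟩ : ∃ i : Fin n, c = i.succ := ⟨⟨c.val - 1, by omega⟩, by
      ext; simp; omega⟩
    rw [Fin.val_succ] at hc
    have hib : b < i.castSucc := by rw [Fin.lt_def, Fin.val_castSucc]; omega
    by_cases hm : w i.castSucc < w b
    · exact ih _ (by rw [← hk, Fin.val_succ, Fin.val_castSucc]; omega) w a b i.castSucc hab hib
        hm h2 rfl
    · have hne : w i.castSucc ≠ w b := fun he => hib.ne' (w.injective he)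
      have hd : w i.succ < w i.castSucc := by omega
      have hs : ∀ m, m < i.castSucc → simpleRefl n i m = m := fun m hm =>
        Equiv.swap_apply_of_ne_of_ne hm.ne (by
          rintro rfl
          rw [Fin.lt_def, Fin.val_succ, Fin.val_castSucc] at hm
          omega)
      obtain ⟨p, q, i', j', hij, hr⟩ := ih _
        (by rw [← hk, Fin.val_succ, Fin.val_castSucc]; omega) (w * simpleRefl n i)
        a b i.castSucc hab hib
        (by rw [Equiv.Perm.mul_apply, Equiv.Perm.mul_apply, hs b hib, simpleRefl_apply_castSucc]
            exact h1)
        (by rw [Equiv.Perm.mul_apply, Equiv.Perm.mul_apply, hs b hib, hs a (by omega)]; exact h2) rfl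
      refine ⟨p, q ++ [i], i', j', hij, ?_⟩
      rw [← List.append_assoc]
      exact hr.append_singleton hd
  · obtain ⟨i, rfl⟩ : ∃ i : Fin n, a = i.castSucc := ⟨⟨a.val, by omega⟩, rfl⟩
    obtain ⟨j, rfl⟩ : ∃ j : Fin n, b = j.castSucc := ⟨⟨b.val, by omega⟩, rfl⟩
    obtain rfl : c = j.succ := by
      rw [Fin.val_castSucc] at hc
      rw [Fin.lt_def, Fin.val_castSucc] at hbc
      ext
      rw [Fin.val_succ]
      omega
    rw [Fin.lt_def, Fin.val_castSucc, Fin.val_castSucc] at *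
    have hij : i.val + 1 = j.val := by omega
    have e1 : i.succ = j.castSucc := by ext; simpa using hij
    have e2 : simpleRefl n j i.castSucc = i.castSucc :=
      Equiv.swap_apply_of_ne_of_ne (by simp [Fin.ext_iff]; omega) (by simp [Fin.ext_iff]; omega)
    have e3 : simpleRefl n i j.succ = j.succ :=
      Equiv.swap_apply_of_ne_of_ne (by simp [Fin.ext_iff]; omega) (by simp [Fin.ext_iff]; omega)
    have e4 : simpleRefl n i j.castSucc = i.castSucc := by rw [← e1, simpleRefl_apply_succ]
    have e5 : simpleRefl n i i.castSucc = j.castSucc := by rw [← e1, simpleRefl_apply_castSucc]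
    obtain ⟨u, hu⟩ := exists_isReducedWord (w * simpleRefl n i * simpleRefl n j * simpleRefl n i)
    have d3 := hu.append_singleton (by
      simp only [Equiv.Perm.mul_apply, e1, e2, e3, e5, simpleRefl_apply_castSucc]
      omega)
    have d2 := d3.append_singleton (by
      simp only [Equiv.Perm.mul_apply, e3, e4]
      omega)
    have d1 := d2.append_singleton (by rw [e1]; omega)
    refine ⟨u, [], i, j, hij, ?_⟩
    simpa using d1

theorem CommMove.perm {u u' : List (Fin n)} (h : CommMove n u u') : u.Perm u' := by
  obtain ⟨a, b, i, j, -, rfl, rfl⟩ := h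
  exact (List.Perm.swap j i b).append_left a

/-- A braid move changes the number of occurrences of a letter, which commutations preserve. -/
theorem IsFullyCommutative.avoids321 {w : Equiv.Perm (Fin (n + 1))}
    (h : IsFullyCommutative n w) : Avoids321 w := by
  intro a b c hab hbc h1 h2
  obtain ⟨p, q, i, j, hij, hr⟩ := exists_isReducedWord_braid w a b c hab hbc h1 h2
  have hr' : IsReducedWord n w (p ++ [j, i, j] ++ q) := by
    refine ⟨?_, ?_⟩
    · rw [← hr.1]
      simp only [wordProd_append, wordProd_cons]
      have := simpleRefl_braid hij
      rw [mul_assoc, mul_assoc] at this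
      simp only [wordProd, List.map_nil, List.prod_nil, mul_one, this]
    · rw [← hr.2]
      simp
  have hp : (p ++ [i, j, i] ++ q).Perm (p ++ [j, i, j] ++ q) := by
    have key : ∀ u u', Relation.ReflTransGen (CommMove n) u u' → u.Perm u' := by
      intro u u' h
      induction h with
      | refl => exact .refl _
      | tail _ h ih => exact ih.trans h.perm
    exact key _ _ (h _ _ hr hr')
  have hc := hp.count_eq i
  have hne : j ≠ i := by rintro rfl; omega
  simp [List.count_append, hne] at hc

theorem CommMove.cons {u u' : List (Fin n)} (k : Fin n) (h : CommMove n u u') :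
    CommMove n (k :: u) (k :: u') := by
  obtain ⟨a, b, i, j, hij, rfl, rfl⟩ := h
  exact ⟨k :: a, b, i, j, hij, rfl, rfl⟩

theorem Avoids321.simpleRefl_mul {w : Equiv.Perm (Fin (n + 1))} (h : Avoids321 w) {i : Fin n}
    (hi : w⁻¹ i.succ < w⁻¹ i.castSucc) : Avoids321 (simpleRefl n i * w) := by
  have key : ∀ a b, a < b → (simpleRefl n i * w) b < (simpleRefl n i * w) a → w b < w a := by
    intro a b hab hlt
    have e1 : w a = i.castSucc → a = w⁻¹ i.castSucc := fun h => by rw [← h, perm_inv_apply_self]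
    have e2 : w b = i.succ → b = w⁻¹ i.succ := fun h => by rw [← h, perm_inv_apply_self]
    have ha := simpleRefl_apply_val i (w a)
    have hb := simpleRefl_apply_val i (w b)
    rw [Equiv.Perm.mul_apply, Equiv.Perm.mul_apply] at hlt
    rw [Fin.ext_iff, Fin.val_castSucc] at e1
    rw [Fin.ext_iff, Fin.val_succ] at e2
    have hne : w a ≠ w b := fun he => hab.ne (w.injective he)
    split_ifs at ha hb <;> grind
  intro a b c hab hbc h1 h2
  exact h a b c hab hbc (key _ _ hbc h1) (key _ _ hab h2)

/-- Neighbouring left descents put three consecutive values in decreasing order. So distinct left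
descents of a 321-avoiding permutation commute. -/
theorem Avoids321.descent_ne {w : Equiv.Perm (Fin (n + 1))} (h : Avoids321 w) {i j : Fin n}
    (hi : w⁻¹ i.succ < w⁻¹ i.castSucc) (hj : w⁻¹ j.succ < w⁻¹ j.castSucc) :
    i.val + 1 ≠ j.val := by
  intro hij
  have e1 : i.succ = j.castSucc := by ext; simpa using hij
  rw [e1] at hi
  refine h _ _ _ hj hi ?_ ?_ <;> rw [perm_apply_inv_self, perm_apply_inv_self]
  · rw [Fin.lt_def, Fin.val_castSucc, Fin.val_castSucc]
    omega
  · exact Fin.castSucc_lt_succ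

theorem Avoids321.isFullyCommutative {w : Equiv.Perm (Fin (n + 1))} (h : Avoids321 w) :
    IsFullyCommutative n w := by
  have key : ∀ k, ∀ w : Equiv.Perm (Fin (n + 1)), Avoids321 w → lenS n w ≤ k →
      IsFullyCommutative n w := by
    intro k
    induction k with
    | zero =>
      intro w _ hk u u' hu hu'
      have h1 := hu.2
      have h2 := hu'.2
      have h3 : u = [] := List.length_eq_zero_iff.mp (by omega)
      have h4 : u' = [] := List.length_eq_zero_iff.mp (by omega)
      rw [h3, h4]
    | succ k ih =>
      intro w h hk u u' hu hu'
      have cons : ∀ (i : Fin n) (r r' : List (Fin n)), IsReducedWord n w (i :: r) →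
          IsReducedWord n w (i :: r') →
          Relation.ReflTransGen (CommMove n) (i :: r) (i :: r') := by
        intro i r r' hr hr'
        obtain ⟨h1, h2⟩ := hr.of_cons
        have := lenS_simpleRefl_mul_add_one h2
        have := ih _ (h.simpleRefl_mul h2) (by omega) r r' h1 hr'.of_cons.1
        exact this.lift (List.cons i) fun _ _ => CommMove.cons i
      rcases u with - | ⟨i, r⟩
      · have h1 := hu.2
        have h2 := hu'.2
        rw [List.length_nil] at h1
        have h4 : u' = [] := List.length_eq_zero_iff.mp (by omega)
        rw [h4]
      rcases u' with - | ⟨j, r'⟩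
      · have h1 := hu.2
        have h2 := hu'.2
        simp only [List.length_nil, List.length_cons] at h1 h2
        omega
      by_cases hij : i = j
      · subst hij
        exact cons i r r' hu hu'
      · obtain ⟨hr, hi⟩ := hu.of_cons
        obtain ⟨hr', hj⟩ := hu'.of_cons
        have n1 := h.descent_ne hi hj
        have n2 := h.descent_ne hj hi
        have n3 : i.val ≠ j.val := fun he => hij (Fin.ext he)
        have hcomm := simpleRefl_comm (i := i) (j := j) (by omega)
        have hj' : (simpleRefl n i * w)⁻¹ j.succ < (simpleRefl n i * w)⁻¹ j.castSucc := by
          rw [mul_inv_rev, simpleRefl_inv, Equiv.Perm.mul_apply, Equiv.Perm.mul_apply]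
          have e1 : simpleRefl n i j.succ = j.succ := by
            ext; rw [simpleRefl_apply_val, Fin.val_succ]; split_ifs <;> omega
          have e2 : simpleRefl n i j.castSucc = j.castSucc := by
            ext; rw [simpleRefl_apply_val, Fin.val_castSucc]; split_ifs <;> omega
          rwa [e1, e2]
        -- The first letters `i` and `j` are commuting left descents, so `w` has reduced words
        -- starting with `i j` and with `j i` and continuing alike. They link the two given words.
        obtain ⟨v, hv⟩ := exists_isReducedWord (simpleRefl n j * (simpleRefl n i * w))
        have l1 := lenS_simpleRefl_mul_add_one hi
        have l2 := lenS_simpleRefl_mul_add_one hj'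
        have r1 : IsReducedWord n w (i :: j :: v) := by
          refine ⟨?_, by simp only [List.length_cons, hv.2]; omega⟩
          rw [wordProd_cons, wordProd_cons, hv.1, ← mul_assoc (simpleRefl n j),
            simpleRefl_mul_self, one_mul, ← mul_assoc, simpleRefl_mul_self, one_mul]
        have r2 : IsReducedWord n w (j :: i :: v) := by
          refine ⟨?_, by rw [← r1.2]; simp⟩
          rw [← r1.1]
          simp only [wordProd_cons, ← mul_assoc, hcomm]
        refine (cons i _ _ hu r1).trans (.trans (.single ⟨[], v, i, j, hcomm, rfl, rfl⟩)
          (cons j _ _ r2 hu'))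
  exact key _ w h le_rfl

/-- `w` is increasing on its excedances and on its non-excedances. -/
def IsIncreasing (w : Equiv.Perm (Fin (n + 1))) : Prop :=
  (∀ a b, a < b → a < w a → b < w b → w a < w b) ∧
    ∀ a b, a < b → w a ≤ a → w b ≤ b → w a < w b

/-- If two excedances `a < b` are out of order, any point to the right of `b` with value at most `b`
would complete a 321. So the points beyond `b` are stable, yet they contain `w a` and not `a`.
Non-excedances are treated symmetrically. -/
theorem Avoids321.isIncreasing {w : Equiv.Perm (Fin (n + 1))} (h : Avoids321 w) :
    IsIncreasing w := by
  refine ⟨fun a b hab ha hb => ?_, fun a b hab ha hb => ?_⟩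
  · by_contra! hc
    have hne : w a ≠ w b := fun he => hab.ne (w.injective he)
    have hst : ∀ c, b < c → b < w c := by
      intro c hbc
      by_contra! hlt
      exact h a b c hab hbc (by omega) (by omega)
    have := mem_of_apply_mem w (S := fun c => b < c) hst (a := a) (by omega)
    omega
  · by_contra! hc
    have hne : w a ≠ w b := fun he => hab.ne (w.injective he)
    have hst : ∀ c, c < a → w c < a := by
      intro c hca
      by_contra! hlt
      have hne : w c ≠ w a := fun he => hca.ne (w.injective he)
      exact h c a b hca hab (by omega) (by omega)
    have := mem_of_apply_mem w (S := fun c => c < a) hst (a := b) (by omega)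
    omega

/-- Two of the three positions of a 321 are of the same type. -/
theorem IsIncreasing.avoids321 {w : Equiv.Perm (Fin (n + 1))} (h : IsIncreasing w) :
    Avoids321 w := by
  intro a b c hab hbc h1 h2
  have e1 := h.1 a b hab
  have e2 := h.1 b c hbc
  have e3 := h.1 a c (hab.trans hbc)
  have f1 := h.2 a b hab
  have f2 := h.2 b c hbc
  have f3 := h.2 a c (hab.trans hbc)
  omega

theorem isFullyCommutative_iff {w : Equiv.Perm (Fin (n + 1))} :
    IsFullyCommutative n w ↔ IsIncreasing w :=
  ⟨fun h => h.avoids321.isIncreasing, fun h => h.avoids321.isFullyCommutative⟩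

end Length

/-! ### Canonical forms of fully commutative elements -/

section CanonicalForm

variable {n : ℕ}

theorem filter_finRange_eq_append {p q : Fin n → Bool} {i : Fin n}
    (h : ∀ m, p m = true ↔ q m = true ∨ m = i) (hi : ∀ m, q m = true → m < i) :
    (List.finRange n).filter p = (List.finRange n).filter q ++ [i] := by
  apply List.Pairwise.eq_of_mem_iff (r := (· < ·))
  · exact (List.pairwise_lt_finRange n).filter _
  · rw [List.pairwise_append]
    refine ⟨(List.pairwise_lt_finRange n).filter _, List.pairwise_singleton _ _, ?_⟩
    intro a ha b hb
    rw [List.mem_filter] at ha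
    rw [List.mem_singleton.mp hb]
    exact hi a ha.2
  · intro m
    simp [h]

theorem descRun_self (i : Fin n) : descRun n i i = [i] := by
  rw [descRun, filter_finRange_eq_append (q := fun _ => false) (i := i)]
  · simp
  · intro m
    simp
    omega
  · simp

theorem descRun_succ {i i' j : Fin n} (h : i'.val + 1 = i.val) (hj : j ≤ i') :
    descRun n i j = i :: descRun n i' j := by
  rw [descRun, filter_finRange_eq_append (q := fun m => decide (j ≤ m ∧ m ≤ i')) (i := i),
    List.reverse_append]
  · rfl
  · intro m
    simp
    omega
  · intro m
    simp
    omega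

theorem descRun_spec (d : ℕ) (i j : Fin n) (h : i.val = j.val + d) :
    (descRun n i j).length = d + 1 ∧ ∀ m, (wordProd n (descRun n i j) m).val =
      if m.val = j.val then i.val + 1 else
        if j.val < m.val ∧ m.val ≤ i.val + 1 then m.val - 1 else m.val := by
  induction d generalizing i with
  | zero =>
    obtain rfl : i = j := Fin.ext h
    rw [descRun_self]
    refine ⟨rfl, fun m => ?_⟩
    rw [wordProd_singleton, simpleRefl_apply_val]
    split_ifs <;> omega
  | succ d ih =>
    have hi := i.isLt
    obtain ⟨h1, h2⟩ := ih ⟨i.val - 1, by omega⟩ (by simp; omega)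
    rw [descRun_succ (i' := ⟨i.val - 1, by omega⟩) (by simp; omega)
      (by rw [Fin.le_def]; simp; omega)]
    refine ⟨by simp [h1], fun m => ?_⟩
    rw [wordProd_cons, Equiv.Perm.mul_apply, simpleRefl_apply_val, h2]
    dsimp only
    split_ifs <;> omega

theorem wordProd_descRun_apply_val {i j : Fin n} (h : j ≤ i) (m : Fin (n + 1)) :
    (wordProd n (descRun n i j) m).val =
      if m.val = j.val then i.val + 1 else
        if j.val < m.val ∧ m.val ≤ i.val + 1 then m.val - 1 else m.val :=
  (descRun_spec (i.val - j.val) i j (by omega)).2 m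

theorem length_descRun {i j : Fin n} (h : j ≤ i) :
    (descRun n i j).length = i.val + 1 - j.val := by
  rw [(descRun_spec (i.val - j.val) i j (by omega)).1]
  omega

/-- The permutation with the run lengths encoded by `p`. -/
def runProd (p : List (Fin n × Fin n)) : Equiv.Perm (Fin (n + 1)) :=
  wordProd n (p.flatMap fun q => descRun n q.1 q.2)

theorem runProd_cons (q : Fin n × Fin n) (p : List (Fin n × Fin n)) :
    runProd (q :: p) = wordProd n (descRun n q.1 q.2) * runProd p := by
  rw [runProd, List.flatMap_cons, wordProd_append]
  rfl

/-- The total displacement of the excedances. -/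
def displacement (w : Equiv.Perm (Fin (n + 1))) : ℕ :=
  ∑ m, ((w m).val - m.val)

/-- Only the preimage of `i` is moved upwards. Thus the displacement bounds the length from below,
which certifies that products of runs are reduced. -/
theorem displacement_simpleRefl_mul_le (i : Fin n) (w : Equiv.Perm (Fin (n + 1))) :
    displacement (simpleRefl n i * w) ≤ displacement w + 1 := by
  have h : ∀ m, ((simpleRefl n i * w) m).val - m.val ≤
      ((w m).val - m.val) + if m = w⁻¹ i.castSucc then 1 else 0 := by
    intro m
    rw [Equiv.Perm.mul_apply, simpleRefl_apply_val]
    simp only [Equiv.Perm.eq_inv_iff_eq, Fin.ext_iff, Fin.val_castSucc]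
    split_ifs <;> omega
  refine (Finset.sum_le_sum fun m _ => h m).trans ?_
  rw [Finset.sum_add_distrib, Finset.sum_ite_eq' Finset.univ]
  simp [displacement]

theorem displacement_wordProd_le (u : List (Fin n)) : displacement (wordProd n u) ≤ u.length := by
  induction u with
  | nil => simp [displacement, wordProd]
  | cons i u ih =>
    rw [wordProd_cons, List.length_cons]
    exact (displacement_simpleRefl_mul_le _ _).trans (by omega)

theorem isReducedWord_of_length_eq_displacement {u : List (Fin n)}
    (h : u.length = displacement (wordProd n u)) : IsReducedWord n (wordProd n u) u := by
  refine ⟨rfl, le_antisymm ?_ (lenS_wordProd_le u)⟩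
  obtain ⟨v, hv, hl⟩ := exists_isReducedWord (wordProd n u)
  rw [← hl, h, ← hv]
  exact displacement_wordProd_le v

/-- The properties of a product of descending runs with increasing endpoints. -/
theorem runProd_spec (p : List (Fin n × Fin n)) (h1 : (p.map Prod.fst).Pairwise (· < ·))
    (h2 : (p.map Prod.snd).Pairwise (· < ·)) (h3 : ∀ q ∈ p, q.2 ≤ q.1) :
    (∀ q ∈ p, runProd p q.2.castSucc = q.1.succ) ∧
    (∀ m, (∀ q ∈ p, m ≠ q.2.castSucc) → runProd p m ≤ m) ∧
    (∀ m m', m < m' → (∀ q ∈ p, m ≠ q.2.castSucc) → (∀ q ∈ p, m' ≠ q.2.castSucc) →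
      runProd p m < runProd p m') ∧
    (∀ m, (∀ q ∈ p, m < q.2.castSucc) → runProd p m = m) ∧
    (p.flatMap fun q => descRun n q.1 q.2).length = displacement (runProd p) := by
  induction p with
  | nil => simp [runProd, wordProd, displacement]
  | cons q p ih =>
    rw [List.map_cons, List.pairwise_cons] at h1 h2
    obtain ⟨i1, i2, i3, i4, i5⟩ := ih h1.2 h2.2 fun q hq => h3 q (List.mem_cons_of_mem _ hq)
    have hq := h3 q List.mem_cons_self
    have hfst : ∀ r ∈ p, q.1 < r.1 := fun r hr => h1.1 _ (List.mem_map_of_mem hr)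
    have hsnd : ∀ r ∈ p, q.2 < r.2 := fun r hr => h2.1 _ (List.mem_map_of_mem hr)
    have run := wordProd_descRun_apply_val hq
    set W := runProd p with hW
    have e : ∀ m, runProd (q :: p) m = wordProd n (descRun n q.1 q.2) (W m) := fun m => by
      rw [runProd_cons, Equiv.Perm.mul_apply]
    -- The later runs start further right, so they fix the start of the first run. It is therefore
    -- the only point that this run sends upwards; all other values can only be lowered.
    have hWj : W q.2.castSucc = q.2.castSucc := i4 _ fun r hr => by
      have := hsnd r hr
      rw [Fin.lt_def] at *
      simpa using this
    have j1 : ∀ r ∈ p, runProd (q :: p) r.2.castSucc = r.1.succ := by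
      intro r hr
      have := hfst r hr
      have := hsnd r hr
      rw [e, i1 r hr]
      ext
      rw [run, Fin.val_succ]
      split_ifs <;> omega
    have j0 : runProd (q :: p) q.2.castSucc = q.1.succ := by
      rw [e, hWj]
      ext
      rw [run]
      simp
    have hW_ne : ∀ m, m ≠ q.2.castSucc → (W m).val ≠ q.2.val := fun m hm he => by
      apply hm
      apply W.injective
      rw [hWj]
      exact Fin.ext he
    simp only [List.forall_mem_cons]
    refine ⟨⟨j0, j1⟩, ?_, ?_, ?_, ?_⟩
    · rintro m ⟨hm, hm'⟩
      have := i2 m hm'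
      have := hW_ne m hm
      have := run (W m)
      rw [e, Fin.le_def]
      split_ifs at this <;> omega
    · rintro m m' hmm ⟨hm, hm'⟩ ⟨hn, hn'⟩
      have := i3 m m' hmm hm' hn'
      have := hW_ne m hm
      have := hW_ne m' hn
      have := run (W m)
      have := run (W m')
      rw [e, e, Fin.lt_def]
      split_ifs at * <;> omega
    · rintro m ⟨hm, hm'⟩
      rw [e, i4 m hm']
      rw [Fin.lt_def, Fin.val_castSucc] at hm
      ext
      rw [run]
      split_ifs <;> omega
    · have key : ∀ m, ((runProd (q :: p) m).val - m.val) =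
          ((W m).val - m.val) + if m = q.2.castSucc then q.1.val + 1 - q.2.val else 0 := by
        intro m
        by_cases hm : m = q.2.castSucc
        · rw [if_pos hm, hm, j0, hWj]
          simp
        · rw [if_neg hm]
          by_cases hm' : ∃ r ∈ p, m = r.2.castSucc
          · obtain ⟨r, hr, rfl⟩ := hm'
            rw [j1 r hr, i1 r hr, add_zero]
          · push Not at hm'
            have := i2 m hm'
            have := hW_ne m hm
            have := run (W m)
            rw [e]
            split_ifs at this <;> omega
      rw [displacement, Finset.sum_congr rfl fun m _ => key m, Finset.sum_add_distrib,
        Finset.sum_ite_eq' Finset.univ, List.flatMap_cons, List.length_append, i5,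
        length_descRun hq]
      simp [displacement, add_comm]

theorem eq_of_strictMonoOn {f g : Equiv.Perm (Fin (n + 1))} (S : Fin (n + 1) → Prop)
    (hf : ∀ a b, a < b → S a → S b → f a < f b) (hg : ∀ a b, a < b → S a → S b → g a < g b)
    (hfg : ∀ a, S a → ∃ b, S b ∧ g b = f a) (hgf : ∀ a, S a → ∃ b, S b ∧ f b = g a) :
    ∀ a, S a → f a = g a := by
  intro a
  induction hk : a.val using Nat.strong_induction_on generalizing a with | _ k ih
  intro ha
  obtain ⟨b, hb, hab⟩ := hfg a ha
  obtain ⟨c, hc, hac⟩ := hgf a ha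
  rcases lt_trichotomy b a with h | h | h
  · have := f.injective (hab ▸ ih b.val (by omega) b rfl hb : f b = f a)
    omega
  · rw [← hab, h]
  · rcases lt_trichotomy c a with h' | h' | h'
    · have := g.injective (hac ▸ (ih c.val (by omega) c rfl hc).symm : g c = g a)
      omega
    · rw [← hac, h']
    · have := hf a c h' ha hc
      have := hg a b h ha hb
      omega

/-- The set of values of the excedances. -/
def excVal (x : Equiv.Perm (Fin (n + 1))) : Finset (Fin (n + 1)) :=
  Finset.univ.filter fun m => x⁻¹ m < m

theorem mem_excVal {x : Equiv.Perm (Fin (n + 1))} {m : Fin (n + 1)} :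
    m ∈ excVal x ↔ x⁻¹ m < m := by
  simp [excVal]

theorem apply_mem_excVal {x : Equiv.Perm (Fin (n + 1))} {m : Fin (n + 1)} :
    x m ∈ excVal x ↔ m < x m := by
  rw [mem_excVal, perm_inv_apply_self]

/-- `x` and `y` have the same excedances and the same excedance values. -/
def SameExc (x y : Equiv.Perm (Fin (n + 1))) : Prop :=
  excSet x = excSet y ∧ excVal x = excVal y

theorem SameExc.symm {x y : Equiv.Perm (Fin (n + 1))} (h : SameExc x y) : SameExc y x :=
  ⟨h.1.symm, h.2.symm⟩

theorem SameExc.trans {x y z : Equiv.Perm (Fin (n + 1))} (h : SameExc x y) (h' : SameExc y z) :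
    SameExc x z :=
  ⟨h.1.trans h'.1, h.2.trans h'.2⟩

theorem SameExc.lt_iff {x y : Equiv.Perm (Fin (n + 1))} (h : SameExc x y) (m : Fin (n + 1)) :
    m < x m ↔ m < y m := by
  rw [← mem_excSet, h.1, mem_excSet]

theorem SameExc.exists_eq {x y : Equiv.Perm (Fin (n + 1))} (h : SameExc x y) (m : Fin (n + 1)) :
    ∃ k, (k < x k ↔ m < x m) ∧ y k = x m := by
  refine ⟨y⁻¹ (x m), ?_, perm_apply_inv_self _ _⟩
  rw [h.lt_iff, perm_apply_inv_self, ← mem_excVal, ← h.2, apply_mem_excVal]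

theorem IsIncreasing.eq_of_sameExc {w w' : Equiv.Perm (Fin (n + 1))} (h : IsIncreasing w)
    (h' : IsIncreasing w') (he : SameExc w w') : w = w' := by
  ext m
  congr 1
  by_cases hm : m < w m
  · refine eq_of_strictMonoOn (fun m => m < w m) h.1 (fun a b hab ha hb => ?_) ?_ ?_ m hm
    · exact h'.1 a b hab ((he.lt_iff a).mp ha) ((he.lt_iff b).mp hb)
    · intro a ha
      obtain ⟨k, hk, hk'⟩ := he.exists_eq a
      exact ⟨k, hk.mpr ha, hk'⟩
    · intro a ha
      obtain ⟨k, hk, hk'⟩ := he.symm.exists_eq a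
      rw [← he.lt_iff, ← he.lt_iff] at hk
      exact ⟨k, hk.mpr ha, hk'⟩
  · refine eq_of_strictMonoOn (fun m => ¬ m < w m)
      (fun a b hab ha hb => h.2 a b hab (not_lt.mp ha) (not_lt.mp hb))
      (fun a b hab ha hb => ?_) ?_ ?_ m hm
    · rw [he.lt_iff, not_lt] at ha hb
      exact h'.2 a b hab ha hb
    · intro a ha
      obtain ⟨k, hk, hk'⟩ := he.exists_eq a
      exact ⟨k, fun hc => ha (hk.mp hc), hk'⟩
    · intro a ha
      obtain ⟨k, hk, hk'⟩ := he.symm.exists_eq a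
      rw [← he.lt_iff, ← he.lt_iff] at hk
      exact ⟨k, fun hc => ha (hk.mp hc), hk'⟩

theorem IsCanonicalForm.spec {w : Equiv.Perm (Fin (n + 1))} {p : List (Fin n × Fin n)}
    (h : IsCanonicalForm n w p) :
    (∀ m, m < w m ↔ ∃ q ∈ p, m = q.2.castSucc) ∧ (∀ m, w⁻¹ m < m ↔ ∃ q ∈ p, m = q.1.succ) := by
  obtain ⟨h1, h2, h3, h4, -⟩ := h
  obtain ⟨i1, i2, -⟩ := runProd_spec p h1 h2 h3
  change runProd p = w at h4
  rw [h4] at i1 i2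
  have key : ∀ m, m < w m ↔ ∃ q ∈ p, m = q.2.castSucc := by
    intro m
    constructor
    · intro hm
      by_contra! hc
      have := i2 m hc
      omega
    · rintro ⟨q, hq, rfl⟩
      rw [i1 q hq, Fin.lt_def, Fin.val_castSucc, Fin.val_succ]
      have := h3 q hq
      omega
  refine ⟨key, fun m => ?_⟩
  obtain ⟨k, rfl⟩ := w.surjective m
  rw [perm_inv_apply_self, key]
  constructor
  · rintro ⟨q, hq, rfl⟩
    exact ⟨q, hq, i1 q hq⟩
  · rintro ⟨q, hq, he⟩
    rw [← i1 q hq] at he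
    exact ⟨q, hq, w.injective he⟩

theorem exists_pairs (w : Equiv.Perm (Fin (n + 1))) (l : List (Fin (n + 1)))
    (hl : ∀ d ∈ l, d < w d) : ∃ p : List (Fin n × Fin n),
      p.map (fun q => q.2.castSucc) = l ∧ p.map (fun q => q.1.succ) = l.map w := by
  induction l with
  | nil => exact ⟨[], rfl, rfl⟩
  | cons d l ih =>
    obtain ⟨p, h1, h2⟩ := ih fun d hd => hl d (List.mem_cons_of_mem _ hd)
    have hd := hl d List.mem_cons_self
    refine ⟨(⟨(w d).val - 1, by omega⟩, ⟨d.val, by omega⟩) :: p, ?_, ?_⟩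
    · rw [List.map_cons, h1]
      rfl
    · rw [List.map_cons, List.map_cons, h2]
      congr 1
      ext
      simp
      omega

theorem IsIncreasing.exists_isCanonicalForm {w : Equiv.Perm (Fin (n + 1))} (h : IsIncreasing w) :
    ∃ p, IsCanonicalForm n w p := by
  obtain ⟨p, hp1, hp2⟩ := exists_pairs w ((excSet w).sort (· ≤ ·)) fun d hd => by
    rwa [Finset.mem_sort, mem_excSet] at hd
  have hs : ((excSet w).sort (· ≤ ·)).Pairwise (· < ·) := (Finset.sortedLT_sort _).pairwise
  have h2 : (p.map Prod.snd).Pairwise (· < ·) := by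
    rw [← hp1, List.pairwise_map] at hs
    rw [List.pairwise_map]
    exact hs.imp fun {a b} hab => by simpa using hab
  have h1 : (p.map Prod.fst).Pairwise (· < ·) := by
    have : (((excSet w).sort (· ≤ ·)).map w).Pairwise (· < ·) := by
      rw [List.pairwise_map]
      refine hs.imp_of_mem fun {a b} ha hb hab => ?_
      rw [Finset.mem_sort, mem_excSet] at ha hb
      exact h.1 a b hab ha hb
    rw [← hp2, List.pairwise_map] at this
    rw [List.pairwise_map]
    exact this.imp fun {a b} hab => by simpa using hab
  have hw : ∀ q ∈ p, w q.2.castSucc = q.1.succ := by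
    rw [← hp1, List.map_map] at hp2
    exact fun q hq => ((List.map_inj_left.mp hp2) q hq).symm
  have hmem : ∀ m, m < w m ↔ ∃ q ∈ p, m = q.2.castSucc := by
    intro m
    rw [← mem_excSet, ← Finset.mem_sort (· ≤ ·), ← hp1, List.mem_map]
    simp only [eq_comm]
  have h3 : ∀ q ∈ p, q.2 ≤ q.1 := by
    intro q hq
    have := (hmem _).mpr ⟨q, hq, rfl⟩
    rw [hw q hq, Fin.lt_def, Fin.val_castSucc, Fin.val_succ] at this
    omega
  obtain ⟨i1, i2, i3, -, i5⟩ := runProd_spec p h1 h2 h3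
  have hexc : ∀ m, ¬ m < w m ↔ ∀ q ∈ p, m ≠ q.2.castSucc := fun m => by
    rw [hmem]
    push Not
    rfl
  have e : runProd p = w := by
    have hJ : ∀ m, m < w m → runProd p m = w m := by
      intro m hm
      obtain ⟨q, hq, rfl⟩ := (hmem m).mp hm
      rw [hw q hq, i1 q hq]
    ext m
    congr 1
    by_cases hm : m < w m
    · exact hJ m hm
    · refine eq_of_strictMonoOn (fun m => ¬ m < w m) (fun a b hab ha hb => i3 a b hab
        ((hexc a).mp ha) ((hexc b).mp hb)) (fun a b hab ha hb => h.2 a b hab (not_lt.mp ha)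
        (not_lt.mp hb)) ?_ ?_ m hm
      · intro a ha
        refine ⟨w⁻¹ (runProd p a), fun hc => ?_, perm_apply_inv_self _ _⟩
        have := hJ _ hc
        rw [perm_apply_inv_self] at this
        rw [(runProd p).injective this] at hc
        exact ha hc
      · intro a ha
        refine ⟨(runProd p)⁻¹ (w a), fun hc => ?_, perm_apply_inv_self _ _⟩
        have := hJ _ hc
        rw [perm_apply_inv_self] at this
        rw [← w.injective this] at hc
        exact ha hc
  refine ⟨p, h1, h2, h3, ?_⟩
  have := isReducedWord_of_length_eq_displacement i5
  rwa [← runProd, e] at this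

/-! ### Existence and uniqueness in a class of permutations with given excedances -/

/-- The weight, a measure that increases when an inversion is removed. -/
def weight (x : Equiv.Perm (Fin (n + 1))) : ℤ := ∑ m : Fin (n + 1), (m.val : ℤ) * (x m).val

theorem weight_mul_swap (x : Equiv.Perm (Fin (n + 1))) {a b : Fin (n + 1)} (hab : a ≠ b) :
    weight (x * Equiv.swap a b) - weight x = (a.val - b.val : ℤ) * ((x b).val - (x a).val) := by
  rw [weight, weight, ← Finset.sum_sub_distrib, Finset.sum_eq_add a b hab]
  · rw [Equiv.Perm.mul_apply, Equiv.Perm.mul_apply, Equiv.swap_apply_left,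
      Equiv.swap_apply_right]
    ring
  · intro c _ hc
    rw [Equiv.Perm.mul_apply, Equiv.swap_apply_of_ne_of_ne hc.1 hc.2, sub_self]
  · simp
  · simp

theorem weight_lt_mul_swap {x : Equiv.Perm (Fin (n + 1))} {a b : Fin (n + 1)} (hab : a < b)
    (h : x b < x a) : weight x < weight (x * Equiv.swap a b) := by
  have h1 := weight_mul_swap x hab.ne
  have h2 : (0 : ℤ) < (a.val - b.val : ℤ) * ((x b).val - (x a).val) :=
    mul_pos_of_neg_of_neg (by rw [Fin.lt_def] at hab; omega) (by rw [Fin.lt_def] at h; omega)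
  omega

theorem weight_mul_swap_lt {x : Equiv.Perm (Fin (n + 1))} {a b : Fin (n + 1)} (hab : a < b)
    (h : x a < x b) : weight (x * Equiv.swap a b) < weight x := by
  have := weight_lt_mul_swap (x := x * Equiv.swap a b) hab (by simpa using h)
  rwa [mul_assoc, Equiv.swap_mul_self, mul_one] at this

/-- The hypotheses say that `a` and `b` are of the same type and stay so after exchanging their
values. -/
theorem sameExc_mul_swap {x : Equiv.Perm (Fin (n + 1))} {a b : Fin (n + 1)}
    (h1 : a < x b ↔ a < x a) (h2 : b < x a ↔ a < x a) (h3 : b < x b ↔ a < x a) :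
    SameExc (x * Equiv.swap a b) x := by
  constructor
  · ext m
    rw [mem_excSet, mem_excSet, Equiv.Perm.mul_apply, Equiv.swap_apply_def]
    split_ifs with e1 e2
    · rw [e1, h1]
    · rw [e2, h2, h3]
    · rfl
  · ext m
    obtain ⟨k, rfl⟩ := x.surjective m
    rw [mem_excVal, mem_excVal, mul_inv_rev, Equiv.Perm.mul_apply, perm_inv_apply_self,
      Equiv.swap_inv, Equiv.swap_apply_def]
    split_ifs with e1 e2
    · rw [e1, h2]
    · rw [e2, h1, h3]
    · rfl

/-- The two hypotheses are exactly what weight minimality provides: nested values for two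
excedances, and for two non-excedances, whenever exchanging them would preserve the types. -/
theorem isNoncrossing_of_nesting {x : Equiv.Perm (Fin (n + 1))}
    (hE : ∀ a b, a < b → b < x a → b < x b → x b < x a)
    (hN : ∀ a b, a < b → x a ≤ a → x b ≤ a → x b < x a) : IsNoncrossing x := by
  intro m k hmk hk
  by_cases hkx : k < x k
  · exact ⟨hmk.trans hkx, hE m k hmk hk hkx⟩
  rw [not_lt] at hkx
  refine ⟨?_, hkx.trans_lt hk⟩
  by_contra! hc
  -- Were `x k ≤ m`, the points above `m` and up to `k` would be stable under the inverse, although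
  -- `x k` is the image of one of them and lies outside.
  have hinv : ∀ u, m < u ∧ u ≤ k → m < x⁻¹ u ∧ x⁻¹ u ≤ k := by
    intro u hu
    obtain ⟨v, rfl⟩ := x.surjective u
    rw [perm_inv_apply_self]
    by_cases hv : v < x v
    · refine ⟨?_, by omega⟩
      by_contra! hvm
      have hne : v ≠ m := by rintro rfl; omega
      have := hE v m (by omega) (by omega) (by omega)
      omega
    · refine ⟨by omega, ?_⟩
      by_contra! hkv
      have := hN k v hkv hkx hu.2
      omega
  have := mem_of_apply_mem x⁻¹ (S := fun u => m < u ∧ u ≤ k) hinv (a := x k)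
    (by rw [perm_inv_apply_self]; exact ⟨hmk, le_rfl⟩)
  omega

theorem IsNoncrossing.nesting {x : Equiv.Perm (Fin (n + 1))} (h : IsNoncrossing x)
    {a b : Fin (n + 1)} (hab : a < b) (ha : x a ≤ a) (hb : x b ≤ a) : x b < x a := by
  by_contra! hc
  have := h.mem_Icc_of_apply_mem ha hc hb
  omega

/-- At the minimum of the weight no exchange that lowers it can stay in the class. -/
theorem exists_isNoncrossing_sameExc (w : Equiv.Perm (Fin (n + 1))) :
    ∃ x, IsNoncrossing x ∧ SameExc x w := by
  classical
  obtain ⟨x, hx, hmin⟩ := Finset.exists_min_image (Finset.univ.filter fun x => SameExc x w) weight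
    ⟨w, Finset.mem_filter.mpr ⟨Finset.mem_univ _, rfl, rfl⟩⟩
  simp only [Finset.mem_filter, Finset.mem_univ, true_and] at hx hmin
  refine ⟨x, isNoncrossing_of_nesting ?_ ?_, hx⟩
  · intro a b hab h1 h2
    by_contra! hc
    have hne : x a ≠ x b := fun he => hab.ne (x.injective he)
    have h3 := hmin _ ((sameExc_mul_swap (a := a) (b := b) (by omega) (by omega) (by omega)).trans
      hx)
    have h4 := weight_mul_swap_lt (x := x) hab (by omega)
    omega
  · intro a b hab h1 h2
    by_contra! hc
    have hne : x a ≠ x b := fun he => hab.ne (x.injective he)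
    have h3 := hmin _ ((sameExc_mul_swap (a := a) (b := b) (by omega) (by omega) (by omega)).trans
      hx)
    have h4 := weight_mul_swap_lt (x := x) hab (by omega)
    omega

/-- At the maximum of the weight, two points of the same type cannot be out of order: exchanging
their values preserves the types and raises the weight. -/
theorem exists_isIncreasing_sameExc (x : Equiv.Perm (Fin (n + 1))) :
    ∃ w, IsIncreasing w ∧ SameExc w x := by
  classical
  obtain ⟨w, hw, hmax⟩ := Finset.exists_max_image (Finset.univ.filter fun w => SameExc w x) weight
    ⟨x, Finset.mem_filter.mpr ⟨Finset.mem_univ _, rfl, rfl⟩⟩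
  simp only [Finset.mem_filter, Finset.mem_univ, true_and] at hw hmax
  refine ⟨w, ⟨?_, ?_⟩, hw⟩
  · intro a b hab h1 h2
    by_contra! hc
    have hne : w a ≠ w b := fun he => hab.ne (w.injective he)
    have h3 := hmax _ ((sameExc_mul_swap (a := a) (b := b) (by omega) (by omega) (by omega)).trans
      hw)
    have h4 := weight_lt_mul_swap (x := w) hab (by omega)
    omega
  · intro a b hab h1 h2
    by_contra! hc
    have hne : w a ≠ w b := fun he => hab.ne (w.injective he)
    have h3 := hmax _ ((sameExc_mul_swap (a := a) (b := b) (by omega) (by omega) (by omega)).trans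
      hw)
    have h4 := weight_lt_mul_swap (x := w) hab (by omega)
    omega

/-- This is bracket matching: each excedance value, in increasing order, must be joined to the
nearest excedance on its left that is still free. -/
theorem IsNoncrossing.eq_of_sameExc {x y : Equiv.Perm (Fin (n + 1))} (hx : IsNoncrossing x)
    (hy : IsNoncrossing y) (h : SameExc x y) : x = y := by
  -- Here `y` agrees with `x` on all excedances whose `x`-value is below `k`. If the arc of `y`
  -- ending at `k` started to the right of that of `x`, its start would be an excedance of `x` with
  -- value below `k`, hence have the same value under `y`.
  have key1 : ∀ k : ℕ, ∀ x y : Equiv.Perm (Fin (n + 1)), IsNoncrossing x → SameExc x y →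
      (∀ b, y b = x b ∨ ¬ b < y b ∨ k ≤ (x b).val) → ∀ a, a < x a → (x a).val = k →
        ∀ a', a' < y a' → y a' = x a → ¬ a < a' := by
    intro k x y hx h ih a ha hk a' ha' he hlt
    have h1 := hx a a' hlt (by omega)
    rcases ih a' with h2 | h2 | h2
    · exact hlt.ne (x.injective (he.symm.trans h2))
    · exact h2 ha'
    · omega
  have hE : ∀ k : ℕ, ∀ a, a < x a → (x a).val = k → y a = x a := by
    intro k
    induction k using Nat.strong_induction_on with | _ k ih
    intro a ha hk
    obtain ⟨a', h1, h2⟩ := h.exists_eq a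
    have ha' := (h.lt_iff _).mp (h1.mpr ha)
    have n1 := key1 k x y hx h (fun b => by
      by_cases hb : b < x b
      · by_cases hbk : (x b).val < k
        · exact Or.inl (ih _ hbk b hb rfl)
        · exact Or.inr (Or.inr (not_lt.mp hbk))
      · rw [h.lt_iff] at hb
        exact Or.inr (Or.inl hb)) a ha hk a' ha' h2
    have n2 := key1 k y x hy h.symm (fun b => by
      by_cases hb : b < x b
      · by_cases hbk : (y b).val < k
        · obtain ⟨c, hc, hc'⟩ := h.symm.exists_eq b
          rw [← h.lt_iff, ← h.lt_iff] at hc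
          have h3 := ih _ (by rw [hc']; exact hbk) c (hc.mpr hb) rfl
          have : c = b := y.injective (h3.trans hc')
          rw [this] at hc'
          exact Or.inl hc'
        · exact Or.inr (Or.inr (not_lt.mp hbk))
      · exact Or.inr (Or.inl hb)) a' ha' (by rw [h2]; exact hk) a ha h2.symm
    have : a = a' := by omega
    rw [← h2, ← this]
  -- The non-excedances are processed by increasing position: by nesting, each takes the largest
  -- value not above it that is still free.
  have hN : ∀ k : ℕ, ∀ a : Fin (n + 1), ¬ a < x a → a.val = k → x a = y a := by
    intro k
    induction k using Nat.strong_induction_on with | _ k ih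
    intro a ha hk
    rcases lt_trichotomy (x a) (y a) with hlt | heq | hlt
    · obtain ⟨v, h1, h2⟩ := h.symm.exists_eq a
      rw [← h.lt_iff, ← h.lt_iff] at h1
      have hya := h.lt_iff a
      by_cases hv : v < a
      · have := ih v.val (by omega) v (fun hc => ha (h1.mp hc)) rfl
        have := y.injective (this.symm.trans h2)
        omega
      · have hne : v ≠ a := by rintro rfl; omega
        have := hx.nesting (a := a) (b := v) (by omega) (by omega) (by omega)
        omega
    · exact heq
    · obtain ⟨v, h1, h2⟩ := h.exists_eq a
      have hya := h.lt_iff a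
      by_cases hv : v < a
      · have := ih v.val (by omega) v (fun hc => ha (h1.mp hc)) rfl
        have := x.injective (this.trans h2)
        omega
      · have hne : v ≠ a := by rintro rfl; omega
        have := hy.nesting (a := a) (b := v) (by omega) (by omega) (by omega)
        omega
  ext m
  congr 1
  by_cases hm : m < x m
  · exact (hE _ m hm rfl).symm
  · exact hN _ m hm rfl

/-! ### The bijection `ψ` -/

/-- Both the canonical form of `w` and the polygon data of `x` only record excedances and excedance
values. -/
theorem corresponds_iff {w : Equiv.Perm (Fin (n + 1))} (hw : IsFullyCommutative n w)
    {x : Equiv.Perm (Fin (n + 1))} : Corresponds n w x ↔ IsNoncrossing x ∧ SameExc x w := by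
  rw [Corresponds, mem_NC_iff]
  refine and_congr_right fun hx => ?_
  rw [hx.setD_eq, hx.setU_eq]
  have key : ∀ p, IsCanonicalForm n w p →
      (({m | m < x m} = {m | ∃ q ∈ p, m = q.2.castSucc} ∧
        {m | x⁻¹ m < m} = {m | ∃ q ∈ p, m = q.1.succ}) ↔ SameExc x w) := by
    intro p hp
    obtain ⟨h1, h2⟩ := hp.spec
    simp only [← h1, ← h2, SameExc, Finset.ext_iff, Set.ext_iff, mem_excSet, mem_excVal,
      Set.mem_ofPred_eq]
  constructor
  · rintro ⟨p, hp, h⟩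
    exact (key p hp).mp h
  · intro h
    obtain ⟨p, hp⟩ := (isFullyCommutative_iff.mp hw).exists_isCanonicalForm
    exact ⟨p, hp, (key p hp).mpr h⟩

theorem exists_corresponds {w : Equiv.Perm (Fin (n + 1))} (hw : IsFullyCommutative n w) :
    ∃ x, Corresponds n w x := by
  obtain ⟨x, hx⟩ := exists_isNoncrossing_sameExc w
  exact ⟨x, (corresponds_iff hw).mpr hx⟩

theorem psi_spec {w : Equiv.Perm (Fin (n + 1))} (hw : IsFullyCommutative n w) :
    IsNoncrossing (psi n w) ∧ SameExc (psi n w) w := by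
  rw [← corresponds_iff hw, psi, dif_pos (exists_corresponds hw)]
  exact (exists_corresponds hw).choose_spec

theorem corresponds_iff_eq_psi {w : Equiv.Perm (Fin (n + 1))} (hw : IsFullyCommutative n w)
    (x : Equiv.Perm (Fin (n + 1))) : Corresponds n w x ↔ x = psi n w := by
  rw [corresponds_iff hw]
  constructor
  · rintro ⟨h1, h2⟩
    exact h1.eq_of_sameExc (psi_spec hw).1 (h2.trans (psi_spec hw).2.symm)
  · rintro rfl
    exact psi_spec hw

theorem bijOn_psi : Set.BijOn (psi n) {w | IsFullyCommutative n w} (NC n) := by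
  refine ⟨fun w hw => mem_NC_iff.mpr (psi_spec hw).1, fun w hw w' hw' h => ?_, fun x hx => ?_⟩
  · have h1 := (psi_spec hw).2.symm
    rw [h] at h1
    exact (isFullyCommutative_iff.mp hw).eq_of_sameExc (isFullyCommutative_iff.mp hw')
      (h1.trans (psi_spec hw').2)
  · obtain ⟨w, hw, hwx⟩ := exists_isIncreasing_sameExc x
    have hw' := isFullyCommutative_iff.mpr hw
    exact ⟨w, hw', ((corresponds_iff_eq_psi hw' x).mp ((corresponds_iff hw').mpr
      ⟨mem_NC_iff.mp hx, hwx.symm⟩)).symm⟩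

end CanonicalForm

/-! ### The sets `Q_w` consist of noncrossing partitions -/

section QSet

variable {n : ℕ}

/-- The condition under which `s_i` can be multiplied from the left within the noncrossing
partitions. -/
def LeftAdmissible (y : Equiv.Perm (Fin (n + 1))) (i : Fin n) : Prop :=
  y⁻¹ i.succ ≤ i.castSucc ∧ i.castSucc ≤ y⁻¹ i.castSucc

/-- The condition under which `s_i` can be multiplied from the right within the noncrossing
partitions. -/
def RightAdmissible (y : Equiv.Perm (Fin (n + 1))) (i : Fin n) : Prop :=
  i.succ ≤ y i.castSucc ∧ y i.succ ≤ i.succ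

theorem IsNoncrossing.simpleRefl_mul {y : Equiv.Perm (Fin (n + 1))} (h : IsNoncrossing y)
    {i : Fin n} (hi : LeftAdmissible y i) : IsNoncrossing (simpleRefl n i * y) := by
  obtain ⟨hp, hq⟩ := hi
  intro m k hmk hk
  have yp := perm_apply_inv_self y i.succ
  have yq := perm_apply_inv_self y i.castSucc
  generalize y⁻¹ i.succ = p at *
  generalize y⁻¹ i.castSucc = q at *
  have zm := simpleRefl_apply_val i (y m)
  have zk := simpleRefl_apply_val i (y k)
  rw [Equiv.Perm.mul_apply] at *
  rw [Equiv.Perm.mul_apply]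
  have a1 : (y m).val = i.val → m = q := fun e => y.injective (by rw [yq]; exact Fin.ext e)
  have a2 : (y m).val = i.val + 1 → m = p := fun e => y.injective (by rw [yp]; exact Fin.ext e)
  have a3 : (y k).val = i.val → k = q := fun e => y.injective (by rw [yq]; exact Fin.ext e)
  have a4 : (y k).val = i.val + 1 → k = p := fun e => y.injective (by rw [yp]; exact Fin.ext e)
  have vp : (y p).val = i.val + 1 := by rw [yp]; rfl
  have vq : (y q).val = i.val := by rw [yq]; rfl
  rw [Fin.le_def, Fin.val_castSucc] at hp hq
  -- Otherwise the arc from `p` to `i + 1` would enclose the value `i` but not its preimage `q`.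
  have hqp : p.val = i.val ∨ q.val = i.val := by
    by_contra! hc
    have := h.mem_Ioo_of_apply_mem (m := p) (k := q) (by omega) (by omega)
    omega
  have b1 := h m k hmk
  have b2 := h m p
  have b3 := h m q
  generalize simpleRefl n i (y m) = M at *
  generalize simpleRefl n i (y k) = K at *
  split_ifs at zm zk with c1 c2 c3 c4 <;> grind

theorem IsNoncrossing.mul_simpleRefl {y : Equiv.Perm (Fin (n + 1))} (h : IsNoncrossing y)
    {i : Fin n} (hi : RightAdmissible y i) : IsNoncrossing (y * simpleRefl n i) := by
  obtain ⟨hp, hq⟩ := hi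
  have hne := apply_castSucc_ne_apply_succ y i
  have zi : (y * simpleRefl n i) i.castSucc = y i.succ := by
    rw [Equiv.Perm.mul_apply, simpleRefl_apply_castSucc]
  have zi' : (y * simpleRefl n i) i.succ = y i.castSucc := by
    rw [Equiv.Perm.mul_apply, simpleRefl_apply_succ]
  have zo : ∀ m, m ≠ i.castSucc → m ≠ i.succ → (y * simpleRefl n i) m = y m := fun m h1 h2 => by
    rw [Equiv.Perm.mul_apply, simpleRefl, Equiv.swap_apply_of_ne_of_ne h1 h2]
  generalize y * simpleRefl n i = z at *
  have hA : i.castSucc.val + 1 = i.succ.val := rfl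
  generalize i.castSucc = A at *
  generalize i.succ = B at *
  have hfix : B < y A → y B = B := by
    intro hlt
    have := h A B (by omega) hlt
    omega
  intro m k hmk hk
  have inj : ∀ a b, y a = y b → a = b := fun a b e => y.injective e
  by_cases mA : m = A
  · subst mA
    omega
  by_cases mB : m = B
  · subst mB
    rw [zi'] at hk ⊢
    rw [zo k (by omega) (by omega)]
    have h1 := h A k (by omega) hk
    have h2 := hfix (by omega)
    have : y k ≠ m := fun he => by
      have := inj k m (he.trans h2.symm)
      omega
    omega
  rw [zo m mA mB] at *
  by_cases kA : k = A
  · subst kA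
    rw [zi]
    have h1 := h m k hmk hk
    have h2 := h m B (by omega)
    have : y m = B → False := fun he => by
      by_cases hlt : B < y k
      · exact mB (inj m B (he.trans (hfix hlt).symm))
      · exact mA (inj m k (he.trans (by omega)))
    omega
  by_cases kB : k = B
  · subst kB
    rw [zi']
    exact h m A (by omega) (by omega)
  rw [zo k kA kB]
  exact h m k hmk hk

theorem LeftAdmissible.weight_lt {y : Equiv.Perm (Fin (n + 1))} {i : Fin n}
    (hi : LeftAdmissible y i) : weight y < weight (simpleRefl n i * y) := by
  have h : y⁻¹ i.succ < y⁻¹ i.castSucc :=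
    lt_of_le_of_ne (hi.1.trans hi.2) (apply_castSucc_ne_apply_succ y⁻¹ i).symm
  rw [simpleRefl, Equiv.swap_mul_eq_mul_swap, Equiv.swap_comm]
  refine weight_lt_mul_swap h ?_
  rw [perm_apply_inv_self, perm_apply_inv_self]
  exact Fin.castSucc_lt_succ

theorem RightAdmissible.weight_lt {y : Equiv.Perm (Fin (n + 1))} {i : Fin n}
    (hi : RightAdmissible y i) : weight y < weight (y * simpleRefl n i) :=
  weight_lt_mul_swap Fin.castSucc_lt_succ
    (lt_of_le_of_ne (hi.2.trans hi.1) (apply_castSucc_ne_apply_succ y i).symm)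

theorem LeftAdmissible.ne {y : Equiv.Perm (Fin (n + 1))} {i j : Fin n}
    (hi : LeftAdmissible y i) (hj : LeftAdmissible y j) : i.val + 1 ≠ j.val := by
  intro hij
  have e : i.succ = j.castSucc := by ext; simpa using hij
  have h1 := hi.1
  have h2 := hj.2
  rw [e] at h1
  rw [Fin.le_def, Fin.val_castSucc] at *
  omega

theorem RightAdmissible.ne {y : Equiv.Perm (Fin (n + 1))} {i j : Fin n}
    (hi : RightAdmissible y i) (hj : RightAdmissible y j) : i.val + 1 ≠ j.val := by
  intro hij
  have e : i.succ = j.castSucc := by ext; simpa using hij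
  have h1 := hi.2
  have h2 := hj.1
  rw [e] at h1
  rw [Fin.le_def, Fin.val_succ] at *
  rw [Fin.val_castSucc] at h1
  omega

theorem LeftAdmissible.simpleRefl_mul {y : Equiv.Perm (Fin (n + 1))} {i j : Fin n}
    (hi : LeftAdmissible y i) (hj : LeftAdmissible y j) (hij : j ≠ i) :
    LeftAdmissible (simpleRefl n i * y) j := by
  have h1 := hi.ne hj
  have h2 := hj.ne hi
  have h3 : j.val ≠ i.val := fun he => hij (Fin.ext he)
  have e1 : simpleRefl n i j.succ = j.succ := by
    ext; rw [simpleRefl_apply_val, Fin.val_succ]; split_ifs <;> omega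
  have e2 : simpleRefl n i j.castSucc = j.castSucc := by
    ext; rw [simpleRefl_apply_val, Fin.val_castSucc]; split_ifs <;> omega
  rwa [LeftAdmissible, mul_inv_rev, simpleRefl_inv, Equiv.Perm.mul_apply, Equiv.Perm.mul_apply,
    e1, e2]

theorem RightAdmissible.mul_simpleRefl {y : Equiv.Perm (Fin (n + 1))} {i j : Fin n}
    (hi : RightAdmissible y i) (hj : RightAdmissible y j) (hij : j ≠ i) :
    RightAdmissible (y * simpleRefl n i) j := by
  have h1 := hi.ne hj
  have h2 := hj.ne hi
  have h3 : j.val ≠ i.val := fun he => hij (Fin.ext he)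
  have e1 : simpleRefl n i j.succ = j.succ := by
    ext; rw [simpleRefl_apply_val, Fin.val_succ]; split_ifs <;> omega
  have e2 : simpleRefl n i j.castSucc = j.castSucc := by
    ext; rw [simpleRefl_apply_val, Fin.val_castSucc]; split_ifs <;> omega
  rwa [RightAdmissible, Equiv.Perm.mul_apply, Equiv.Perm.mul_apply, e1, e2]

/-- The preimage of `i + 1` can be pushed above `i` only by `s_i`, and the preimage of `i` can be
pushed below `i` only by `s_{i-1}`. These are the two excluded values of `r`. -/
theorem LeftAdmissible.mul_simpleRefl {y : Equiv.Perm (Fin (n + 1))} {i r : Fin n}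
    (hi : LeftAdmissible y i) (hir : ¬ Conflict i r) :
    LeftAdmissible (y * simpleRefl n r) i := by
  obtain ⟨h1, h2⟩ := hi
  have h3 : r.val ≠ i.val := fun he => hir (Or.inl (Fin.ext he))
  have h4 : r.val + 1 ≠ i.val := fun he => hir (Or.inr he)
  have e1 := simpleRefl_apply_val r (y⁻¹ i.succ)
  have e2 := simpleRefl_apply_val r (y⁻¹ i.castSucc)
  rw [LeftAdmissible, mul_inv_rev, simpleRefl_inv, Equiv.Perm.mul_apply, Equiv.Perm.mul_apply]
  rw [Fin.le_def, Fin.val_castSucc] at *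
  rw [Fin.le_def, Fin.val_castSucc]
  split_ifs at e1 e2 <;> omega

/-- Successive multiplication by simple reflections from the right. -/
theorem mul_wordProd_spec (l : List (Fin n)) (hl : l.Nodup) (y : Equiv.Perm (Fin (n + 1)))
    (h : IsNoncrossing y) (hr : ∀ r ∈ l, RightAdmissible y r) :
    IsNoncrossing (y * wordProd n l) ∧ (y * wordProd n l = y ∨
      weight y < weight (y * wordProd n l)) ∧
      ∀ i, LeftAdmissible y i → (∀ r ∈ l, ¬ Conflict i r) → LeftAdmissible (y * wordProd n l) i := by
  induction l generalizing y with
  | nil => simpa [wordProd] using h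
  | cons r l ih =>
    rw [List.nodup_cons] at hl
    rw [List.forall_mem_cons] at hr
    obtain ⟨h1, h2, h3⟩ := ih hl.2 (y * simpleRefl n r) (h.mul_simpleRefl hr.1) fun r' hr' =>
      hr.1.mul_simpleRefl (hr.2 r' hr') fun he => hl.1 (he ▸ hr')
    rw [wordProd_cons, ← mul_assoc]
    refine ⟨h1, Or.inr ?_, fun i hi hc => ?_⟩
    · rcases h2 with h2 | h2
      · rw [h2]
        exact hr.1.weight_lt
      · exact hr.1.weight_lt.trans h2
    · rw [List.forall_mem_cons] at hc
      exact h3 i (hi.mul_simpleRefl hc.1) hc.2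

theorem wordProd_mul_spec (l : List (Fin n)) (hl : l.Nodup) (y : Equiv.Perm (Fin (n + 1)))
    (h : IsNoncrossing y) (hr : ∀ r ∈ l, LeftAdmissible y r) :
    IsNoncrossing (wordProd n l * y) ∧ (wordProd n l * y = y ∨
      weight y < weight (wordProd n l * y)) := by
  induction l using List.reverseRecOn generalizing y with
  | nil => simpa [wordProd] using h
  | append_singleton l r ih =>
    rw [List.nodup_append] at hl
    have hr' : LeftAdmissible y r := hr r (by simp)
    obtain ⟨h1, h2⟩ := ih hl.1 (simpleRefl n r * y) (h.simpleRefl_mul hr') fun r' hr'' =>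
      hr'.simpleRefl_mul (hr r' (by simp [hr''])) (hl.2.2 r' hr'' r (by simp))
    rw [wordProd_append, wordProd_singleton, mul_assoc]
    refine ⟨h1, Or.inr ?_⟩
    rcases h2 with h2 | h2
    · rw [h2]
      exact hr'.weight_lt
    · exact hr'.weight_lt.trans h2

theorem SameExc.inv_lt_iff {x y : Equiv.Perm (Fin (n + 1))} (h : SameExc x y)
    (m : Fin (n + 1)) : x⁻¹ m < m ↔ y⁻¹ m < m := by
  rw [← mem_excVal, h.2, mem_excVal]

/-- As `w` is increasing on each type, the two preimages at a descent have different types: `i + 1`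
is an excedance value and `i` is not. This depends on the excedances only and passes to ψ(w). -/
theorem leftAdmissible_psi {w : Equiv.Perm (Fin (n + 1))} (hw : IsFullyCommutative n w)
    {i : Fin n} (hi : i ∈ leftDescents n w) : LeftAdmissible (psi n w) i := by
  rw [mem_leftDescents] at hi
  have hinc := isFullyCommutative_iff.mp hw
  have h1 := (psi_spec hw).2.inv_lt_iff i.succ
  have h2 := (psi_spec hw).2.inv_lt_iff i.castSucc
  have key : w⁻¹ i.succ < i.succ ∧ ¬ w⁻¹ i.castSucc < i.castSucc := by
    have e1 := perm_apply_inv_self w i.succ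
    have e2 := perm_apply_inv_self w i.castSucc
    generalize w⁻¹ i.succ = p at *
    generalize w⁻¹ i.castSucc = q at *
    have f1 := hinc.1 p q hi
    have f2 := hinc.2 p q hi
    rw [e1, e2] at f1 f2
    have : i.castSucc.val + 1 = i.succ.val := rfl
    omega
  have : i.castSucc.val + 1 = i.succ.val := rfl
  refine ⟨?_, ?_⟩ <;> omega

theorem rightAdmissible_psi {w : Equiv.Perm (Fin (n + 1))} (hw : IsFullyCommutative n w)
    {i : Fin n} (hi : i ∈ rightDescents n w) : RightAdmissible (psi n w) i := by
  rw [mem_rightDescents] at hi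
  have hinc := isFullyCommutative_iff.mp hw
  have h1 := (psi_spec hw).2.lt_iff i.succ
  have h2 := (psi_spec hw).2.lt_iff i.castSucc
  have : i.castSucc.val + 1 = i.succ.val := rfl
  have f1 := hinc.1 i.castSucc i.succ Fin.castSucc_lt_succ
  have f2 := hinc.2 i.castSucc i.succ Fin.castSucc_lt_succ
  refine ⟨?_, ?_⟩ <;> omega

theorem RemovalStep.subset {P P' : Finset (Fin n) × Finset (Fin n)}
    (h : Relation.ReflTransGen (RemovalStep n) P P') : P'.1 ⊆ P.1 ∧ P'.2 ⊆ P.2 := by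
  induction h with
  | refl => exact ⟨subset_rfl, subset_rfl⟩
  | tail _ h ih =>
    cases h with
    | left L R i r => exact ⟨(Finset.erase_subset _ _).trans ih.1, ih.2⟩
    | right L R i r => exact ⟨ih.1, (Finset.erase_subset _ _).trans ih.2⟩

/-- The triangularity statement: apart from ψ(w) itself, every member of the set has strictly larger
weight. -/
theorem Q_spec {w : Equiv.Perm (Fin (n + 1))} (hw : IsFullyCommutative n w)
    {x : Equiv.Perm (Fin (n + 1))} (hx : x ∈ Q n w) :
    IsNoncrossing x ∧ (x = psi n w ∨ weight (psi n w) < weight x) := by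
  obtain ⟨L, R, L', R', hL, hR, ⟨hred, hend⟩, rfl⟩ := hx
  obtain ⟨hL', hR'⟩ := RemovalStep.subset hred
  -- The right factors are applied first. That the pair is an ending pair is what keeps the left
  -- factors admissible afterwards.
  obtain ⟨h1, h2, h3⟩ := mul_wordProd_spec (R'.sort (· ≤ ·)) (Finset.sort_nodup _ _) (psi n w)
    (psi_spec hw).1 fun r hr => rightAdmissible_psi hw (hR (hR' ((Finset.mem_sort _).mp hr)))
  obtain ⟨h4, h5⟩ := wordProd_mul_spec (L'.sort (· ≤ ·)) (Finset.sort_nodup _ _) _ h1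
    fun i hi => h3 i (leftAdmissible_psi hw (hL (hL' ((Finset.mem_sort _).mp hi))))
      fun r hr => hend i ((Finset.mem_sort _).mp hi) r ((Finset.mem_sort _).mp hr)
  rw [mul_assoc]
  refine ⟨h4, ?_⟩
  rw [finsetProd, finsetProd]
  rcases h5 with h5 | h5
  · rw [h5]
    exact h2
  · rcases h2 with h2 | h2
    · rw [h2] at h5 ⊢
      exact Or.inr h5
    · exact Or.inr (h2.trans h5)

theorem psi_mem_Q (w : Equiv.Perm (Fin (n + 1))) : psi n w ∈ Q n w :=
  ⟨∅, ∅, ∅, ∅, by simp, by simp, ⟨.refl, by simp⟩, by simp [finsetProd, wordProd]⟩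

theorem Q_subset_NC {w : Equiv.Perm (Fin (n + 1))} (hw : IsFullyCommutative n w) :
    Q n w ⊆ NC n := fun _ hx => (Q_spec hw hx).1.mem_NC

end QSet

/-! ### The dual braid relations -/

section DualBraid

variable {G : Type*} [Group G] (σ : ℕ → G)

/-- The conjugate `σ_{q-1}⁻¹ ⋯ σ_{p+1}⁻¹ σ_p σ_{p+1} ⋯ σ_{q-1}`. -/
def conjGen (p : ℕ) : ℕ → G
  | 0 => 1
  | q + 1 => if q ≤ p then σ p else (σ q)⁻¹ * conjGen p q * σ q

variable {σ}

theorem conjGen_self_succ (p : ℕ) : conjGen σ p (p + 1) = σ p := by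
  rw [conjGen, if_pos le_rfl]

theorem conjGen_succ {p q : ℕ} (h : p < q) :
    conjGen σ p (q + 1) = (σ q)⁻¹ * conjGen σ p q * σ q := by
  rw [conjGen, if_neg (by omega)]

theorem commute_conj {a b c : G} (h1 : Commute a b) (h2 : Commute a c) :
    Commute a (c⁻¹ * b * c) :=
  (h2.inv_right.mul_right h1).mul_right h2

theorem commute_conjGen_right {a : G} {p q : ℕ} (hpq : p < q)
    (h : ∀ i, p ≤ i → i < q → Commute a (σ i)) : Commute a (conjGen σ p q) := by
  induction q, hpq using Nat.le_induction with
  | base =>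
    rw [conjGen_self_succ]
    exact h p le_rfl (by omega)
  | succ q hq ih =>
    rw [conjGen_succ hq]
    exact commute_conj (ih fun i h1 h2 => h i h1 (by omega)) (h q (by omega) (by omega))

/-- The braid relations among `σ 0, …, σ (N - 1)`. -/
structure IsBraided (σ : ℕ → G) (N : ℕ) : Prop where
  braid : ∀ i, i + 1 < N → σ i * σ (i + 1) * σ i = σ (i + 1) * σ i * σ (i + 1)
  comm : ∀ i j, i + 1 < j → Commute (σ i) (σ j)

namespace IsBraided

variable {N : ℕ} (h : IsBraided σ N)
include h

theorem commute_conjGen_gen {p q i : ℕ} (hpq : p < q) (hq : q < i) :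
    Commute (conjGen σ p q) (σ i) :=
  (commute_conjGen_right hpq fun j _ hj => (h.comm j i (by omega)).symm).symm

theorem commute_of_separate {p q r s : ℕ} (hpq : p < q) (hqr : q < r) (hrs : r < s) :
    Commute (conjGen σ p q) (conjGen σ r s) :=
  commute_conjGen_right hrs fun _ hi _ => h.commute_conjGen_gen hpq (by omega)

theorem conjGen_braid {p q : ℕ} (hpq : p < q) (hq : q < N) :
    conjGen σ p q * σ q * conjGen σ p q = σ q * conjGen σ p q * σ q := by
  induction q, hpq using Nat.le_induction with
  | base =>
    rw [conjGen_self_succ]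
    exact h.braid p hq
  | succ q hpq ih =>
    have h1 := ih (by omega)
    have h2 := h.braid q hq
    have h3 := (h.commute_conjGen_gen (i := q + 1) hpq (by omega)).eq
    rw [conjGen_succ hpq]
    generalize conjGen σ p q = A at *
    generalize σ q = B at *
    generalize σ (q + 1) = C at *
    -- The inductive braid relation between `A` and `B` exchanges the roles of the conjugating and
    -- the conjugated element; `A` commutes with `C`, so the relation for `B` and `C` can be
    -- conjugated by `A`.
    have e : B⁻¹ * A * B = A * B * A⁻¹ := by
      rw [eq_mul_inv_iff_mul_eq, mul_assoc, mul_assoc, inv_mul_eq_iff_eq_mul, ← mul_assoc,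
        ← mul_assoc, h1]
    have e' : A⁻¹ * C * A = C := by rw [mul_assoc, ← h3, inv_mul_cancel_left]
    calc B⁻¹ * A * B * C * (B⁻¹ * A * B) = A * B * (A⁻¹ * C * A) * B * A⁻¹ := by
          rw [e]; group
      _ = A * (C * B * C) * A⁻¹ := by rw [e', ← h2]; group
      _ = (A * C * A⁻¹) * (A * B * A⁻¹) * (A * C * A⁻¹) := by group
      _ = C * (B⁻¹ * A * B) * C := by rw [e, h3, mul_inv_cancel_right]

/-- Induction on `r` conjugates the relation by `σ r`, which commutes with the first factor. The
next lemma, proved alike, completes the chain of three equal products on three points. -/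
theorem conjGen_mul {p q r : ℕ} (hpq : p < q) (hqr : q < r) :
    conjGen σ p q * conjGen σ q r = conjGen σ q r * conjGen σ p r := by
  induction r, hqr using Nat.le_induction with
  | base =>
    rw [conjGen_self_succ, conjGen_succ hpq]
    group
  | succ r hqr ih =>
    have h3 := (h.commute_conjGen_gen (i := r) hpq hqr).eq
    rw [conjGen_succ hqr, conjGen_succ (by omega : p < r)]
    generalize conjGen σ p q = A at *
    generalize conjGen σ q r = B at *
    generalize conjGen σ p r = D at *
    generalize σ r = C at *
    have e : A = C⁻¹ * A * C := by rw [mul_assoc, h3, inv_mul_cancel_left]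
    calc A * (C⁻¹ * B * C) = (C⁻¹ * A * C) * (C⁻¹ * B * C) := by rw [← e]
      _ = C⁻¹ * (A * B) * C := by group
      _ = C⁻¹ * B * C * (C⁻¹ * D * C) := by rw [ih]; group

theorem conjGen_mul' {p q r : ℕ} (hpq : p < q) (hqr : q < r) (hr : r ≤ N) :
    conjGen σ q r * conjGen σ p r = conjGen σ p r * conjGen σ p q := by
  induction r, hqr using Nat.le_induction with
  | base =>
    have := h.conjGen_braid hpq (by omega)
    rw [conjGen_self_succ, conjGen_succ hpq]
    generalize conjGen σ p q = A at *
    generalize σ q = B at *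
    rw [mul_assoc, mul_inv_cancel_left, mul_assoc, mul_assoc, eq_inv_mul_iff_mul_eq, ← mul_assoc,
      ← mul_assoc, this]
  | succ r hqr ih =>
    have h3 := (h.commute_conjGen_gen (i := r) hpq hqr).eq
    have ih := ih (by omega)
    rw [conjGen_succ hqr, conjGen_succ (by omega : p < r)]
    generalize conjGen σ p q = A at *
    generalize conjGen σ q r = B at *
    generalize conjGen σ p r = D at *
    generalize σ r = C at *
    have e : A = C⁻¹ * A * C := by rw [mul_assoc, h3, inv_mul_cancel_left]
    calc C⁻¹ * B * C * (C⁻¹ * D * C) = C⁻¹ * (B * D) * C := by group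
      _ = C⁻¹ * D * C * (C⁻¹ * A * C) := by rw [ih]; group
      _ = C⁻¹ * D * C * A := by rw [← e]

/-- For `s = r + 1` both elements are conjugates, by the same `B * C`, of the commuting elements `C`
and `A`. -/
theorem commute_of_nested {p q r s : ℕ} (hpq : p < q) (hqr : q < r) (hrs : r < s) (hs : s ≤ N) :
    Commute (conjGen σ q r) (conjGen σ p s) := by
  induction s, hrs using Nat.le_induction with
  | base =>
    have h1 := h.conjGen_mul hpq hqr
    have h2 := h.conjGen_braid hqr (by omega)
    have h3 := (h.commute_conjGen_gen (i := r) hpq (by omega)).eq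
    rw [conjGen_succ (by omega : p < r)]
    generalize conjGen σ p q = A at *
    generalize conjGen σ q r = B at *
    generalize conjGen σ p r = D at *
    generalize σ r = C at *
    have e1 : D = B⁻¹ * A * B := by rw [mul_assoc, h1, inv_mul_cancel_left]
    have e2 : B = (B * C)⁻¹ * C * (B * C) := by
      rw [mul_assoc, ← mul_assoc C, ← h2]
      group
    have e3 : C⁻¹ * D * C = (B * C)⁻¹ * A * (B * C) := by rw [e1]; group
    rw [e3]
    rw [commute_iff_eq]
    calc B * ((B * C)⁻¹ * A * (B * C)) = (B * C)⁻¹ * C * (B * C) * ((B * C)⁻¹ * A * (B * C)) := by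
          rw [← e2]
      _ = (B * C)⁻¹ * (C * A) * (B * C) := by group
      _ = (B * C)⁻¹ * A * (B * C) * ((B * C)⁻¹ * C * (B * C)) := by rw [← h3]; group
      _ = (B * C)⁻¹ * A * (B * C) * B := by rw [← e2]
  | succ s hrs ih =>
    rw [conjGen_succ (by omega : p < s)]
    exact commute_conj (ih (by omega)) (h.commute_conjGen_gen hqr hrs)

end IsBraided

variable {n : ℕ}

/-- The generators of the braid group, indexed by the natural numbers. -/
def braidGenNat (n i : ℕ) : Braid n := if h : i < n then braidGen n ⟨i, h⟩ else 1

theorem isBraided_braidGenNat : IsBraided (braidGenNat n) n where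
  braid i hi := by
    rw [braidGenNat, braidGenNat, dif_pos (by omega), dif_pos hi]
    have := PresentedGroup.one_of_mem (rels := {r | IsBraidRelator n r})
      (IsBraidRelator.braid (⟨i, by omega⟩ : Fin n) ⟨i + 1, hi⟩ rfl)
    rw [map_mul, map_inv, mul_inv_eq_one] at this
    simpa [braidGen, PresentedGroup.of] using this
  comm i j hij := by
    rw [braidGenNat, braidGenNat]
    split_ifs with h1 h2
    · have := PresentedGroup.one_of_mem (rels := {r | IsBraidRelator n r})
        (IsBraidRelator.comm (⟨i, h1⟩ : Fin n) ⟨j, h2⟩ (Or.inl hij))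
      rw [map_mul, map_inv, mul_inv_eq_one] at this
      rw [commute_iff_eq]
      simpa [braidGen, PresentedGroup.of] using this
    · exact Commute.one_right _
    · exact Commute.one_left _
    · exact Commute.one_left _

theorem braidTransp_eq_aux (p : ℕ) (q : ℕ) (hpq : p < q) (hq : q ≤ n) :
    ((((List.finRange n).filter (fun i => p < i.val ∧ i.val < q)).map (braidGen n)).prod)⁻¹ *
      braidGenNat n p *
      (((List.finRange n).filter (fun i => p < i.val ∧ i.val < q)).map (braidGen n)).prod =
      conjGen (braidGenNat n) p q := by
  induction q, hpq using Nat.le_induction with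
  | base =>
    rw [conjGen_self_succ]
    have : (List.finRange n).filter (fun i => p < i.val ∧ i.val < p + 1) = [] := by
      rw [List.filter_eq_nil_iff]
      intro i _
      simp
    rw [this]
    simp
  | succ q hpq ih =>
    have e := filter_finRange_eq_append (n := n)
      (p := fun i => decide (p < i.val ∧ i.val < q + 1))
      (q := fun i => decide (p < i.val ∧ i.val < q)) (i := ⟨q, hq⟩) (fun m => by
        simp [Fin.ext_iff]
        omega) (fun m => by
        simp [Fin.lt_def])
    rw [conjGen_succ hpq, ← ih (by omega), e, List.map_append, List.prod_append]
    have : braidGenNat n q = braidGen n ⟨q, hq⟩ := dif_pos _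
    simp [this, mul_assoc]

theorem braidTransp_eq (t : Transp n) :
    braidTransp n t = conjGen (braidGenNat n) t.1.1.val t.1.2.val := by
  rw [← braidTransp_eq_aux _ _ t.2 (by omega), braidGenNat, dif_pos]
  rfl

end DualBraid

/-! ### Independence of the reduced decomposition -/

section Independence

variable {n : ℕ}

/-- The transposition exchanging `a` and `b`. -/
abbrev mkTransp {a b : Fin (n + 1)} (h : a < b) : Transp n := ⟨(a, b), h⟩

/-- The lift of the transposition exchanging `a` and `b`. -/
abbrev bt {a b : Fin (n + 1)} (h : a < b) : Braid n := braidTransp n (mkTransp h)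

section Relations

variable {a b c d : Fin (n + 1)}

theorem bt_mul (hab : a < b) (hbc : b < c) : bt hab * bt hbc = bt hbc * bt (hab.trans hbc) := by
  simp only [bt, braidTransp_eq]
  exact isBraided_braidGenNat.conjGen_mul hab hbc

theorem bt_mul' (hab : a < b) (hbc : b < c) :
    bt hbc * bt (hab.trans hbc) = bt (hab.trans hbc) * bt hab := by
  simp only [bt, braidTransp_eq]
  exact isBraided_braidGenNat.conjGen_mul' hab hbc (by omega)

theorem bt_comm_of_separate (hab : a < b) (hbc : b < c) (hcd : c < d) :
    bt hab * bt hcd = bt hcd * bt hab := by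
  simp only [bt, braidTransp_eq]
  exact isBraided_braidGenNat.commute_of_separate hab hbc hcd

theorem bt_comm_of_nested (hab : a < b) (hbc : b < c) (hcd : c < d) :
    bt hbc * bt (hab.trans (hbc.trans hcd)) = bt (hab.trans (hbc.trans hcd)) * bt hbc := by
  simp only [bt, braidTransp_eq]
  exact isBraided_braidGenNat.commute_of_nested hab hbc hcd (by omega)

end Relations

theorem simpleElt_spec (x : Equiv.Perm (Fin (n + 1))) :
    ∃ u, IsReducedTranspWord n x u ∧ simpleElt n x = braidTranspProd n u :=
  ⟨_, (exists_isReducedTranspWord n x).choose_spec, rfl⟩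

theorem braidTranspProd_cons (t : Transp n) (u : List (Transp n)) :
    braidTranspProd n (t :: u) = braidTransp n t * braidTranspProd n u := by
  simp [braidTranspProd]

theorem IsNoncrossing.lenT_swap_mul {x : Equiv.Perm (Fin (n + 1))} (h : IsNoncrossing x)
    {a b : Fin (n + 1)} (hab : a < b) (hs : x.SameCycle a b) :
    lenT n (Equiv.swap a b * x) + 1 = lenT n x := by
  rw [(h.swap_mul hab hs).lenT_eq, h.lenT_eq, h.card_excSet_swap_mul hab hs]

theorem IsNoncrossing.of_cons {x : Equiv.Perm (Fin (n + 1))} (h : IsNoncrossing x)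
    {t : Transp n} {u : List (Transp n)} (hu : IsReducedTranspWord n x (t :: u)) :
    x.SameCycle t.1.1 t.1.2 ∧ IsReducedTranspWord n (Equiv.swap t.1.1 t.1.2 * x) u := by
  have h1 : transpProd n u = Equiv.swap t.1.1 t.1.2 * x := by
    rw [← hu.1, transpProd_cons, Transp.toPerm, ← mul_assoc, Equiv.swap_mul_self, one_mul]
  have h2 := hu.2
  rw [List.length_cons] at h2
  have h3 := lenT_transpProd_le u
  rw [h1] at h3
  have hs := h.sameCycle_of_lenT_swap_mul_lt (a := t.1.1) (b := t.1.2) (by omega)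
  refine ⟨hs, h1, ?_⟩
  have := h.lenT_swap_mul t.2 hs
  omega

theorem IsNoncrossing.cons {x : Equiv.Perm (Fin (n + 1))} (h : IsNoncrossing x)
    {t : Transp n} (hs : x.SameCycle t.1.1 t.1.2) {u : List (Transp n)}
    (hu : IsReducedTranspWord n (Equiv.swap t.1.1 t.1.2 * x) u) :
    IsReducedTranspWord n x (t :: u) := by
  refine ⟨?_, ?_⟩
  · rw [transpProd_cons, hu.1, Transp.toPerm, ← mul_assoc, Equiv.swap_mul_self, one_mul]
  · rw [List.length_cons, hu.2, h.lenT_swap_mul t.2 hs]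

/-- All reduced decompositions of `x` have the same lift to the braid group. -/
def LiftsUniquely (x : Equiv.Perm (Fin (n + 1))) : Prop :=
  ∀ u, IsReducedTranspWord n x u → braidTranspProd n u = simpleElt n x

theorem LiftsUniquely.simpleElt_eq {x : Equiv.Perm (Fin (n + 1))} (hx : LiftsUniquely x)
    (h : IsNoncrossing x) {a b : Fin (n + 1)} (hab : a < b) (hs : x.SameCycle a b) :
    simpleElt n x = bt hab * simpleElt n (Equiv.swap a b * x) := by
  obtain ⟨u, hu, he⟩ := simpleElt_spec (Equiv.swap a b * x)
  rw [he, ← braidTranspProd_cons]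
  exact (hx _ (h.cons (t := mkTransp hab) hs hu)).symm

section Confluence

variable {x : Equiv.Perm (Fin (n + 1))} (h : IsNoncrossing x)
  (ih : ∀ y : Equiv.Perm (Fin (n + 1)), IsNoncrossing y → lenT n y < lenT n x → LiftsUniquely y)
include h ih

/-- Both sides are continued by a second letter so that the two-letter products agree, in the
symmetric group and in the braid group. The common rest has a smaller length, where the lift is
already unique. -/
theorem IsNoncrossing.confluence {a b c d a' b' c' d' : Fin (n + 1)} (hab : a < b) (hcd : c < d)
    (hab' : a' < b') (hcd' : c' < d') (hs : x.SameCycle a b) (hs' : x.SameCycle a' b')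
    (hs1 : x.SameCycle c d) (hs1' : x.SameCycle c' d')
    (h1 : (a ≤ c ∧ c < b) ↔ (a ≤ d ∧ d < b)) (h2 : (a' ≤ c' ∧ c' < b') ↔ (a' ≤ d' ∧ d' < b'))
    (hp : Equiv.swap a b * Equiv.swap c d = Equiv.swap a' b' * Equiv.swap c' d')
    (hb : bt hab * bt hcd = bt hab' * bt hcd') :
    bt hab * simpleElt n (Equiv.swap a b * x) = bt hab' * simpleElt n (Equiv.swap a' b' * x) := by
  have l1 := h.lenT_swap_mul hab hs
  have l2 := h.lenT_swap_mul hab' hs'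
  have n1 := h.swap_mul hab hs
  have n2 := h.swap_mul hab' hs'
  rw [(ih _ n1 (by omega)).simpleElt_eq n1 hcd (h.sameCycle_swap_mul hab hs hs1 h1),
    (ih _ n2 (by omega)).simpleElt_eq n2 hcd' (h.sameCycle_swap_mul hab' hs' hs1' h2),
    ← mul_assoc, ← mul_assoc, hb]
  have hp' : Equiv.swap c d * Equiv.swap a b = Equiv.swap c' d' * Equiv.swap a' b' := by
    have := congrArg (·⁻¹) hp
    simpa only [mul_inv_rev, Equiv.swap_inv] using this
  rw [← mul_assoc, ← mul_assoc, hp']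

theorem IsNoncrossing.confluence_triple {a b c : Fin (n + 1)} (hab : a < b) (hbc : b < c)
    (hs : x.SameCycle a b) (hs' : x.SameCycle b c) :
    bt hab * simpleElt n (Equiv.swap a b * x) = bt hbc * simpleElt n (Equiv.swap b c * x) ∧
    bt hab * simpleElt n (Equiv.swap a b * x) =
      bt (hab.trans hbc) * simpleElt n (Equiv.swap a c * x) := by
  have hac := hab.trans hbc
  have e1 : Equiv.swap a b * Equiv.swap b c = Equiv.swap b c * Equiv.swap a c := by
    rw [Equiv.mul_swap_eq_swap_mul (Equiv.swap b c), Equiv.swap_apply_of_ne_of_ne hab.ne hac.ne,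
      Equiv.swap_apply_right]
  have e2 : Equiv.swap b c * Equiv.swap a c = Equiv.swap a c * Equiv.swap a b := by
    rw [Equiv.mul_swap_eq_swap_mul (Equiv.swap a c), Equiv.swap_apply_left,
      Equiv.swap_apply_of_ne_of_ne hab.ne' hbc.ne, Equiv.swap_comm b c]
  refine ⟨?_, ?_⟩
  · exact h.confluence ih hab hbc hbc hac hs hs' hs' (hs.trans hs') (by omega) (by omega) e1
      (bt_mul hab hbc)
  · exact h.confluence ih hab hbc hac hab hs (hs.trans hs') hs' hs (by omega) (by omega)
      (e1.trans e2) ((bt_mul hab hbc).trans (bt_mul' hab hbc))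

theorem IsNoncrossing.confluence_of_lt {a b c d : Fin (n + 1)} (hab : a < b) (hcd : c < d)
    (hac : a < c) (hs : x.SameCycle a b) (hs' : x.SameCycle c d) :
    bt hab * simpleElt n (Equiv.swap a b * x) = bt hcd * simpleElt n (Equiv.swap c d * x) := by
  rcases lt_trichotomy b c with hbc | rfl | hcb
  · exact h.confluence ih hab hcd hcd hab hs hs' hs' hs (by omega) (by omega)
      (Equiv.Perm.Disjoint.commute (by
        rw [Equiv.Perm.disjoint_iff_disjoint_support, Equiv.Perm.support_swap hab.ne,
          Equiv.Perm.support_swap hcd.ne]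
        simp
        omega)) (bt_comm_of_separate hab hbc hcd)
  · exact (h.confluence_triple ih hab hcd hs hs').1
  · rcases lt_trichotomy b d with hbd | rfl | hdb
    · have hs2 : x.SameCycle a c := by
        by_contra hc
        have := mem_of_sameCycle x (S := fun y => a < y ∧ y < b ∧ ¬ x.SameCycle a y) ?_ hs'
          ⟨hac, hcb, hc⟩
        · omega
        · rintro y ⟨h1, h2, h3⟩
          have h4 := h.apply_mem_Ioc hab hs h1.le h2
          have h5 : ¬ x.SameCycle a (x y) := fun hc => h3 (Equiv.Perm.sameCycle_apply_right.mp hc)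
          refine ⟨h4.1, lt_of_le_of_ne h4.2 ?_, h5⟩
          rintro rfl
          exact h5 hs
      -- The two crossing transpositions are compared through `(a, c)`, which forms a triple with
      -- each.
      rw [← (h.confluence_triple ih hac hcb hs2 (hs2.symm.trans hs)).2,
        (h.confluence_triple ih hac hcd hs2 hs').1]
    · have := h.confluence_triple ih hac hcb (hs.trans hs'.symm) hs'
      rw [← this.2, ← this.1]
    · exact h.confluence ih hab hcd hcd hab hs hs' hs' hs (by omega) (by omega)
        (Equiv.Perm.Disjoint.commute (by
          rw [Equiv.Perm.disjoint_iff_disjoint_support, Equiv.Perm.support_swap hab.ne,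
            Equiv.Perm.support_swap hcd.ne]
          simp
          omega)) (bt_comm_of_nested hac hcd hdb).symm

theorem IsNoncrossing.confluence_all {t t' : Transp n} (hs : x.SameCycle t.1.1 t.1.2)
    (hs' : x.SameCycle t'.1.1 t'.1.2) :
    braidTransp n t * simpleElt n (Equiv.swap t.1.1 t.1.2 * x) =
      braidTransp n t' * simpleElt n (Equiv.swap t'.1.1 t'.1.2 * x) := by
  obtain ⟨⟨a, b⟩, hab⟩ := t
  obtain ⟨⟨c, d⟩, hcd⟩ := t'
  dsimp only at *
  rcases lt_trichotomy a c with hac | rfl | hca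
  · exact h.confluence_of_lt ih hab hcd hac hs hs'
  · rcases lt_trichotomy b d with hbd | rfl | hdb
    · exact (h.confluence_triple ih hab hbd hs (hs.symm.trans hs')).2
    · rfl
    · exact (h.confluence_triple ih hcd hdb hs' (hs'.symm.trans hs)).2.symm
  · exact (h.confluence_of_lt ih hcd hab hca hs' hs).symm

end Confluence

theorem IsNoncrossing.liftsUniquely {x : Equiv.Perm (Fin (n + 1))} (h : IsNoncrossing x) :
    LiftsUniquely x := by
  induction hk : lenT n x using Nat.strong_induction_on generalizing x with | _ k ih
  have ih' : ∀ y : Equiv.Perm (Fin (n + 1)), IsNoncrossing y → lenT n y < lenT n x →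
      LiftsUniquely y := fun y hy hlt => ih _ (by omega) hy rfl
  intro u hu
  obtain ⟨v, hv, he⟩ := simpleElt_spec x
  rw [he]
  rcases u with - | ⟨t, u⟩ <;> rcases v with - | ⟨t', v⟩
  · rfl
  · have := hu.2.trans hv.2.symm
    simp at this
  · have := hu.2.trans hv.2.symm
    simp at this
  · obtain ⟨h1, h2⟩ := h.of_cons hu
    obtain ⟨h3, h4⟩ := h.of_cons hv
    have l1 := h.lenT_swap_mul t.2 h1
    have l2 := h.lenT_swap_mul t'.2 h3
    rw [braidTranspProd_cons, braidTranspProd_cons,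
      ih' _ (h.swap_mul t.2 h1) (by omega) u h2, ih' _ (h.swap_mul t'.2 h3) (by omega) v h4]
    exact h.confluence_all ih' h1 h3

/-- Splitting off a transposition on the right. -/
theorem simpleElt_mul_swap {y : Equiv.Perm (Fin (n + 1))} {a b : Fin (n + 1)}
    (hab : a < b) (h' : IsNoncrossing (y * Equiv.swap a b))
    (hl : lenT n (y * Equiv.swap a b) = lenT n y + 1) :
    simpleElt n (y * Equiv.swap a b) = simpleElt n y * bt hab := by
  obtain ⟨u, hu, he⟩ := simpleElt_spec y
  have h1 : IsReducedTranspWord n (y * Equiv.swap a b) (u ++ [mkTransp hab]) := by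
    refine ⟨?_, ?_⟩
    · rw [transpProd_append, hu.1]
      simp [transpProd, Transp.toPerm]
    · rw [List.length_append, hu.2, hl]
      rfl
  rw [← h'.liftsUniquely _ h1, he]
  simp [braidTranspProd]

end Independence

/-! ### Temperley-Lieb relations for the images of all transpositions -/

section Relations

variable {R A : Type*} [CommRing R] [Ring A] [Algebra R A] {v u : R}

theorem tl_mul_mul {a b : A} (h : a * b * a = a) (x : A) : a * (b * (a * x)) = a * x := by
  rw [← mul_assoc, ← mul_assoc, h]

/-- The product `e * e2` for three points. -/
theorem tl_three_mul {e1 e2 e : A} (hv : v * u = 1)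
    (h12 : e1 * e2 * e1 = e1) (h21 : e2 * e1 * e2 = e2) (s1 : e1 * e1 = (v + u) • e1)
    (s2 : e2 * e2 = (v + u) • e2)
    (he : e = e1 + e2 - u • (e2 * e1) - v • (e1 * e2)) :
    e * e2 = v • e2 - v ^ 2 • (e1 * e2) ∧ e1 * e = v • e1 - v ^ 2 • (e1 * e2) ∧
      e2 * e1 = v • (e1 + e2 - e - v • (e1 * e2)) ∧
      e * e1 = u • e - u • e2 + e1 * e2 := by
  rw [mul_assoc] at h12 h21
  have t1 : ∀ x, e1 * (e1 * x) = (v + u) • (e1 * x) := fun x => by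
    rw [← mul_assoc, s1, smul_mul_assoc]
  subst he
  refine ⟨?_, ?_, ?_, ?_⟩ <;>
  (try simp only [add_mul, sub_mul, mul_add, mul_sub, smul_mul_assoc, mul_smul_comm, mul_assoc,
    h12, h21, s1, s2, t1]) <;>
  match_scalars <;> grind

/-- The crossing relation for four points. -/
theorem tl_crossing {e1 e2 e3 e f g : A} (hv : v * u = 1)
    (h21 : e2 * e1 * e2 = e2) (h23 : e2 * e3 * e2 = e2) (h13 : e3 * e1 = e1 * e3)
    (s2 : e2 * e2 = (v + u) • e2)
    (he : e = e1 + e2 - u • (e2 * e1) - v • (e1 * e2))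
    (hf : f = e2 + e3 - u • (e3 * e2) - v • (e2 * e3))
    (hg : g = e + e3 - u • (e3 * e) - v • (e * e3)) :
    e * f = v • e2 - v ^ 2 • (e1 * e2) + e * e3 -
      u ^ 2 • (v • e2 - v ^ 2 • (e1 * e2) -
        v ^ 2 • (e1 * f - e1 * e2 - e1 * e3 + v • (e1 * e2 * e3)) - e2 * g) -
      v • (v • (e2 * e3) - v ^ 2 • (e1 * e2 * e3)) := by
  have t13 : ∀ x, e3 * (e1 * x) = e1 * (e3 * x) := fun x => by
    rw [← mul_assoc, h13, mul_assoc]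
  have w21 := tl_mul_mul h21
  have w23 := tl_mul_mul h23
  rw [mul_assoc] at h21 h23
  have t2 : ∀ x, e2 * (e2 * x) = (v + u) • (e2 * x) := fun x => by
    rw [← mul_assoc, s2, smul_mul_assoc]
  subst hg he hf
  simp only [add_mul, sub_mul, mul_add, mul_sub, smul_mul_assoc, mul_smul_comm, mul_assoc, h21,
    h23, h13, t13, w21, w23, s2, t2, smul_add, smul_sub]
  match_scalars <;> grind

end Relations

/-! ### The elements `v⁻¹ - ω(𝐭)` for all transpositions and their relations -/

section TLH

variable {n : ℕ}

open LaurentPolynomial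

/-- The invertible elements `v⁻¹ - b_i`, indexed by the natural numbers. -/
noncomputable def tlUnitNat (n i : ℕ) : (TL n)ˣ := omegaUnits n (braidGenNat n i)

theorem isBraided_tlUnitNat : IsBraided (tlUnitNat n) n where
  braid i hi := by
    simp only [tlUnitNat, ← map_mul, isBraided_braidGenNat.braid i hi]
  comm i j hij := (isBraided_braidGenNat.comm i j hij).map _

theorem omegaUnits_conjGen (p q : ℕ) :
    omegaUnits n (conjGen (braidGenNat n) p q) = conjGen (tlUnitNat n) p q := by
  induction q with
  | zero => simp [conjGen]
  | succ q ih =>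
    rw [conjGen, conjGen]
    split_ifs
    · rfl
    · simp [ih, tlUnitNat]

/-- The element `v⁻¹ - ω(𝐭)` for the transposition exchanging `p` and `q`. -/
noncomputable def tlH (n p q : ℕ) : TL n :=
  (T (-1) : ℤ[T;T⁻¹]) • (1 : TL n) - (conjGen (tlUnitNat n) p q : (TL n)ˣ)

theorem conjGen_eq_sub (p q : ℕ) : ((conjGen (tlUnitNat n) p q : (TL n)ˣ) : TL n) =
    (T (-1) : ℤ[T;T⁻¹]) • (1 : TL n) - tlH n p q := by
  rw [tlH, sub_sub_cancel]

theorem tlUnitNat_eq {i : ℕ} (hi : i < n) : tlUnitNat n i = tlUnit n ⟨i, hi⟩ := by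
  rw [tlUnitNat, braidGenNat, dif_pos hi, omegaUnits, braidGen, PresentedGroup.toGroup.of]

theorem tlH_self_succ {i : ℕ} (hi : i < n) : tlH n i (i + 1) = tlGen n ⟨i, hi⟩ := by
  rw [tlH, conjGen_self_succ, tlUnitNat_eq hi, tlUnit_val, sub_sub_cancel]

theorem T_mul_T_neg : (T 1 * T (-1) : ℤ[T;T⁻¹]) = 1 := by
  rw [← T_add]
  simp

/-- Conjugation by a unit. -/
theorem tlH_conj {c : (TL n)ˣ} {p q p' q' : ℕ}
    (h : conjGen (tlUnitNat n) p' q' = c⁻¹ * conjGen (tlUnitNat n) p q * c) :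
    tlH n p' q' = (c⁻¹ : (TL n)ˣ) * tlH n p q * c := by
  rw [tlH, tlH, h]
  simp [mul_sub, sub_mul]

theorem tlH_of_commute {c : (TL n)ˣ} {p q : ℕ} (h : Commute (conjGen (tlUnitNat n) p q) c) :
    tlH n p q = (c⁻¹ : (TL n)ˣ) * tlH n p q * c :=
  tlH_conj (by rw [mul_assoc, h.eq, inv_mul_cancel_left])

theorem conj_mul_conj {M : Type*} [Monoid M] (c : Mˣ) (x y : M) :
    (((c⁻¹ : Mˣ) : M) * x * c) * (((c⁻¹ : Mˣ) : M) * y * c) = ((c⁻¹ : Mˣ) : M) * (x * y) * c := by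
  simp [mul_assoc]

theorem tlH_sq {p q : ℕ} (hpq : p < q) (hq : q ≤ n) :
    tlH n p q * tlH n p q = (T 1 + T (-1) : ℤ[T;T⁻¹]) • tlH n p q := by
  induction q, hpq using Nat.le_induction with
  | base =>
    rw [tlH_self_succ hq]
    exact tlGen_sq n _
  | succ q hpq ih =>
    rw [tlH_conj (conjGen_succ hpq), conj_mul_conj, ih (by omega), mul_smul_comm,
      smul_mul_assoc]

theorem tlH_commute {p q r s : ℕ}
    (h : Commute (conjGen (tlUnitNat n) p q) (conjGen (tlUnitNat n) r s)) :
    tlH n p q * tlH n r s = tlH n r s * tlH n p q := by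
  have h' : ((conjGen (tlUnitNat n) p q : (TL n)ˣ) : TL n) * (conjGen (tlUnitNat n) r s : (TL n)ˣ) =
      (conjGen (tlUnitNat n) r s : (TL n)ˣ) * (conjGen (tlUnitNat n) p q : (TL n)ˣ) := by
    exact_mod_cast congrArg Units.val h.eq
  simp only [tlH, mul_sub, sub_mul, smul_mul_assoc, mul_smul_comm, one_mul, mul_one, h']
  module

/-- Conjugating by the lift of a shorter transposition that commutes with the last generator reduces
to two neighbouring generators, where these are the defining relations. -/
theorem tlH_braid_succ {p q : ℕ} (hpq : p < q) (hq : q < n) :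
    tlH n p q * tlH n q (q + 1) * tlH n p q = tlH n p q ∧
      tlH n q (q + 1) * tlH n p q * tlH n q (q + 1) = tlH n q (q + 1) := by
  have base : ∀ p, p + 1 < n →
      tlH n p (p + 1) * tlH n (p + 1) (p + 2) * tlH n p (p + 1) = tlH n p (p + 1) ∧
      tlH n (p + 1) (p + 2) * tlH n p (p + 1) * tlH n (p + 1) (p + 2) = tlH n (p + 1) (p + 2) := by
    intro p hp
    rw [tlH_self_succ (by omega : p < n), tlH_self_succ hp]
    exact ⟨tlGen_braid n _ _ (Or.inr rfl), tlGen_braid n _ _ (Or.inl rfl)⟩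
  rcases eq_or_lt_of_le (Nat.succ_le_of_lt hpq) with rfl | hlt
  · exact base p hq
  obtain ⟨q, rfl⟩ : ∃ k, q = k + 1 := ⟨q - 1, by omega⟩
  have hpq' : p < q := by omega
  have hb := (isBraided_tlUnitNat (n := n)).conjGen_braid hpq' (by omega)
  have hc := (isBraided_tlUnitNat (n := n)).commute_conjGen_gen (i := q + 1) hpq' (by omega)
  have e1 : tlH n p (q + 1) = _ := tlH_conj (c := (conjGen (tlUnitNat n) p q)⁻¹) (p := q)
    (q := q + 1) (by
      rw [conjGen_succ hpq', conjGen_self_succ, inv_inv, eq_mul_inv_iff_mul_eq, mul_assoc,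
        mul_assoc, inv_mul_eq_iff_eq_mul, ← mul_assoc, hb, mul_assoc])
  have e2 := tlH_of_commute (c := (conjGen (tlUnitNat n) p q)⁻¹) (p := q + 1)
    (q := q + 1 + 1) (by
      rw [conjGen_self_succ]
      exact hc.symm.inv_right)
  obtain ⟨b1, b2⟩ := base q (by omega)
  rw [e1, e2]
  simp only [conj_mul_conj]
  rw [b1, b2]
  exact ⟨rfl, rfl⟩

theorem tlH_braid {p q r : ℕ} (hpq : p < q) (hqr : q < r) (hr : r ≤ n) :
    tlH n p q * tlH n q r * tlH n p q = tlH n p q ∧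
      tlH n q r * tlH n p q * tlH n q r = tlH n q r := by
  induction r, hqr using Nat.le_induction with
  | base => exact tlH_braid_succ hpq hr
  | succ r hqr ih =>
    obtain ⟨b1, b2⟩ := ih (by omega)
    have e := tlH_of_commute ((isBraided_tlUnitNat (n := n)).commute_conjGen_gen (i := r) hpq hqr)
    rw [tlH_conj (conjGen_succ hqr), e]
    simp only [conj_mul_conj]
    rw [b1, b2]
    exact ⟨rfl, rfl⟩

theorem conjGen_inv_eq_sub {p q : ℕ} (hpq : p < q) (hq : q ≤ n) :
    (((conjGen (tlUnitNat n) p q)⁻¹ : (TL n)ˣ) : TL n) =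
      (T 1 : ℤ[T;T⁻¹]) • (1 : TL n) - tlH n p q := by
  apply Units.inv_eq_of_mul_eq_one_right
  have hv := T_mul_T_neg
  rw [conjGen_eq_sub]
  simp only [sub_mul, mul_sub, smul_mul_assoc, mul_smul_comm, one_mul, mul_one, tlH_sq hpq hq]
  match_scalars <;> grind

/-- This expands the conjugation `t_pr = t_qr⁻¹ t_pq t_qr`, the cubic term collapsing by
`tlH_braid`. -/
theorem tlH_three {p q r : ℕ} (hpq : p < q) (hqr : q < r) (hr : r ≤ n) :
    tlH n p r = tlH n p q + tlH n q r - (T (-1) : ℤ[T;T⁻¹]) • (tlH n q r * tlH n p q) -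
      (T 1 : ℤ[T;T⁻¹]) • (tlH n p q * tlH n q r) := by
  have h := (isBraided_tlUnitNat (n := n)).conjGen_mul hpq hqr
  rw [tlH_conj (c := conjGen (tlUnitNat n) q r) (p := p) (q := q)
    (by rw [mul_assoc, h, inv_mul_cancel_left]), conjGen_inv_eq_sub hqr hr, conjGen_eq_sub]
  have hv := T_mul_T_neg
  simp only [sub_mul, mul_sub, smul_mul_assoc, mul_smul_comm, one_mul, mul_one,
    (tlH_braid hpq hqr hr).2]
  match_scalars <;> grind

theorem tlH_three_mul {p q r : ℕ} (hpq : p < q) (hqr : q < r) (hr : r ≤ n) :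
    tlH n p r * tlH n q r =
        (T 1 : ℤ[T;T⁻¹]) • tlH n q r - (T 1 : ℤ[T;T⁻¹]) ^ 2 • (tlH n p q * tlH n q r) ∧
      tlH n p q * tlH n p r =
        (T 1 : ℤ[T;T⁻¹]) • tlH n p q - (T 1 : ℤ[T;T⁻¹]) ^ 2 • (tlH n p q * tlH n q r) ∧
      tlH n q r * tlH n p q = (T 1 : ℤ[T;T⁻¹]) • (tlH n p q + tlH n q r - tlH n p r -
        (T 1 : ℤ[T;T⁻¹]) • (tlH n p q * tlH n q r)) ∧
      tlH n p r * tlH n p q = (T (-1) : ℤ[T;T⁻¹]) • tlH n p r -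
        (T (-1) : ℤ[T;T⁻¹]) • tlH n q r + tlH n p q * tlH n q r :=
  tl_three_mul T_mul_T_neg (tlH_braid hpq hqr hr).1 (tlH_braid hpq hqr hr).2
    (tlH_sq hpq (by omega)) (tlH_sq hqr hr) (tlH_three hpq hqr hr)

/-- The product for a crossing pair is rewritten so that every term has its factor ending at `s`, if
any, in last place, preceded only by products on `p, q, r` whose action on the relevant `Z` is
known. -/
theorem tlH_crossing {p q r s : ℕ} (hpq : p < q) (hqr : q < r) (hrs : r < s) (hs : s ≤ n) :
    tlH n p r * tlH n q s =
      (T 1 : ℤ[T;T⁻¹]) • tlH n q r - (T 1 : ℤ[T;T⁻¹]) ^ 2 • (tlH n p q * tlH n q r) +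
        tlH n p r * tlH n r s -
      (T (-1) : ℤ[T;T⁻¹]) ^ 2 •
        ((T 1 : ℤ[T;T⁻¹]) • tlH n q r - (T 1 : ℤ[T;T⁻¹]) ^ 2 • (tlH n p q * tlH n q r) -
        (T 1 : ℤ[T;T⁻¹]) ^ 2 • (tlH n p q * tlH n q s - tlH n p q * tlH n q r -
          tlH n p q * tlH n r s + (T 1 : ℤ[T;T⁻¹]) • (tlH n p q * tlH n q r * tlH n r s)) -
          tlH n q r * tlH n p s) -
      (T 1 : ℤ[T;T⁻¹]) • ((T 1 : ℤ[T;T⁻¹]) • (tlH n q r * tlH n r s) -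
        (T 1 : ℤ[T;T⁻¹]) ^ 2 • (tlH n p q * tlH n q r * tlH n r s)) :=
  tl_crossing T_mul_T_neg (tlH_braid hpq hqr (by omega)).2 (tlH_braid hqr hrs hs).1
    (tlH_commute (isBraided_tlUnitNat.commute_of_separate hpq hqr hrs)).symm
    (tlH_sq hqr (by omega))
    (tlH_three hpq hqr (by omega)) (tlH_three hqr hrs hs) (tlH_three (by omega) hrs hs)

end TLH

/-! ### The elements `Z_x` span the Temperley-Lieb algebra -/

section Merge

variable {n : ℕ} {y : Equiv.Perm (Fin (n + 1))} {p q : Fin (n + 1)}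

theorem IsNoncrossing.apply_mem_Ioo_of_merge (h : IsNoncrossing y) (hp : y p ≤ p)
    (hq : y q ≤ q) (hc : ∀ k, (k < p ∧ p < y k) ↔ (k < q ∧ q < y k)) {k : Fin (n + 1)}
    (h1 : p < k) (h2 : k < y q) : p < y k ∧ y k < y q := by
  constructor
  · by_contra! hk
    have hkk : y k ≤ k := by omega
    have hpk : y p ≠ y k := fun he => by
      have := y.injective he
      omega
    have h3 := h.apply_mem_Icc (k := p) hkk hk h1.le
    -- If `y k ≤ p`, the points from `y k` up to `y p` (excluded) would be stable, so they would
    -- contain `k`, which lies beyond `p`.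
    have hS : ∀ j, y k ≤ j ∧ j < y p → y k ≤ y j ∧ y j < y p := by
      intro j hj
      have h4 := h.apply_mem_Icc (k := j) hkk hj.1 (by omega)
      refine ⟨h4.1, ?_⟩
      by_contra! h5
      have h6 : y p ≠ y j := fun he => by
        have := y.injective he
        omega
      by_cases h7 : p < y j
      · have := (hc j).mp ⟨by omega, h7⟩
        omega
      · have := h.mem_Icc_of_apply_mem (k := j) hp h5 (by omega)
        omega
    have := mem_of_apply_mem y hS (a := k) ⟨le_rfl, by omega⟩
    omega
  · by_contra! hk
    have hqk : y q ≠ y k := fun he => by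
      have := y.injective he
      omega
    by_cases h7 : q < y k
    · have := (hc k).mpr ⟨by omega, h7⟩
      omega
    · have := h.mem_Icc_of_apply_mem (k := k) hq hk (by omega)
      omega

theorem mul_swap_apply_of_ne {x : Equiv.Perm (Fin (n + 1))} {k : Fin (n + 1)} (h1 : k ≠ p)
    (h2 : k ≠ q) : (x * Equiv.swap p q) k = x k := by
  rw [Equiv.Perm.mul_apply, Equiv.swap_apply_of_ne_of_ne h1 h2]

theorem mul_swap_apply_left (x : Equiv.Perm (Fin (n + 1))) : (x * Equiv.swap p q) p = x q := by
  simp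

theorem mul_swap_apply_right (x : Equiv.Perm (Fin (n + 1))) : (x * Equiv.swap p q) q = x p := by
  simp

/-- Two cycles whose maximal elements `p < q` are covered by the same arcs can be merged. -/
theorem IsNoncrossing.merge (h : IsNoncrossing y) (hpq : p < q) (hp : y p ≤ p)
    (hq : y q ≤ q) (hpq' : p < y q) (hc : ∀ k, (k < p ∧ p < y k) ↔ (k < q ∧ q < y k)) :
    IsNoncrossing (y * Equiv.swap p q) ∧
      (excSet (y * Equiv.swap p q)).card = (excSet y).card + 1 := by
  have zp := mul_swap_apply_left (p := p) (q := q) y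
  have zq := mul_swap_apply_right (p := p) (q := q) y
  have zk := fun k => mul_swap_apply_of_ne (p := p) (q := q) (x := y) (k := k)
  set z := y * Equiv.swap p q
  constructor
  · intro m k hmk hk
    have hmq : m ≠ q := fun he => by
      subst he
      omega
    rcases eq_or_ne m p with rfl | hmp
    · rw [zp] at hk ⊢
      rw [zk k (by omega) (by omega)]
      exact h.apply_mem_Ioo_of_merge hp hq hc hmk hk
    · rw [zk m hmp hmq] at hk ⊢
      rcases eq_or_ne k p with rfl | hkp
      · have := (hc m).mp ⟨hmk, hk⟩
        omega
      rcases eq_or_ne k q with rfl | hkq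
      · have := (hc m).mpr ⟨hmk, hk⟩
        rw [zq]
        exact h m p this.1 this.2
      · rw [zk k hkp hkq]
        exact h m k hmk hk
  · have : excSet z = insert p (excSet y) := by
      ext k
      rw [Finset.mem_insert, mem_excSet, mem_excSet]
      rcases eq_or_ne k p with rfl | hkp
      · simp [zp, hpq']
      rcases eq_or_ne k q with rfl | hkq
      · rw [zq]
        omega
      · rw [zk k hkp hkq]
        simp [hkp]
    rw [this, Finset.card_insert_of_notMem]
    rw [mem_excSet]
    omega

end Merge

/-! ### Right multiplication of `Z_x` by the element of a transposition with a new point -/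

section Span

variable {n : ℕ}

open LaurentPolynomial

theorem Z_eq (x : Equiv.Perm (Fin (n + 1))) : Z n x = (omegaUnits n (simpleElt n x) : (TL n)ˣ) := by
  simp [Z, omega]

/-- When multiplication by the transposition raises the length, the lift is multiplicative, and
`ω(𝐭)` is `v⁻¹` minus this element. -/
theorem Z_mul_tlH {y : Equiv.Perm (Fin (n + 1))} {p q : Fin (n + 1)} (hpq : p < q)
    (hy : IsNoncrossing y) (h : IsNoncrossing (y * Equiv.swap p q))
    (hl : (excSet (y * Equiv.swap p q)).card = (excSet y).card + 1) :
    Z n y * tlH n p q = (T (-1) : ℤ[T;T⁻¹]) • Z n y - Z n (y * Equiv.swap p q) := by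
  rw [← h.lenT_eq, ← hy.lenT_eq] at hl
  rw [Z_eq (y * _), simpleElt_mul_swap hpq h hl, map_mul, Units.val_mul, bt, braidTransp_eq,
    omegaUnits_conjGen, conjGen_eq_sub, ← Z_eq, mul_sub, mul_smul_comm, mul_one, sub_sub_cancel]

/-- Splitting a cycle. -/
theorem Z_mul_tlH_of_sameCycle {x : Equiv.Perm (Fin (n + 1))} {a b : Fin (n + 1)} (hab : a < b)
    (hx : IsNoncrossing x) (hs : x.SameCycle a b) :
    Z n (x * Equiv.swap a b) * tlH n a b =
      (T (-1) : ℤ[T;T⁻¹]) • Z n (x * Equiv.swap a b) - Z n x := by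
  have h := hx.mul_swap hab.ne hs
  have e : x * Equiv.swap a b * Equiv.swap a b = x := by
    rw [mul_assoc, Equiv.swap_mul_self, mul_one]
  have := Z_mul_tlH hab h.1 (by rwa [e]) (by rw [e]; omega)
  rwa [e] at this

/-- All points beyond `m` are fixed by `x`. -/
def SuppLE (m : ℕ) (x : Equiv.Perm (Fin (n + 1))) : Prop := ∀ k : Fin (n + 1), m < k.val → x k = k

theorem SuppLE.mul_swap {m : ℕ} {x : Equiv.Perm (Fin (n + 1))} (h : SuppLE m x)
    {p q : Fin (n + 1)} (hp : p.val ≤ m) (hq : q.val ≤ m) : SuppLE m (x * Equiv.swap p q) :=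
  fun k hk => by
    rw [mul_swap_apply_of_ne (by omega) (by omega), h k hk]

/-- The span of the `Z_x` with `x` supported on the points up to `m`. -/
noncomputable def zSpan (n m : ℕ) : Submodule ℤ[T;T⁻¹] (TL n) :=
  Submodule.span _ (Z n '' {x | IsNoncrossing x ∧ SuppLE m x})

theorem Z_mem_zSpan {m : ℕ} {x : Equiv.Perm (Fin (n + 1))} (h : IsNoncrossing x)
    (h' : SuppLE m x) : Z n x ∈ zSpan n m :=
  Submodule.subset_span ⟨x, ⟨h, h'⟩, rfl⟩

theorem zSpan_mono {m m' : ℕ} (h : m ≤ m') : zSpan n m ≤ zSpan n m' := by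
  apply Submodule.span_mono
  rintro _ ⟨x, ⟨h1, h2⟩, rfl⟩
  exact ⟨x, ⟨h1, fun k hk => h2 k (by omega)⟩, rfl⟩

theorem mul_mem_of_forall_Z_mul_mem {m : ℕ} {S : Submodule ℤ[T;T⁻¹] (TL n)} {a : TL n}
    (h : ∀ x : Equiv.Perm (Fin (n + 1)), IsNoncrossing x → SuppLE m x → Z n x * a ∈ S) {z : TL n}
    (hz : z ∈ zSpan n m) : z * a ∈ S := by
  induction hz using Submodule.span_induction with
  | mem z hz =>
    obtain ⟨x, ⟨h1, h2⟩, rfl⟩ := hz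
    exact h x h1 h2
  | zero => simp
  | add y z _ _ h1 h2 =>
    rw [add_mul]
    exact add_mem h1 h2
  | smul c y _ h1 =>
    rw [smul_mul_assoc]
    exact Submodule.smul_mem _ _ h1

/-- The arcs covering a point. -/
def covers (x : Equiv.Perm (Fin (n + 1))) (d : Fin (n + 1)) : Finset (Fin (n + 1)) :=
  Finset.univ.filter fun k => k < d ∧ d < x k

theorem mem_covers {x : Equiv.Perm (Fin (n + 1))} {d k : Fin (n + 1)} :
    k ∈ covers x d ↔ k < d ∧ d < x k := by
  simp [covers]

/-- The measure for the induction in the proof of `Z_mul_tlH_mem`. -/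
def depth (x : Equiv.Perm (Fin (n + 1))) (d : Fin (n + 1)) : ℕ :=
  2 * (covers x d).card + if d < x d then 1 else 0

theorem depth_le {x : Equiv.Perm (Fin (n + 1))} {d : Fin (n + 1)} {S : Finset (Fin (n + 1))}
    (hd : x d ≤ d) (hS : ∀ k, k < d → d < x k → k ∈ S) : depth x d ≤ 2 * S.card := by
  rw [depth, if_neg (by omega)]
  have := Finset.card_le_card (s := covers x d) (t := S) fun k hk =>
    hS k (mem_covers.mp hk).1 (mem_covers.mp hk).2
  omega

theorem exists_max_sameCycle (x : Equiv.Perm (Fin (n + 1))) (a : Fin (n + 1)) :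
    ∃ b, x.SameCycle a b ∧ x b ≤ b ∧ x a ≤ b ∧ a ≤ b := by
  classical
  obtain ⟨b, hb, hmax⟩ := Finset.exists_max_image (Finset.univ.filter fun b => x.SameCycle a b) id
    ⟨a, by simp [Equiv.Perm.SameCycle.refl]⟩
  simp only [Finset.mem_filter, Finset.mem_univ, true_and, id] at hb hmax
  exact ⟨b, hb, hmax _ (Equiv.Perm.sameCycle_apply_right.mpr hb),
    hmax _ (Equiv.Perm.sameCycle_apply_right.mpr (.refl _ _)), hmax _ (.refl _ _)⟩

theorem SuppLE.le_of_sameCycle {m : ℕ} {x : Equiv.Perm (Fin (n + 1))} (h : SuppLE m x)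
    {a b : Fin (n + 1)} (ha : a.val ≤ m) (hs : x.SameCycle a b) : b.val ≤ m := by
  by_contra! hb
  have := (hs.symm.eq_of_left (h b hb))
  omega

theorem SuppLE.apply_le {m : ℕ} {x : Equiv.Perm (Fin (n + 1))} (h : SuppLE m x)
    {a : Fin (n + 1)} (ha : a.val ≤ m) : (x a).val ≤ m :=
  h.le_of_sameCycle ha (Equiv.Perm.sameCycle_apply_right.mpr (.refl _ _))

/-- Splitting off the maximal element of a nontrivial cycle. -/
theorem Z_mul_tlH_mem_of_lt {m : ℕ} {x : Equiv.Perm (Fin (n + 1))} {d : Fin (n + 1)}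
    (hm : m < n) (hx : IsNoncrossing x) (hsup : SuppLE m x) (hd : d.val ≤ m) (hdx : d < x d)
    (ih : ∀ (z : Equiv.Perm (Fin (n + 1))) (k : Fin (n + 1)), IsNoncrossing z → SuppLE m z →
      k.val ≤ m → depth z k < depth x d → Z n z * tlH n k (m + 1) ∈ zSpan n (m + 1)) :
    Z n x * tlH n d (m + 1) ∈ zSpan n (m + 1) := by
  obtain ⟨b, hs, hb, hxb, -⟩ := exists_max_sameCycle x d
  have hdb : d < b := lt_of_lt_of_le hdx hxb
  have hbm := hsup.le_of_sameCycle hd hs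
  have hdep : depth x d = 2 * (covers x d).card + 1 := by rw [depth, if_pos hdx]
  have hxbd := (hx.mem_Icc_of_sameCycle hb hs.symm).1
  have hsplit := Z_mul_tlH_of_sameCycle hdb hx hs
  have hy := (hx.mul_swap hdb.ne hs).1
  have hys := hsup.mul_swap hd hbm
  have yd := mul_swap_apply_left (p := d) (q := b) x
  have yb := mul_swap_apply_right (p := d) (q := b) x
  have yk := fun k => mul_swap_apply_of_ne (p := d) (q := b) (x := x) (k := k)
  set y := x * Equiv.swap d b
  have hcov : ∀ k, k < b → b < x k → k ∈ covers x d := fun k h1 h2 =>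
    mem_covers.mpr (hx.mem_Ioo_of_sameCycle hs.symm h1 h2)
  -- In `y` the point `d` has become the maximum of its cycle, so the depth drops by its parity bit.
  -- The same bound holds for `b`, because an arc over `b` also covers `d`.
  have m1 : Z n y * tlH n d (m + 1) ∈ zSpan n (m + 1) := by
    refine ih y d hy hys hd (lt_of_le_of_lt (depth_le (S := covers x d) (by omega) ?_) (by omega))
    intro k h1 h2
    rw [yk k (by omega) (by omega)] at h2
    exact mem_covers.mpr ⟨h1, h2⟩
  have m2 : Z n y * tlH n b (m + 1) ∈ zSpan n (m + 1) := by
    refine ih y b hy hys hbm (lt_of_le_of_lt (depth_le (S := covers x d) (by omega) ?_) (by omega))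
    intro k h1 h2
    rcases eq_or_ne k d with rfl | hkd
    · omega
    rw [yk k hkd (by omega)] at h2
    exact hcov k h1 h2
  have m3 : Z n x * tlH n b (m + 1) ∈ zSpan n (m + 1) :=
    ih x b hx hsup hbm (lt_of_le_of_lt (depth_le (S := covers x d) hb hcov) (by omega))
  have m4 := zSpan_mono (Nat.le_succ m) (Z_mem_zSpan hy hys)
  have m5 := zSpan_mono (Nat.le_succ m) (Z_mem_zSpan hx hsup)
  -- This relation trades the factor from `d` to the new point for one from the maximum `b`.
  have e1 := (tlH_three_mul (n := n) hdb (Nat.lt_succ_of_le hbm) (by omega)).2.1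
  have e2 : Z n x = (T (-1) : ℤ[T;T⁻¹]) • Z n y - Z n y * tlH n d b := by rw [hsplit]; abel
  have e3 : Z n x * tlH n d (m + 1) = (T (-1) : ℤ[T;T⁻¹]) • (Z n y * tlH n d (m + 1)) -
      ((T 1 : ℤ[T;T⁻¹]) • ((T (-1) : ℤ[T;T⁻¹]) • Z n y - Z n x) - (T 1 : ℤ[T;T⁻¹]) ^ 2 •
        ((T (-1) : ℤ[T;T⁻¹]) • (Z n y * tlH n b (m + 1)) - Z n x * tlH n b (m + 1))) := by
    rw [← hsplit]
    nth_rewrite 1 [e2]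
    rw [sub_mul, smul_mul_assoc, mul_assoc, e1, mul_sub, mul_smul_comm, mul_smul_comm, ← mul_assoc,
      hsplit, sub_mul, smul_mul_assoc]
  rw [e3]
  repeat' first | assumption | apply Submodule.sub_mem | apply Submodule.smul_mem

/-- Adding a new point to a cycle whose maximum is not covered by an arc. -/
theorem Z_mul_tlH_mem_of_covers_eq_empty {m : ℕ} {x : Equiv.Perm (Fin (n + 1))} {d : Fin (n + 1)}
    (hm : m < n) (hx : IsNoncrossing x) (hsup : SuppLE m x) (hd : d.val ≤ m) (hdx : x d ≤ d)
    (hc : covers x d = ∅) : Z n x * tlH n d (m + 1) ∈ zSpan n (m + 1) := by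
  obtain ⟨q, hq⟩ : ∃ q : Fin (n + 1), q.val = m + 1 := ⟨⟨m + 1, by omega⟩, rfl⟩
  have hdq : d < q := by omega
  have hxq := hsup q (by omega)
  have hmerge := hx.merge hdq hdx hxq.le (by omega) fun k => by
    constructor
    · intro h
      rw [← mem_covers, hc] at h
      simp at h
    · rintro ⟨h1, h2⟩
      have := hsup.apply_le (a := k) (by omega)
      omega
  have h1 := Z_mul_tlH hdq hx hmerge.1 hmerge.2
  rw [hq] at h1
  rw [h1]
  have hs : SuppLE (m + 1) x := fun k hk => hsup k (by omega)
  exact Submodule.sub_mem _ (Submodule.smul_mem _ _ (Z_mem_zSpan hx hs))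
    (Z_mem_zSpan hmerge.1 (hs.mul_swap (by omega) (by omega)))

end Span

/-! ### Covered points, stability of the span, and spanning -/

section SpanTop

variable {n : ℕ}

open LaurentPolynomial

/-- The expansion of `Z_x f` for a point `d` lying in an arc of a cycle of `x`. -/
theorem mul_tlH_eq_of_crossing {p q r s : ℕ} (hpq : p < q) (hqr : q < r) (hrs : r < s)
    (hs : s ≤ n) {z0 z1 z2 z3 zx : TL n}
    (h1 : z0 * tlH n p q = (T (-1) : ℤ[T;T⁻¹]) • z0 - z1)
    (h2 : z0 * tlH n q r = (T (-1) : ℤ[T;T⁻¹]) • z0 - z2)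
    (h3 : z1 * tlH n q r = (T (-1) : ℤ[T;T⁻¹]) • z1 - z3)
    (he : z0 * tlH n p r = (T (-1) : ℤ[T;T⁻¹]) • z0 - zx) {S : Submodule ℤ[T;T⁻¹] (TL n)}
    (m0 : z0 ∈ S) (m1 : z1 ∈ S) (m2 : z2 ∈ S) (m3 : z3 ∈ S)
    (mf0 : z0 * tlH n q s ∈ S) (mf1 : z1 * tlH n q s ∈ S)
    (mr0 : z0 * tlH n r s ∈ S) (mr1 : z1 * tlH n r s ∈ S) (mr2 : z2 * tlH n r s ∈ S)
    (mr3 : z3 * tlH n r s ∈ S) (mrx : zx * tlH n r s ∈ S)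
    (mg0 : z0 * tlH n p s ∈ S) (mg2 : z2 * tlH n p s ∈ S) : zx * tlH n q s ∈ S := by
  have e : zx = (T (-1) : ℤ[T;T⁻¹]) • z0 - z0 * tlH n p r := by rw [he]; abel
  rw [e, sub_mul, smul_mul_assoc, mul_assoc, tlH_crossing hpq hqr hrs hs]
  simp only [mul_add, mul_sub, mul_smul_comm, ← mul_assoc, h1, h2, h3, he, sub_mul, smul_mul_assoc]
  repeat' first
    | assumption
    | apply Submodule.sub_mem
    | apply Submodule.add_mem
    | apply Submodule.smul_mem

/-- The case of a point covered by an arc. -/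
theorem Z_mul_tlH_mem_of_covered {m : ℕ} {x : Equiv.Perm (Fin (n + 1))} {d : Fin (n + 1)}
    (hm : m < n) (hx : IsNoncrossing x) (hsup : SuppLE m x) (hd : d.val ≤ m) (hdx : x d ≤ d)
    (hne : (covers x d).Nonempty)
    (ih : ∀ (z : Equiv.Perm (Fin (n + 1))) (k : Fin (n + 1)), IsNoncrossing z → SuppLE m z →
      k.val ≤ m → depth z k < depth x d → Z n z * tlH n k (m + 1) ∈ zSpan n (m + 1)) :
    Z n x * tlH n d (m + 1) ∈ zSpan n (m + 1) := by
  -- The arc starting at `a` is the innermost one over `d`.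
  obtain ⟨a, ha, hmax⟩ := Finset.exists_max_image (covers x d) id hne
  have hcard := Finset.card_erase_add_one ha
  simp only [mem_covers, id] at ha hmax
  obtain ⟨had, hda⟩ := ha
  obtain ⟨b, hs, hb, hxb, -⟩ := exists_max_sameCycle x a
  have hab : a < b := by omega
  have hdb : d < b := by omega
  have ham : a.val ≤ m := by omega
  have hbm := hsup.le_of_sameCycle ham hs
  have hxba := (hx.mem_Icc_of_sameCycle hb hs.symm).1
  have hxd := hx a d had hda
  have hdep : depth x d = 2 * (covers x d).card := by rw [depth, if_neg (by omega), add_zero]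
  set S := (covers x d).erase a with hS
  have memS : ∀ k, k ≠ a → k < d → d < x k → k ∈ S := fun k h0 h1 h2 =>
    Finset.mem_erase.mpr ⟨h0, mem_covers.mpr ⟨h1, h2⟩⟩
  have lta : ∀ k, k ≠ a → k < d → d < x k → k < a := fun k h0 h1 h2 => by
    have := hmax k ⟨h1, h2⟩
    omega
  have cova : ∀ k, k < a → a < x k → d < x k := fun k h1 h2 => by
    have := hx.mem_Ioo_of_sameCycle (b := x a) (Equiv.Perm.sameCycle_apply_right.mpr (.refl _ _)) h1 h2
    omega
  have covb : ∀ k, k < b → b < x k → k < a ∧ d < x k := fun k h1 h2 => by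
    have := hx.mem_Ioo_of_sameCycle hs.symm h1 h2
    exact ⟨this.1, cova k this.1 this.2⟩
  have covd : ∀ k, k ≠ a → k < d → d < x k → b < x k := fun k h0 h1 h2 => by
    have := hx.mem_Ioo_of_sameCycle hs (lta k h0 h1 h2) (by omega)
    omega
  have he := Z_mul_tlH_of_sameCycle hab hx hs
  have hy := (hx.mul_swap hab.ne hs).1
  have sy := hsup.mul_swap ham hbm
  have ya := mul_swap_apply_left (p := a) (q := b) x
  have yb := mul_swap_apply_right (p := a) (q := b) x
  have yk := fun k => mul_swap_apply_of_ne (p := a) (q := b) (x := x) (k := k)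
  -- The cycle through the arc is cut into two, with maxima `a < b` on either side of `d`. In `y`
  -- the points `a`, `d`, `b` are maxima of three cycles, which can be merged: `y1` joins `a` and
  -- `d`, `y2` joins `d` and `b`, and `y3` joins all three.
  set y := x * Equiv.swap a b with hydef
  have yd := yk d (by omega) (by omega)
  have hy1 := hy.merge had (by omega) (by omega) (by omega) fun k => by
    rcases eq_or_ne k a with rfl | hka
    · omega
    rcases eq_or_ne k b with rfl | hkb
    · omega
    rw [yk k hka hkb]
    constructor
    · rintro ⟨h1, h2⟩
      exact ⟨by omega, cova k h1 h2⟩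
    · rintro ⟨h1, h2⟩
      exact ⟨lta k hka h1 h2, by omega⟩
  have hy2 := hy.merge hdb (by omega) (by omega) (by omega) fun k => by
    rcases eq_or_ne k a with rfl | hka
    · omega
    rcases eq_or_ne k b with rfl | hkb
    · omega
    rw [yk k hka hkb]
    constructor
    · rintro ⟨h1, h2⟩
      exact ⟨by omega, covd k hka h1 h2⟩
    · rintro ⟨h1, h2⟩
      have := covb k h1 h2
      omega
  have h1 := Z_mul_tlH had hy hy1.1 hy1.2
  have h2 := Z_mul_tlH hdb hy hy2.1 hy2.2
  have s1 := sy.mul_swap ham hd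
  have s2 := sy.mul_swap hd hbm
  have y1a := mul_swap_apply_left (p := a) (q := d) y
  have y1d := mul_swap_apply_right (p := a) (q := d) y
  have y1k := fun k => mul_swap_apply_of_ne (p := a) (q := d) (x := y) (k := k)
  have y2d := mul_swap_apply_left (p := d) (q := b) y
  have y2b := mul_swap_apply_right (p := d) (q := b) y
  have y2k := fun k => mul_swap_apply_of_ne (p := d) (q := b) (x := y) (k := k)
  set y1 := y * Equiv.swap a d
  set y2 := y * Equiv.swap d b
  have y1b := y1k b (by omega) (by omega)
  have y2a := y2k a (by omega) (by omega)
  have hy3 := hy1.1.merge hdb (by omega) (by omega) (by omega) fun k => by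
    rcases eq_or_ne k a with rfl | hka
    · omega
    rcases eq_or_ne k b with rfl | hkb
    · omega
    rcases eq_or_ne k d with rfl | hkd
    · omega
    rw [y1k k hka hkd, yk k hka hkb]
    constructor
    · rintro ⟨h1, h2⟩
      exact ⟨by omega, covd k hka h1 h2⟩
    · rintro ⟨h1, h2⟩
      have := covb k h1 h2
      omega
  have h3 := Z_mul_tlH hdb hy1.1 hy3.1 hy3.2
  have s3 := s1.mul_swap hd hbm
  have y3d := mul_swap_apply_left (p := d) (q := b) y1
  have y3b := mul_swap_apply_right (p := d) (q := b) y1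
  have y3k := fun k => mul_swap_apply_of_ne (p := d) (q := b) (x := y1) (k := k)
  set y3 := y1 * Equiv.swap d b
  have y3a := y3k a (by omega) (by omega)
  -- At a cycle maximum among `a`, `d`, `b`, only arcs from `S` can remain, so the depth is at most
  -- `2 * S.card`; removing `a` from the covers of `d` gained two.
  have ih' : ∀ (z : Equiv.Perm (Fin (n + 1))) (p : Fin (n + 1)), IsNoncrossing z → SuppLE m z →
      p.val ≤ m → z p ≤ p → (p = a ∨ p = d ∨ p = b) → z a ≤ d → z d ≤ b → z b ≤ b →
      (∀ k, k ≠ a → k ≠ b → k ≠ d → z k = x k) → Z n z * tlH n p (m + 1) ∈ zSpan n (m + 1) := by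
    intro z p hz sz hp hzp hpe za zd zb hzk
    refine ih z p hz sz hp (lt_of_le_of_lt (depth_le (S := S) hzp ?_) (by omega))
    intro k hk1 hk2
    rcases eq_or_ne k a with rfl | hka
    · rcases hpe with rfl | rfl | rfl <;> omega
    rcases eq_or_ne k b with rfl | hkb
    · omega
    rcases eq_or_ne k d with rfl | hkd
    · rcases hpe with rfl | rfl | rfl <;> omega
    rw [hzk k hka hkb hkd] at hk2
    rcases hpe with rfl | rfl | rfl
    · exact memS k hka (by omega) (cova k hk1 hk2)
    · exact memS k hka hk1 hk2
    · have := covb k hk1 hk2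
      exact memS k hka (by omega) this.2
  have up := fun (z : Equiv.Perm (Fin (n + 1))) (h : IsNoncrossing z) (h' : SuppLE m z) =>
    zSpan_mono (Nat.le_succ m) (Z_mem_zSpan h h')
  have zk0 : ∀ k, k ≠ a → k ≠ b → k ≠ d → y k = x k := fun k h1 h2 _ => yk k h1 h2
  have zk1 : ∀ k, k ≠ a → k ≠ b → k ≠ d → y1 k = x k := fun k h1 h2 h3 => by
    rw [y1k k h1 h3, yk k h1 h2]
  have zk2 : ∀ k, k ≠ a → k ≠ b → k ≠ d → y2 k = x k := fun k h1 h2 h3 => by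
    rw [y2k k h3 h2, yk k h1 h2]
  have zk3 : ∀ k, k ≠ a → k ≠ b → k ≠ d → y3 k = x k := fun k h1 h2 h3 => by
    rw [y3k k h3 h2, zk1 k h1 h2 h3]
  refine mul_tlH_eq_of_crossing had hdb (Nat.lt_succ_of_le hbm) (by omega) h1 h2 h3 he
    (up _ hy sy) (up _ hy1.1 s1) (up _ hy2.1 s2) (up _ hy3.1 s3) ?_ ?_ ?_ ?_ ?_ ?_ ?_ ?_ ?_
  · exact ih' y d hy sy hd (by omega) (by simp) (by omega) (by omega) (by omega) zk0
  · exact ih' y1 d hy1.1 s1 hd (by omega) (by simp) (by omega) (by omega) (by omega) zk1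
  · exact ih' y b hy sy hbm (by omega) (by simp) (by omega) (by omega) (by omega) zk0
  · exact ih' y1 b hy1.1 s1 hbm (by omega) (by simp) (by omega) (by omega) (by omega) zk1
  · exact ih' y2 b hy2.1 s2 hbm (by omega) (by simp) (by omega) (by omega) (by omega) zk2
  · exact ih' y3 b hy3.1 s3 hbm (by omega) (by simp) (by omega) (by omega) (by omega) zk3
  · refine ih x b hx hsup hbm (lt_of_le_of_lt (depth_le (S := S) hb ?_) (by omega))
    intro k h1 h2
    have := covb k h1 h2
    exact memS k (by omega) (by omega) this.2
  · exact ih' y a hy sy ham (by omega) (by simp) (by omega) (by omega) (by omega) zk0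
  · exact ih' y2 a hy2.1 s2 ham (by omega) (by simp) (by omega) (by omega) (by omega) zk2

theorem Z_mul_tlH_mem {m : ℕ} (hm : m < n) {x : Equiv.Perm (Fin (n + 1))} {d : Fin (n + 1)}
    (hx : IsNoncrossing x) (hsup : SuppLE m x) (hd : d.val ≤ m) :
    Z n x * tlH n d (m + 1) ∈ zSpan n (m + 1) := by
  induction hN : depth x d using Nat.strong_induction_on generalizing x d with
  | _ N ihN =>
    subst hN
    have ih : ∀ (z : Equiv.Perm (Fin (n + 1))) (k : Fin (n + 1)), IsNoncrossing z → SuppLE m z →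
        k.val ≤ m → depth z k < depth x d → Z n z * tlH n k (m + 1) ∈ zSpan n (m + 1) :=
      fun z k h1 h2 h3 h4 => ihN _ h4 h1 h2 h3 rfl
    rcases lt_or_ge d (x d) with hdx | hdx
    · exact Z_mul_tlH_mem_of_lt hm hx hsup hd hdx ih
    rcases Finset.eq_empty_or_nonempty (covers x d) with hc | hc
    · exact Z_mul_tlH_mem_of_covers_eq_empty hm hx hsup hd hdx hc
    · exact Z_mul_tlH_mem_of_covered hm hx hsup hd hdx hc ih

theorem mul_tlH_mem {m : ℕ} (hm : m < n) {z : TL n} (hz : z ∈ zSpan n m) {d : ℕ} (hd : d ≤ m) :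
    z * tlH n d (m + 1) ∈ zSpan n (m + 1) :=
  mul_mem_of_forall_Z_mul_mem (fun _ h1 h2 =>
    Z_mul_tlH_mem (d := ⟨d, by omega⟩) hm h1 h2 hd) hz

theorem mul_tlH_mem_of_gen {m : ℕ} {S : Submodule ℤ[T;T⁻¹] (TL n)} (hm : m ≤ n)
    (h : ∀ z ∈ S, ∀ k < m, z * tlH n k (k + 1) ∈ S) {p q : ℕ} (hpq : p < q) (hq : q ≤ m) :
    ∀ z ∈ S, z * tlH n p q ∈ S := by
  induction q, hpq using Nat.le_induction with
  | base => exact fun z hz => h z hz p hq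
  | succ q hpq ih =>
    intro z hz
    have h1 := ih (by omega)
    have h2 := fun z hz => h z hz q (by omega)
    rw [tlH_three hpq (Nat.lt_succ_self q) (by omega)]
    simp only [mul_add, mul_sub, mul_smul_comm, ← mul_assoc]
    exact sub_mem (sub_mem (add_mem (h1 z hz) (h2 z hz))
      (Submodule.smul_mem _ _ (h1 _ (h2 z hz)))) (Submodule.smul_mem _ _ (h2 _ (h1 z hz)))

/-- Induction on the number of points. If `x` moves the new point, `Z_x` is expressed by some `Z_y`
on fewer points and one factor `e_{d,m+1}`. A generator is moved past that factor by commutation or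
absorbed by a three-point relation, leaving terms controlled by `mul_tlH_mem`. -/
theorem mul_tlH_gen_mem {m : ℕ} (hm : m ≤ n) :
    ∀ z ∈ zSpan n m, ∀ k < m, z * tlH n k (k + 1) ∈ zSpan n m := by
  induction m with
  | zero => simp
  | succ m ih =>
    have ih := ih (by omega)
    have ih' := fun {p q : ℕ} => mul_tlH_mem_of_gen (p := p) (q := q) (by omega) ih
    intro z hz k hk
    have up := zSpan_mono (n := n) (Nat.le_succ m)
    have key : ∀ z ∈ zSpan n m, z * tlH n k (k + 1) ∈ zSpan n (m + 1) := by
      intro z hz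
      rcases Nat.lt_or_eq_of_le (Nat.le_of_lt_succ hk) with hk | rfl
      · exact up (ih z hz k hk)
      · exact mul_tlH_mem hm hz le_rfl
    refine mul_mem_of_forall_Z_mul_mem (fun x hx hsup => ?_) hz
    obtain ⟨q, hq⟩ : ∃ q : Fin (n + 1), q.val = m + 1 := ⟨⟨m + 1, by omega⟩, rfl⟩
    by_cases hxq : x q = q
    · refine key _ (Z_mem_zSpan hx fun k hk => ?_)
      by_cases hkq : k = q
      · rw [hkq, hxq]
      · exact hsup k (by omega)
    obtain ⟨d, rfl⟩ := x.surjective q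
    have hs : x.SameCycle d (x d) := Equiv.Perm.sameCycle_apply_right.mpr (.refl _ _)
    have hdq : d < x d := by
      have h1 := hsup.le_of_sameCycle hq.le hs.symm
      have h2 : d ≠ x d := fun h => hxq (congrArg x h.symm)
      omega
    have hdm : d.val ≤ m := by omega
    have hz0 := Z_mul_tlH_of_sameCycle hdq hx hs
    have hy := (hx.mul_swap hdq.ne hs).1
    have hys : SuppLE m (x * Equiv.swap d (x d)) := fun k hk => by
      rcases eq_or_ne k (x d) with rfl | hk1
      · rw [mul_swap_apply_right]
      · rw [mul_swap_apply_of_ne (by omega) hk1, hsup k (by omega)]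
    have m0 := Z_mem_zSpan hy hys
    set y := x * Equiv.swap d (x d)
    rw [hq] at hz0
    have e : Z n x = (T (-1) : ℤ[T;T⁻¹]) • Z n y - Z n y * tlH n d (m + 1) := by rw [hz0]; abel
    rw [e, sub_mul, smul_mul_assoc]
    refine sub_mem (Submodule.smul_mem _ _ (key _ m0)) ?_
    rw [mul_assoc]
    have hmul := fun (z : TL n) (hz : z ∈ zSpan n m) (d : ℕ) (hd : d ≤ m) => mul_tlH_mem hm hz hd
    rcases Nat.lt_or_eq_of_le (Nat.le_of_lt_succ hk) with hk | rfl
    -- The generator at `k` may be separate from, adjacent to, or nested in the transposition `(d, m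
    -- + 1)`; the extreme case of the last generator is treated below.
    · rcases lt_trichotomy (k + 1) d.val with h | h | h
      · rw [← tlH_commute (isBraided_tlUnitNat.commute_of_separate (Nat.lt_succ_self k) h
          (by omega)), ← mul_assoc]
        exact hmul _ (ih _ m0 k hk) _ hdm
      · have h4 := (tlH_three_mul (n := n) (Nat.lt_succ_self k) (show k + 1 < m + 1 by omega) hm).2.2.1
        rw [← h, h4]
        simp only [mul_smul_comm, mul_sub, mul_add, ← mul_assoc]
        have m1 := ih _ m0 k hk
        exact Submodule.smul_mem _ _ (sub_mem (sub_mem (add_mem (up m1)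
          (hmul _ m0 _ (by omega))) (hmul _ m0 _ (by omega)))
          (Submodule.smul_mem _ _ (hmul _ m1 _ (by omega))))
      · rcases Nat.lt_or_eq_of_le (Nat.le_of_lt_succ h) with h | h
        · rw [← tlH_commute (isBraided_tlUnitNat.commute_of_nested h (Nat.lt_succ_self k)
            (by omega) hm), ← mul_assoc]
          exact hmul _ (ih _ m0 k hk) _ hdm
        · have h4 := (tlH_three_mul (n := n) (Nat.lt_succ_self k) (Nat.succ_lt_succ hk) hm).2.2.2
          rw [h, h4]
          simp only [mul_smul_comm, mul_sub, mul_add, ← mul_assoc]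
          have m1 := ih _ m0 k hk
          exact add_mem (sub_mem (Submodule.smul_mem _ _ (hmul _ m0 _ (by omega)))
            (Submodule.smul_mem _ _ (hmul _ m0 _ (by omega)))) (hmul _ m1 _ (by omega))
    · rcases Nat.lt_or_eq_of_le hdm with h | h
      · rw [(tlH_three_mul (n := n) h (Nat.lt_succ_self k) hm).1]
        simp only [mul_smul_comm, mul_sub, ← mul_assoc]
        exact sub_mem (Submodule.smul_mem _ _ (hmul _ m0 _ le_rfl))
          (Submodule.smul_mem _ _ (hmul _ (ih' h le_rfl _ m0) _ le_rfl))
      · rw [h, tlH_sq (Nat.lt_succ_self k) hm, mul_smul_comm]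
        exact Submodule.smul_mem _ _ (hmul _ m0 _ le_rfl)

theorem Z_one : Z n (1 : Equiv.Perm (Fin (n + 1))) = 1 := by
  obtain ⟨u, hu, he⟩ := simpleElt_spec (1 : Equiv.Perm (Fin (n + 1)))
  have h1 : IsNoncrossing (1 : Equiv.Perm (Fin (n + 1))) := fun m k h1 h2 => by
    simp at h2
    omega
  have h2 : u = [] := by
    rw [← List.length_eq_zero_iff, hu.2, h1.lenT_eq, excSet_one, Finset.card_empty]
  rw [Z_eq, he, h2]
  simp [braidTranspProd]

/-- The elements `Z_x` span the Temperley-Lieb algebra. -/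
theorem span_Z_eq_top :
    Submodule.span ℤ[T;T⁻¹] (Z n '' {x | IsNoncrossing x}) = ⊤ := by
  have h0 : zSpan n n = Submodule.span ℤ[T;T⁻¹] (Z n '' {x | IsNoncrossing x}) := by
    rw [zSpan]
    congr 2
    ext x
    exact ⟨fun h => h.1, fun h => ⟨h, fun k hk => by omega⟩⟩
  rw [← h0, eq_top_iff]
  rintro a -
  -- A submodule that contains the unit and is stable under right multiplication is everything.
  have key : ∀ z ∈ zSpan n n, z * a ∈ zSpan n n := by
    obtain ⟨f, rfl⟩ : ∃ f, tlMk n f = a := RingQuot.mkAlgHom_surjective _ _ a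
    induction f using FreeAlgebra.induction with
    | grade0 r =>
      intro z hz
      rw [AlgHom.commutes, Algebra.algebraMap_eq_smul_one, mul_smul_comm, mul_one]
      exact Submodule.smul_mem _ _ hz
    | grade1 i =>
      intro z hz
      have := mul_tlH_gen_mem le_rfl z hz i i.isLt
      rwa [tlH_self_succ i.isLt] at this
    | mul f g hf hg =>
      intro z hz
      rw [map_mul, ← mul_assoc]
      exact hg _ (hf _ hz)
    | add f g hf hg =>
      intro z hz
      rw [map_add, mul_add]
      exact add_mem (hf _ hz) (hg _ hz)
  have h1 : (1 : TL n) ∈ zSpan n n := by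
    rw [← Z_one]
    exact Z_mem_zSpan (fun m k h1 h2 => by simp at h2; omega) fun _ _ => rfl
  simpa using key 1 h1

end SpanTop

/-! ### The action of the Temperley-Lieb algebra on configurations of particles -/

section SpinOp

variable {R α : Type*} [CommRing R] [DecidableEq α]

/-- The Temperley-Lieb operator acting on the sites `p` and `q`. -/
def spinOp (v u : R) (p q : α) : Module.End R ((α → Bool) → R) where
  toFun F σ := if σ p = σ q then 0 else F (σ ∘ Equiv.swap p q) + (if σ p then v else u) * F σ
  map_add' F G := by
    ext σ
    simp only [Pi.add_apply]
    split_ifs <;> ring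
  map_smul' c F := by
    ext σ
    simp only [Pi.smul_apply, smul_eq_mul, RingHom.id_apply]
    split_ifs <;> ring

variable {v u : R} {p q r s : α}

theorem spinOp_apply (F : (α → Bool) → R) (σ : α → Bool) : spinOp v u p q F σ =
    if σ p = σ q then 0 else F (σ ∘ Equiv.swap p q) + (if σ p then v else u) * F σ := rfl

theorem comp_swap_comp_swap (σ : α → Bool) : (σ ∘ Equiv.swap p q) ∘ Equiv.swap p q = σ := by
  ext m
  simp

theorem spinOp_sq (hv : v * u = 1) : spinOp v u p q * spinOp v u p q = (v + u) • spinOp v u p q := by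
  ext F σ
  simp only [Module.End.mul_apply, LinearMap.smul_apply, Pi.smul_apply, spinOp_apply,
    comp_swap_comp_swap, Function.comp_apply, Equiv.swap_apply_left, Equiv.swap_apply_right,
    smul_eq_mul]
  cases σ p <;> cases σ q <;> simp <;> grind

theorem spinOp_comm (hpr : p ≠ r) (hps : p ≠ s) (hqr : q ≠ r) (hqs : q ≠ s) :
    spinOp v u p q * spinOp v u r s = spinOp v u r s * spinOp v u p q := by
  ext F σ
  have e : (σ ∘ Equiv.swap p q) ∘ Equiv.swap r s = (σ ∘ Equiv.swap r s) ∘ Equiv.swap p q := by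
    ext m
    simp only [Function.comp_apply, Equiv.swap_apply_def]
    split_ifs <;> simp_all
  simp only [Module.End.mul_apply, spinOp_apply, e, Function.comp_apply,
    Equiv.swap_apply_of_ne_of_ne hpr hps, Equiv.swap_apply_of_ne_of_ne hqr hqs,
    Equiv.swap_apply_of_ne_of_ne hpr.symm hqr.symm, Equiv.swap_apply_of_ne_of_ne hps.symm hqs.symm]
  cases σ p <;> cases σ q <;> cases σ r <;> cases σ s <;> simp <;> ring

theorem spinOp_braid (hv : v * u = 1) (hpq : p ≠ q) (hpr : p ≠ r) (hqr : q ≠ r) :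
    spinOp v u p q * spinOp v u q r * spinOp v u p q = spinOp v u p q ∧
      spinOp v u q r * spinOp v u p q * spinOp v u q r = spinOp v u q r := by
  constructor <;> ext F σ <;>
  simp only [Module.End.mul_apply, spinOp_apply, Function.comp_apply, Equiv.swap_apply_left,
    Equiv.swap_apply_right, Equiv.swap_apply_of_ne_of_ne hpq hpr,
    Equiv.swap_apply_of_ne_of_ne hpr.symm hqr.symm, comp_swap_comp_swap] <;>
  cases σ p <;> cases σ q <;> cases σ r <;> simp <;> grind

end SpinOp

/-! ### The particle representation and its matrix coefficients -/

section Rep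

variable {n : ℕ}

open LaurentPolynomial

/-- The representation of the Temperley-Lieb algebra on functions of configurations. -/
noncomputable def spinRep (n : ℕ) :
    TL n →ₐ[ℤ[T;T⁻¹]] Module.End ℤ[T;T⁻¹] ((Fin (n + 1) → Bool) → ℤ[T;T⁻¹]) :=
  RingQuot.liftAlgHom ℤ[T;T⁻¹] ⟨FreeAlgebra.lift ℤ[T;T⁻¹]
    fun i : Fin n => spinOp (T 1) (T (-1)) i.castSucc i.succ, by
      rintro _ _ (⟨i, j, h | h⟩ | ⟨i, j, h⟩ | ⟨i⟩)
      · have e : i.succ = j.castSucc := Fin.ext h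
        simp only [map_mul, FreeAlgebra.lift_ι_apply, e]
        refine (spinOp_braid T_mul_T_neg ?_ ?_ ?_).2 <;> simp [Fin.ext_iff] <;> omega
      · have e : j.succ = i.castSucc := Fin.ext h
        simp only [map_mul, FreeAlgebra.lift_ι_apply, e]
        refine (spinOp_braid T_mul_T_neg ?_ ?_ ?_).1 <;> simp [Fin.ext_iff] <;> omega
      · simp only [map_mul, FreeAlgebra.lift_ι_apply]
        apply spinOp_comm <;> simp [Fin.ext_iff] <;> omega
      · simp only [map_mul, map_smul, FreeAlgebra.lift_ι_apply]
        exact spinOp_sq T_mul_T_neg⟩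

theorem spinRep_tlGen (i : Fin n) :
    spinRep n (tlGen n i) = spinOp (T 1) (T (-1)) i.castSucc i.succ := by
  have h : spinRep n (tlGen n i) = FreeAlgebra.lift ℤ[T;T⁻¹]
      (fun i : Fin n => spinOp (T 1 : ℤ[T;T⁻¹]) (T (-1)) i.castSucc i.succ)
      (FreeAlgebra.ι _ i) := RingQuot.liftAlgHom_mkAlgHom_apply _ _ _ _
  rw [h, FreeAlgebra.lift_ι_apply]

/-- The product of the generators along a word. -/
noncomputable def tlWord (n : ℕ) (u : List (Fin n)) : TL n := (u.map (tlGen n)).prod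

/-- The matrix coefficients of the representation. -/
noncomputable def spinCoeff (σ τ : Fin (n + 1) → Bool) : TL n →ₗ[ℤ[T;T⁻¹]] ℤ[T;T⁻¹] :=
  LinearMap.proj σ ∘ₗ LinearMap.applyₗ (Pi.single τ 1) ∘ₗ (spinRep n).toLinearMap

theorem spinCoeff_nil (σ τ : Fin (n + 1) → Bool) :
    spinCoeff σ τ (tlWord n []) = if σ = τ then 1 else 0 := by
  simp [spinCoeff, tlWord, Pi.single_apply]

theorem spinCoeff_cons (σ τ : Fin (n + 1) → Bool) (i : Fin n) (u : List (Fin n)) :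
    spinCoeff σ τ (tlWord n (i :: u)) = if σ i.castSucc = σ i.succ then 0 else
      spinCoeff (σ ∘ simpleRefl n i) τ (tlWord n u) +
        (if σ i.castSucc then T 1 else T (-1)) * spinCoeff σ τ (tlWord n u) := by
  simp only [tlWord, List.map_cons, List.prod_cons, spinCoeff, LinearMap.comp_apply,
    AlgHom.toLinearMap_apply, map_mul, spinRep_tlGen, LinearMap.applyₗ_apply_apply,
    Module.End.mul_apply, LinearMap.proj_apply, spinOp_apply]
  rfl

/-- The sum of the positions of the particles. -/
def position (σ : Fin (n + 1) → Bool) : ℤ := ∑ m, if σ m then (m.val : ℤ) else 0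

theorem position_comp_simpleRefl (σ : Fin (n + 1) → Bool) (i : Fin n) :
    position (σ ∘ simpleRefl n i) = position σ + (if σ i.castSucc then 1 else 0) -
      if σ i.succ then 1 else 0 := by
  have h : position (σ ∘ simpleRefl n i) - position σ = (if σ i.castSucc then 1 else 0) -
      if σ i.succ then 1 else 0 := by
    have hne : i.castSucc ≠ i.succ := Fin.castSucc_lt_succ.ne
    rw [position, position, ← Finset.sum_sub_distrib, Finset.sum_eq_add i.castSucc i.succ hne]
    · simp only [Function.comp_apply, simpleRefl_apply_castSucc, simpleRefl_apply_succ,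
        Fin.val_castSucc, Fin.val_succ]
      split_ifs <;> simp
    · intro m _ hm
      rw [Function.comp_apply, simpleRefl, Equiv.swap_apply_of_ne_of_ne hm.1 hm.2, sub_self]
    · simp
    · simp
  omega

theorem position_le (σ : Fin (n + 1) → Bool) (u : List (Fin n)) :
    position σ ≤ position (σ ∘ wordProd n u) + u.length := by
  induction u generalizing σ with
  | nil => simp [wordProd]
  | cons i u ih =>
    have h1 := ih (σ ∘ simpleRefl n i)
    rw [position_comp_simpleRefl] at h1
    rw [wordProd_cons, Equiv.Perm.coe_mul, ← Function.comp_assoc, List.length_cons]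
    push_cast
    split_ifs at h1 <;> omega

/-- A letter lowers the sum of positions by at most one, so a word that is too short cannot connect
the two configurations. -/
theorem spinCoeff_eq_zero {σ τ : Fin (n + 1) → Bool} {u : List (Fin n)}
    (h : position τ + u.length < position σ) : spinCoeff σ τ (tlWord n u) = 0 := by
  induction u generalizing σ with
  | nil =>
    rw [spinCoeff_nil, if_neg]
    rintro rfl
    simp at h
  | cons i u ih =>
    rw [List.length_cons] at h
    push_cast at h
    have hp := position_comp_simpleRefl σ i
    rw [spinCoeff_cons, ih (σ := σ) (by omega), ih (σ := σ ∘ simpleRefl n i), mul_zero, add_zero,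
      ite_self]
    rw [hp]
    split_ifs <;> omega

/-- Without slack every letter must move a particle one step to the left. The diagonal terms of the
operators drop out, so no powers of `v` appear. -/
theorem spinCoeff_of_position_eq {σ τ : Fin (n + 1) → Bool} {u : List (Fin n)}
    (h : position σ = position τ + u.length) :
    spinCoeff σ τ (tlWord n u) = if σ ∘ wordProd n u = τ then 1 else 0 := by
  induction u generalizing σ with
  | nil =>
    rw [spinCoeff_nil]
    rfl
  | cons i u ih =>
    rw [List.length_cons] at h
    push_cast at h
    have hp := position_comp_simpleRefl σ i
    rw [spinCoeff_cons, spinCoeff_eq_zero (σ := σ) (by omega), mul_zero, add_zero, wordProd_cons,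
      Equiv.Perm.coe_mul, ← Function.comp_assoc]
    by_cases hσ : σ i.castSucc = false ∧ σ i.succ = true
    · rw [hσ.1, hσ.2] at hp
      simp only [hσ.1, hσ.2, Bool.false_eq_true, if_false]
      apply ih
      simp at hp
      omega
    · have hp' : position σ ≤ position (σ ∘ simpleRefl n i) := by
        rw [hp]
        cases h1 : σ i.castSucc <;> cases h2 : σ i.succ <;> simp_all
      have hne : (σ ∘ simpleRefl n i) ∘ wordProd n u ≠ τ := fun he => by
        have := position_le (σ ∘ simpleRefl n i) u
        rw [he] at this
        omega
      rw [if_neg hne, spinCoeff_eq_zero (by omega), ite_self]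

/-- A word all of whose letters move a particle preserves the orders of the particles and of
the holes. -/
theorem wordProd_lt_of_position_eq {σ τ : Fin (n + 1) → Bool} {u : List (Fin n)}
    (h : position σ = position τ + u.length) (hτ : σ ∘ wordProd n u = τ) {a b : Fin (n + 1)}
    (hab : a < b) (he : τ a = τ b) : wordProd n u a < wordProd n u b := by
  induction u generalizing σ with
  | nil => simpa [wordProd] using hab
  | cons i u ih =>
    rw [List.length_cons] at h
    push_cast at h
    rw [wordProd_cons, Equiv.Perm.coe_mul, ← Function.comp_assoc] at hτ
    have hp := position_comp_simpleRefl σ i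
    have hle := position_le (σ ∘ simpleRefl n i) u
    rw [hτ] at hle
    have hσ : σ i.castSucc = false ∧ σ i.succ = true := by
      cases h1 : σ i.castSucc <;> cases h2 : σ i.succ <;> simp [h1, h2] at hp ⊢ <;> omega
    have hlt := ih (σ := σ ∘ simpleRefl n i) (by rw [hp, hσ.1, hσ.2]; simp; omega) hτ
    rw [wordProd_cons, Equiv.Perm.mul_apply, Equiv.Perm.mul_apply, Fin.lt_def,
      simpleRefl_apply_val, simpleRefl_apply_val]
    have hne : ¬ ((wordProd n u a).val = i.val ∧ (wordProd n u b).val = i.val + 1) := by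
      rintro ⟨h1, h2⟩
      have h1 : wordProd n u a = i.castSucc := Fin.ext h1
      have h2 : wordProd n u b = i.succ := Fin.ext h2
      have h3 := congrFun hτ a
      have h4 := congrFun hτ b
      simp only [Function.comp_apply, h1, h2, simpleRefl_apply_castSucc,
        simpleRefl_apply_succ] at h3 h4
      rw [← h3, ← h4, hσ.1, hσ.2] at he
      simp at he
    split_ifs <;> omega

end Rep

/-! ### Unitriangular coefficients and the surjection onto a free module -/

section Rank

variable {n : ℕ}

open LaurentPolynomial

/-- The configuration of the excedances. -/
def excState (w : Equiv.Perm (Fin (n + 1))) (m : Fin (n + 1)) : Bool := decide (m < w m)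

/-- The configuration of the excedance values. -/
def excValState (w : Equiv.Perm (Fin (n + 1))) (m : Fin (n + 1)) : Bool := decide (w⁻¹ m < m)

theorem excValState_comp (w : Equiv.Perm (Fin (n + 1))) : excValState w ∘ w = excState w := by
  ext m
  simp [excValState, excState]

theorem position_excValState (w : Equiv.Perm (Fin (n + 1))) :
    position (excValState w) = position (excState w) + displacement w := by
  have h : position (excValState w) = ∑ m, if excState w m then ((w m).val : ℤ) else 0 := by
    rw [position, ← Equiv.sum_comp w]
    simp only [← excValState_comp, Function.comp_apply]
  rw [h, position, displacement, Nat.cast_sum, ← Finset.sum_add_distrib]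
  refine Finset.sum_congr rfl fun m _ => ?_
  by_cases hm : m < w m
  · simp only [excState, hm, decide_true, if_true]
    omega
  · simp only [excState, hm, decide_false, Bool.false_eq_true, if_false]
    omega

theorem IsIncreasing.exists_word {w : Equiv.Perm (Fin (n + 1))} (h : IsIncreasing w) :
    ∃ u, wordProd n u = w ∧ u.length = displacement w := by
  obtain ⟨p, h1, h2, h3, h4, -⟩ := h.exists_isCanonicalForm
  exact ⟨_, h4, by rw [(runProd_spec p h1 h2 h3).2.2.2.2, runProd, h4]⟩

/-- The two configurations are exactly `displacement w` apart. A shorter word gives zero; a word of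
this length that connects them preserves the order of particles and of holes, as does `w`, so it
represents `w`. -/
theorem IsIncreasing.spinCoeff_eq {w w' : Equiv.Perm (Fin (n + 1))} (h : IsIncreasing w)
    {u : List (Fin n)} (hu : wordProd n u = w') (hl : u.length = displacement w')
    (hd : displacement w' ≤ displacement w) :
    spinCoeff (excValState w) (excState w) (tlWord n u) = if w = w' then 1 else 0 := by
  have hp := position_excValState w
  rcases lt_or_eq_of_le hd with hd | hd
  · rw [spinCoeff_eq_zero (by omega), if_neg]
    rintro rfl
    exact lt_irrefl _ hd
  have hpos : position (excValState w) = position (excState w) + u.length := by omega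
  rw [spinCoeff_of_position_eq hpos, hu]
  by_cases hw : excValState w ∘ w' = excState w
  · rw [if_pos hw, if_pos]
    have hlt := fun a b hab he => wordProd_lt_of_position_eq hpos (hu ▸ hw) (a := a) (b := b) hab he
    rw [hu] at hlt
    have hcomp := excValState_comp w
    have key : ∀ (f g : Equiv.Perm (Fin (n + 1))), excValState w ∘ f = excState w →
        excValState w ∘ g = excState w → ∀ a, ∃ b, excState w b = excState w a ∧ g b = f a := by
      intro f g hf hg a
      refine ⟨g⁻¹ (f a), ?_, perm_apply_inv_self _ _⟩
      rw [← congrFun hg, ← congrFun hf, Function.comp_apply, Function.comp_apply,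
        perm_apply_inv_self]
    ext a
    congr 1
    refine eq_of_strictMonoOn (fun m => excState w m = excState w a) (fun c d hcd hc hd => ?_)
      (fun c d hcd hc hd => hlt c d hcd (hc.trans hd.symm)) (fun c hc => ?_) (fun c hc => ?_) a rfl
    · have he := hc.trans hd.symm
      simp only [excState, decide_eq_decide] at he
      by_cases h1 : c < w c
      · exact h.1 c d hcd h1 (he.mp h1)
      · exact h.2 c d hcd (not_lt.mp h1) (not_lt.mp fun h2 => h1 (he.mpr h2))
    · obtain ⟨b, hb, hb'⟩ := key w w' hcomp hw c
      exact ⟨b, hb.trans hc, hb'⟩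
    · obtain ⟨b, hb, hb'⟩ := key w' w hw hcomp c
      exact ⟨b, hb.trans hc, hb'⟩
  · rw [if_neg hw, if_neg]
    rintro rfl
    exact hw (excValState_comp w)

/-- The coordinates indexed by the fully commutative elements. -/
noncomputable def tlCoord (n : ℕ) : TL n →ₗ[ℤ[T;T⁻¹]]
    ({w : Equiv.Perm (Fin (n + 1)) // IsFullyCommutative n w} → ℤ[T;T⁻¹]) :=
  LinearMap.pi fun w => spinCoeff (excValState w.1) (excState w.1)

/-- A word for `w` has the coordinate vector of `w` up to entries of smaller displacement, so the
unit vectors are reached by induction on the displacement. -/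
theorem tlCoord_surjective : Function.Surjective (tlCoord n) := by
  classical
  have expand : ∀ f : {w : Equiv.Perm (Fin (n + 1)) // IsFullyCommutative n w} → ℤ[T;T⁻¹],
      (∀ w, f w ≠ 0 → Pi.single w 1 ∈ LinearMap.range (tlCoord n)) →
      f ∈ LinearMap.range (tlCoord n) := by
    intro f hf
    rw [← Finset.univ_sum_single f]
    refine Submodule.sum_mem _ fun w _ => ?_
    by_cases hw : f w = 0
    · rw [hw, Pi.single_zero]
      exact Submodule.zero_mem _
    · rw [show f w = f w • 1 by simp, Pi.single_smul]
      exact Submodule.smul_mem _ _ (hf w hw)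
  have key : ∀ w : {w : Equiv.Perm (Fin (n + 1)) // IsFullyCommutative n w},
      Pi.single w 1 ∈ LinearMap.range (tlCoord n) := by
    intro w
    induction hd : displacement w.1 using Nat.strong_induction_on generalizing w with | _ k ih
    subst hd
    obtain ⟨u, hu, hl⟩ := (isFullyCommutative_iff.mp w.2).exists_word
    have hdiff : tlCoord n (tlWord n u) - Pi.single w 1 ∈ LinearMap.range (tlCoord n) := by
      refine expand _ fun w' hw' => ih _ ?_ w' rfl
      by_contra! hc
      apply hw'
      rw [Pi.sub_apply, tlCoord, LinearMap.pi_apply,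
        (isFullyCommutative_iff.mp w'.2).spinCoeff_eq hu hl hc, Pi.single_apply, sub_eq_zero]
      simp only [Subtype.ext_iff]
    have h2 := sub_mem (LinearMap.mem_range_self (tlCoord n) (tlWord n u)) hdiff
    rwa [sub_sub_cancel] at h2
  intro f
  exact LinearMap.mem_range.mp (expand f fun w _ => key w)

end Rank

/-! ### The basis `X_w` -/

section Basis

variable {n : ℕ}

open LaurentPolynomial

/-- The exponent of `v` vanishes at ψ(w), leaving a sign. -/
theorem coeff_psi (w : Equiv.Perm (Fin (n + 1))) : IsUnit (coeff n w (psi n w)) := by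
  rw [coeff, beta, sub_self]
  refine IsUnit.mul ?_ ?_
  · exact ((Units.isUnit _).map (Int.castRingHom ℤ)).map (C : ℤ →+* ℤ[T;T⁻¹])
  · simp

/-- Downward induction on the weight solves X_w for Z_{ψ(w)}, all other terms being heavier; ψ
reaches every noncrossing permutation. -/
theorem span_X_eq_top : Submodule.span ℤ[T;T⁻¹] (Set.range
    fun w : {w : Equiv.Perm (Fin (n + 1)) // IsFullyCommutative n w} => X n w) = ⊤ := by
  classical
  rw [eq_top_iff, ← span_Z_eq_top, Submodule.span_le]
  obtain ⟨N, hN⟩ : ∃ N : ℤ, ∀ x : Equiv.Perm (Fin (n + 1)), weight x ≤ N := by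
    obtain ⟨x, -, hx⟩ := Finset.exists_max_image Finset.univ
      (weight : Equiv.Perm (Fin (n + 1)) → ℤ) ⟨1, by simp⟩
    exact ⟨_, fun y => hx y (by simp)⟩
  rintro _ ⟨x, hx, rfl⟩
  induction hk : (N - weight x).toNat using Nat.strong_induction_on generalizing x with | _ k ih
  subst hk
  obtain ⟨w, hw, rfl⟩ := bijOn_psi.surjOn (mem_NC_iff.mpr hx)
  obtain ⟨c, hc⟩ := coeff_psi (n := n) w
  have hX := Finset.add_sum_erase (Finset.univ.filter (· ∈ Q n w)) (fun x => coeff n w x • Z n x)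
    (by simpa using psi_mem_Q w)
  have e : Z n (psi n w) = (↑c⁻¹ : ℤ[T;T⁻¹]) • (X n w -
      ∑ x ∈ (Finset.univ.filter (· ∈ Q n w)).erase (psi n w), coeff n w x • Z n x) := by
    have : X n w = _ := hX.symm
    rw [this, add_sub_cancel_right, smul_smul, ← hc, Units.inv_mul, one_smul]
  rw [e]
  refine Submodule.smul_mem _ _ (sub_mem (Submodule.subset_span ⟨⟨w, hw⟩, rfl⟩)
    (Submodule.sum_mem _ fun x hx => Submodule.smul_mem _ _ ?_))
  simp only [Finset.mem_erase, Finset.mem_filter, Finset.mem_univ, true_and] at hx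
  obtain ⟨h1, h2⟩ := Q_spec hw hx.2
  have h3 := h2.resolve_left hx.1
  have := hN x
  exact ih _ (by omega) x h1 rfl

/-- Linear combination of the X_w followed by `tlCoord` is a surjective endomorphism of a finite
free module over a commutative ring, hence injective, and so is its first factor. -/
theorem linearIndependent_X : LinearIndependent ℤ[T;T⁻¹]
    fun w : {w : Equiv.Perm (Fin (n + 1)) // IsFullyCommutative n w} => X n w := by
  classical
  set g := Fintype.linearCombination ℤ[T;T⁻¹]
    fun w : {w : Equiv.Perm (Fin (n + 1)) // IsFullyCommutative n w} => X n w with hg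
  have h1 : Function.Surjective g := by
    rw [← LinearMap.range_eq_top, Fintype.range_linearCombination, span_X_eq_top]
  have h2 : Function.Surjective (tlCoord n ∘ₗ g) := by
    rw [LinearMap.coe_comp]
    exact tlCoord_surjective.comp h1
  have h3 := OrzechProperty.injective_of_surjective_endomorphism _ h2
  rw [LinearMap.coe_comp] at h3
  exact linearIndependent_iff_injective_fintypeLinearCombination.mpr h3.of_comp

end Basis

end TLBasis

theorem mainTheorem2 (n : ℕ) :
    (Set.BijOn (TLBasis.psi n) {w | TLBasis.IsFullyCommutative n w} (TLBasis.NC n) ∧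
      ∀ w, TLBasis.IsFullyCommutative n w →
        ∀ x, TLBasis.Corresponds n w x ↔ x = TLBasis.psi n w) ∧
    (∀ x ∈ TLBasis.NC n, ∀ u, TLBasis.IsReducedTranspWord n x u →
      TLBasis.braidTranspProd n u = TLBasis.simpleElt n x) ∧
    (∀ w, TLBasis.IsFullyCommutative n w → TLBasis.Q n w ⊆ TLBasis.NC n) ∧
    ∃ B : Module.Basis {w : Equiv.Perm (Fin (n + 1)) // TLBasis.IsFullyCommutative n w}
        (LaurentPolynomial ℤ) (TLBasis.TL n),
      ∀ w, B w = TLBasis.X n w := by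
  refine ⟨⟨TLBasis.bijOn_psi, fun w hw => TLBasis.corresponds_iff_eq_psi hw⟩,
    fun x hx => (TLBasis.mem_NC_iff.mp hx).liftsUniquely, fun w hw => TLBasis.Q_subset_NC hw,
    Module.Basis.mk TLBasis.linearIndependent_X TLBasis.span_X_eq_top.ge, fun w => ?_⟩
  rw [Module.Basis.mk_apply]
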